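/- A $k$-ranking of a graph $G$ is a labeling $f:V(G)\to\{1,\dots,k\}$ such that every path joining two distinct vertices with the same label passes through a vertex with a larger label; the rank number of $G$ is the least $k$ for which $G$ has a $k$-ranking. Let $r(m,n)$ be the rank number of the $m\times n$ grid graph (the Cartesian product of paths with $m$ and $n$ vertices). For a positive integer $N$ let $b(N)=2b_2+b_3$, where $b_i$ is the $i$th most significant binary digit of $N$. Theorem. Let $n>8$. (1) If $n=2^k+2^{k-2}-2$ or $n=2^k+2^{k-2}-1$ for some integer $k\ge 2$, then $r(4,n)=4k-2$. If $n$ is of neither form, then $$r(4,n)=4\lfloor\log_2(n+1)\rfloor-3+b(n+1).$$ (2) Let $I$ be the set of all integers that lie, for some integer $k\ge 4$, in $$[2^k-1,\,2^k]\cup\{2^k+2^{k-2}-2\}\cup[2^k+2^{k-1}-1,\,2^k+2^{k-1}]\cup[2^k+2^{k-1}+2^{k-2}-1,\,2^k+2^{k-1}+2^{k-2}].$$ Then $$r(4,n)=\begin{cases}5+r\left(4,\lceil\frac{n-4}{2}\rceil\right)&\text{if } n\in I,\\[2pt] 4+r\left(4,\lceil\frac{n-4}{2}\rceil\right)&\text{if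 } n\notin I.\end{cases}$$ -/

import Mathlib

/-- `f` is a `k`-ranking of `G`: the labels lie in `{1, …, k}`, and every path joining two distinct
vertices with the same label passes through a vertex with a larger label. -/
def IsRanking {V : Type*} (G : SimpleGraph V) (k : ℕ) (f : V → ℕ) : Prop :=
  (∀ v, 1 ≤ f v ∧ f v ≤ k) ∧
    ∀ u v, u ≠ v → f u = f v → ∀ p : G.Walk u v, p.IsPath → ∃ w ∈ p.support, f u < f w

/-- The rank number of `G`: the least `k` for which `G` has a `k`-ranking. -/
noncomputable def rankNumber {V : Type*} (G : SimpleGraph V) : ℕ :=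
  sInf {k | ∃ f : V → ℕ, IsRanking G k f}

/-- On a finite graph the set of which `rankNumber` is the infimum is nonempty. -/
theorem exists_isRanking {V : Type*} [Finite V] (G : SimpleGraph V) :
    {k | ∃ f : V → ℕ, IsRanking G k f}.Nonempty := by
  obtain ⟨n, ⟨e⟩⟩ := Finite.exists_equiv_fin V
  refine ⟨n, fun v => (e v : ℕ) + 1, fun v => ⟨Nat.le_add_left 1 _, (e v).isLt⟩, ?_⟩
  intro u v huv h
  exact absurd (e.injective (Fin.ext (by simpa using h))) huv

/-- The `m × n` grid graph, the Cartesian product of paths with `m` and `n` vertices. -/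
def gridGraph (m n : ℕ) : SimpleGraph (Fin m × Fin n) :=
  SimpleGraph.boxProd (SimpleGraph.pathGraph m) (SimpleGraph.pathGraph n)

/-- `r(m, n)`, the rank number of the `m × n` grid. -/
noncomputable def gridRank (m n : ℕ) : ℕ := rankNumber (gridGraph m n)

/-- The `i`-th most significant binary digit of `n` (`i = 1` is the leading digit;
`0` if `n` has fewer than `i` binary digits). -/
def msBit (i n : ℕ) : ℕ :=
  if i ≤ Nat.size n ∧ n.testBit (Nat.size n - i) = true then 1 else 0

/-- `b(n) = 2 b₂ + b₃`, where `bᵢ` is the `i`-th most significant bit of `n`. -/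
def bitTerm (n : ℕ) : ℕ := 2 * msBit 2 n + msBit 3 n

/-- The exceptional set of the recursion. -/
def exceptionalSet : Set ℕ :=
  {n | ∃ k : ℕ, 4 ≤ k ∧
    (n ∈ Set.Icc (2 ^ k - 1) (2 ^ k) ∨
      n = 2 ^ k + 2 ^ (k - 2) - 2 ∨
      n ∈ Set.Icc (2 ^ k + 2 ^ (k - 1) - 1) (2 ^ k + 2 ^ (k - 1)) ∨
      n ∈ Set.Icc (2 ^ k + 2 ^ (k - 1) + 2 ^ (k - 2) - 1) (2 ^ k + 2 ^ (k - 1) + 2 ^ (k - 2)))}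

/-! ### Rankings of vertex sets -/

/-! Ranking a set with t labels amounts to destroying it by deletions: in a connected set the
largest label occurs only once, and deleting its cell saves one label. Conversely, a deleted cell
costs one label, and parts without edges between them are ranked independently.

Upper bound. Four cells, one in each row and shifted by at most one column between neighbouring
rows, cut the strip at the price of four labels. If the end pieces and a parallel slanted middle
piece are ranked, gluing along such profiles doubles the width and adds four labels
(`UpperBlock.step`). Starting from small explicit rankings, this gives rectangles of widths 8u-2,
10u-3, 12u-2 and 14u-2, where u = 2^j, with 8+4j, 9+4j, 10+4j and 11+4j labels (`rankable_rects`).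

Lower bound. These widths are optimal. Suppose a wide region has a ranking with t labels, and delete
up to seven cells of largest label one after another, stopping when two untouched full columns are
separated (`exists_survives`). If seven deletions separate nothing, one half of the region contains
at most three of them, so this half is rankable with t-4 labels: the deletions inside it isolate
only small pockets, which can be filled in again. Otherwise at most six deletions contain a cut P of
4, 5 or 6 cells, and each side of P is rankable with t-|P| labels (`IsCut`). The cut is narrow, so
one side contains a shape already known not to be rankable. Rectangles alone lose too much at
slanted cuts; the induction therefore carries rectangles with a few extra cells at the ends
(`LowerBlock`) and doubles their width every four labels.

The induction starts from shapes excluded by certificates: a connected set is not rankable with t+1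
labels if it contains sets not rankable with t labels that have no cell in common
(`not_rankable_of_check`). The shapes for nine, ten and eleven labels come from these by cut
arguments; nine labels need a separate treatment.

The two bounds give r(4, n) on four consecutive intervals in each block 8u ≤ n+1 < 16u
(`gridRank_values`). Both the formula and the recursion are read off from these values. -/

/-- `u` and `v` are joined by a walk of `G` inside `A`. -/
def ConnIn {V : Type*} (G : SimpleGraph V) (A : Set V) (u v : V) : Prop :=
  Relation.ReflTransGen (fun a b => G.Adj a b ∧ a ∈ A ∧ b ∈ A) u v

/-- The subgraph of `G` induced by `A` has a ranking with labels `1, …, t`. -/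
def Rankable {V : Type*} (G : SimpleGraph V) (A : Set V) (t : ℕ) : Prop :=
  ∃ f : V → ℕ, (∀ v ∈ A, 1 ≤ f v ∧ f v ≤ t) ∧
    ∀ u ∈ A, ∀ v ∈ A, f u = f v → ConnIn G {x | x ∈ A ∧ f x ≤ f u} u v → u = v

section Rankable

variable {V V' : Type*} {G : SimpleGraph V} {G' : SimpleGraph V'} {A B C : Set V} {t s : ℕ}

theorem ConnIn.refl (u : V) : ConnIn G A u u := Relation.ReflTransGen.refl

theorem ConnIn.trans {u v w : V} (h : ConnIn G A u v) (h' : ConnIn G A v w) : ConnIn G A u w :=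
  Relation.ReflTransGen.trans h h'

theorem ConnIn.symm {u v : V} (h : ConnIn G A u v) : ConnIn G A v u := by
  induction h with
  | refl => exact .refl _
  | tail _ hab ih => exact Relation.ReflTransGen.head ⟨hab.1.symm, hab.2.2, hab.2.1⟩ ih

theorem ConnIn.single {u v : V} (h : G.Adj u v) (hu : u ∈ A) (hv : v ∈ A) : ConnIn G A u v :=
  Relation.ReflTransGen.single ⟨h, hu, hv⟩

theorem ConnIn.mono {u v : V} (h : ConnIn G A u v) (hAB : A ⊆ B) : ConnIn G B u v := by
  induction h with
  | refl => exact .refl _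
  | tail _ hab ih => exact Relation.ReflTransGen.tail ih ⟨hab.1, hAB hab.2.1, hAB hab.2.2⟩

/-- A walk inside `A` that starts in a set closed under adjacency in `A` stays there. -/
theorem ConnIn.closed (hC : ∀ a ∈ C, ∀ b ∈ A, G.Adj a b → b ∈ C) {u v : V} (hu : u ∈ C)
    (h : ConnIn G A u v) : v ∈ C ∧ ConnIn G (A ∩ C) u v := by
  induction h with
  | refl => exact ⟨hu, .refl _⟩
  | tail _ hab ih =>
    have := hC _ ih.1 _ hab.2.2 hab.1
    exact ⟨this, ih.2.trans (.single hab.1 ⟨hab.2.1, ih.1⟩ ⟨hab.2.2, this⟩)⟩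

theorem ConnIn.mem {u v : V} (hu : u ∈ A) (h : ConnIn G A u v) : v ∈ A :=
  (ConnIn.closed (C := A) (fun _ _ _ hb _ => hb) hu h).1

theorem ConnIn.map {A' : Set V'} {u v : V} (h : ConnIn G A u v) (φ : V → V')
    (hφ : ∀ a ∈ A, ∀ b ∈ A, G.Adj a b → G'.Adj (φ a) (φ b)) (hA : ∀ a ∈ A, φ a ∈ A') : ConnIn G' A' (φ u) (φ v) := by
  induction h with
  | refl => exact .refl _
  | tail _ hab ih =>
    exact ih.trans (.single (hφ _ hab.2.1 _ hab.2.2 hab.1) (hA _ hab.2.1) (hA _ hab.2.2))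

/-- A ranking is pulled back along an injective homomorphism, because connections inside a sublevel
set are mapped to such connections. All translations, reflections and inclusions below go through
this. -/
theorem Rankable.comap {A' : Set V'} (h : Rankable G' A' t) (φ : V → V') (hinj : Set.InjOn φ A)
    (hφ : ∀ a ∈ A, ∀ b ∈ A, G.Adj a b → G'.Adj (φ a) (φ b)) (hA : ∀ a ∈ A, φ a ∈ A') :
    Rankable G A t := by
  obtain ⟨f, hf, hf'⟩ := h
  refine ⟨fun v => f (φ v), fun v hv => hf _ (hA _ hv), fun u hu v hv huv hc => ?_⟩
  refine hinj hu hv (hf' _ (hA _ hu) _ (hA _ hv) huv ?_)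
  exact hc.map φ (fun a ha b hb => hφ a ha.1 b hb.1) (fun a ha => ⟨hA _ ha.1, ha.2⟩)

theorem Rankable.mono (h : Rankable G B t) (hAB : A ⊆ B) : Rankable G A t :=
  h.comap id (fun _ _ _ _ h => h) (fun _ _ _ _ h => h) hAB

theorem Rankable.mono_right (h : Rankable G A t) (hts : t ≤ s) : Rankable G A s := by
  obtain ⟨f, hf, hf'⟩ := h
  exact ⟨f, fun v hv => ⟨(hf v hv).1, (hf v hv).2.trans hts⟩, hf'⟩

theorem rankable_empty : Rankable G ∅ t :=
  ⟨fun _ => 0, fun _ h => h.elim, fun _ h => h.elim⟩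

theorem Rankable.eq_empty (h : Rankable G A 0) : A = ∅ := by
  obtain ⟨f, hf, -⟩ := h
  refine Set.eq_empty_of_forall_notMem fun v hv => ?_
  have := hf v hv
  omega

theorem Rankable.of_diff_singleton {v : V} (h : Rankable G (A \ {v}) t) :
    Rankable G A (t + 1) := by
  classical
  obtain ⟨f, hf, hf'⟩ := h
  refine ⟨fun x => if x = v then t + 1 else f x, fun x hx => ?_, fun x hx y hy hxy hc => ?_⟩
  · by_cases h : x = v
    · simp [h]
    · have := hf x ⟨hx, h⟩
      simp only [h, if_false]; omega
  · by_cases h : x = v <;> by_cases h' : y = v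
    · rw [h, h']
    · have := hf y ⟨hy, h'⟩
      simp only [h, h', if_true, if_false] at hxy; omega
    · have := hf x ⟨hx, h⟩
      simp only [h, h', if_true, if_false] at hxy; omega
    · simp only [h, h', if_false] at hxy hc
      refine hf' x ⟨hx, h⟩ y ⟨hy, h'⟩ hxy (hc.mono fun z hz => ?_)
      have hzv : z ≠ v := by
        rintro rfl
        have h1 := hz.2
        have h2 := (hf x ⟨hx, h⟩).2
        simp only [if_true] at h1; omega
      have h1 := hz.2
      simp only [hzv, if_false] at h1
      exact ⟨⟨hz.1, hzv⟩, h1⟩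

theorem Rankable.of_diff_finset (H : Finset V) (h : Rankable G (A \ H) t) :
    Rankable G A (t + H.card) := by
  classical
  induction H using Finset.induction_on generalizing t with
  | empty => simpa using h
  | insert a H ha ih =>
    rw [Finset.card_insert_of_notMem ha, ← add_assoc, add_right_comm]
    apply ih
    apply Rankable.of_diff_singleton (v := a)
    refine h.mono fun x hx => ⟨hx.1.1, ?_⟩
    simp only [Finset.coe_insert, Set.mem_insert_iff, not_or]
    exact ⟨hx.2, hx.1.2⟩

theorem rankable_of_card_le (hA : A.Finite) (h : A.ncard ≤ t) : Rankable G A t := by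
  have h0 : Rankable G (A \ hA.toFinset) 0 := by
    rw [hA.coe_toFinset, Set.sdiff_self]
    exact rankable_empty
  have := h0.of_diff_finset
  rw [← Set.ncard_eq_toFinset_card A hA, zero_add] at this
  exact this.mono_right h

theorem Rankable.union (hA : Rankable G A t) (hB : Rankable G B t)
    (hAB : ∀ a ∈ A, ∀ b ∈ B, ¬ G.Adj a b) : Rankable G (A ∪ B) t := by
  classical
  -- The sets may overlap; the labels of `A` are used on the overlap.
  have hB' : Rankable G (B \ A) t := hB.mono Set.sdiff_subset
  obtain ⟨f, hf, hf'⟩ := hA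
  obtain ⟨g, hg, hg'⟩ := hB'
  refine ⟨fun x => if x ∈ A then f x else g x, fun x hx => ?_, fun x hx y hy hxy hc => ?_⟩
  · by_cases h : x ∈ A
    · simpa [h] using hf x h
    · simpa [h] using hg x ⟨hx.resolve_left h, h⟩
  · by_cases h : x ∈ A
    · obtain ⟨h1, h2⟩ := ConnIn.closed (C := A) (fun a ha b hb hadj => by
        by_contra hbA
        exact hAB a ha b (hb.1.resolve_left hbA) hadj) h hc
      simp only [h, h1, if_true] at hxy h2
      refine hf' x h y h1 hxy (h2.mono fun z hz => ⟨hz.2, ?_⟩)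
      simpa [hz.2] using hz.1.2
    · have hx' : x ∈ B \ A := ⟨hx.resolve_left h, h⟩
      obtain ⟨h1, h2⟩ := ConnIn.closed (C := B \ A) (fun a ha b hb hadj => by
        by_cases hbA : b ∈ A
        · exact absurd hadj.symm (hAB b hbA a ha.1)
        · exact ⟨hb.1.resolve_left hbA, hbA⟩) hx' hc
      simp only [h, h1.2, if_false] at hxy h2
      refine hg' x hx' y h1 hxy (h2.mono fun z hz => ⟨hz.2, ?_⟩)
      simpa [hz.2.2] using hz.1.2

/-- A connected ranked set has a vertex whose deletion saves a label. -/
theorem Rankable.exists_diff_singleton (h : Rankable G A (t + 1)) (hne : A.Nonempty)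
    (hconn : ∀ u ∈ A, ∀ v ∈ A, ConnIn G A u v) : ∃ v ∈ A, Rankable G (A \ {v}) t := by
  obtain ⟨f, hf, hf'⟩ := h
  -- The label `t + 1` need not occur, so the largest label in use is taken; by connectedness only
  -- one vertex has it.
  obtain ⟨v, hv, hmax⟩ : ∃ v ∈ A, ∀ u ∈ A, f u ≤ f v := by
    have hfin : (f '' A).Finite := (Set.finite_Iic (t + 1)).subset (by
      rintro _ ⟨u, hu, rfl⟩; exact (hf u hu).2)
    obtain ⟨_, ⟨v, hv, rfl⟩, hm⟩ := Set.exists_max_image _ id hfin (hne.image f)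
    exact ⟨v, hv, fun u hu => hm _ ⟨u, hu, rfl⟩⟩
  refine ⟨v, hv, f, fun u hu => ⟨(hf u hu.1).1, ?_⟩, fun x hx y hy hxy hc => ?_⟩
  · have h1 := hmax u hu.1
    have h2 := (hf v hv).2
    have h3 : f u ≠ f v := fun he => hu.2 (by
      refine (hf' u hu.1 v hv he ?_)
      refine (hconn u hu.1 v hv).mono fun z hz => ⟨hz, ?_⟩
      rw [he]; exact hmax z hz)
    omega
  · exact hf' x hx.1 y hy.1 hxy (hc.mono fun z hz => ⟨hz.1.1, hz.2⟩)

/-- Deleted vertices and small pockets cost no more than their number. -/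
theorem Rankable.fill {H : Finset V} (hC : Rankable G C (t - H.card))
    (hH : H.card ≤ t) (hclosed : ∀ a ∈ C, ∀ b ∈ A \ H, G.Adj a b → b ∈ C)
    (hfin : (A \ C).Finite) (hdisj : ∀ v ∈ H, v ∈ A \ C) (hcard : (A \ C).ncard ≤ t) :
    Rankable G A t := by
  have key : Rankable G (A \ H) (t - H.card) := by
    -- The pockets are small enough to give all their vertices different labels.
    have hP : Rankable G ((A \ C) \ H) (t - H.card) := by
      refine rankable_of_card_le (hfin.subset Set.sdiff_subset) ?_
      rw [Set.ncard_sdiff (fun v hv => hdisj v hv), Set.ncard_coe_finset]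
      omega
    refine (hC.mono (Set.inter_subset_left : C ∩ (A \ H) ⊆ C)).union hP ?_ |>.mono ?_
    · intro a ha b hb hadj
      exact hb.1.2 (hclosed a ha.1 b ⟨hb.1.1, hb.2⟩ hadj)
    · intro x hx
      by_cases hxC : x ∈ C
      · exact Or.inl ⟨hxC, hx⟩
      · exact Or.inr ⟨⟨hx.1, hxC⟩, hx.2⟩
  have := key.of_diff_finset
  rwa [Nat.sub_add_cancel hH] at this

/-- A walk inside a sublevel set can be shortened to a path, and a path without a larger label is
such a walk. Paths may thus be replaced by connectedness, which behaves well under restriction. -/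
theorem isRanking_iff {k : ℕ} :
    (∃ f : V → ℕ, IsRanking G k f) ↔ Rankable G Set.univ k := by
  classical
  constructor
  · rintro ⟨f, hf, hf'⟩
    refine ⟨f, fun v _ => hf v, fun u _ v hv huv hc => ?_⟩
    by_contra hne
    clear hv
    obtain ⟨p, hp⟩ : ∃ p : G.Walk u v, ∀ w ∈ p.support, f w ≤ f u := by
      clear hne huv
      induction hc with
      | refl => exact ⟨.nil, by simp⟩
      | tail _ hab ih =>
        obtain ⟨p, hp⟩ := ih
        refine ⟨p.concat hab.1, fun w hw => ?_⟩
        rw [SimpleGraph.Walk.support_concat, List.mem_append] at hw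
        rcases hw with hw | hw
        · exact hp w hw
        · rw [List.mem_singleton] at hw
          subst hw
          exact hab.2.2.2
    obtain ⟨w, hw, hlt⟩ := hf' u v hne huv p.bypass p.bypass_isPath
    exact absurd (hp w (p.support_bypass_subset_support hw)) (not_le.2 hlt)
  · rintro ⟨f, hf, hf'⟩
    refine ⟨f, fun v => hf v trivial, fun u v hne huv p _ => ?_⟩
    by_contra! hno
    refine hne (hf' u trivial v trivial huv ?_)
    clear hne huv
    have : ∀ {a b : V} (p : G.Walk a b), (∀ w ∈ p.support, f w ≤ f u) →
        ConnIn G {x | x ∈ Set.univ ∧ f x ≤ f u} a b := by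
      intro a b p hp
      induction p with
      | nil => exact .refl _
      | cons hadj p ih =>
        refine ConnIn.trans (.single hadj ⟨trivial, hp _ (by simp)⟩ ⟨trivial, hp _ (by simp)⟩) ?_
        exact ih fun w hw => hp w (by simp [hw])
    exact this p hno

theorem rankNumber_eq (h : Rankable G Set.univ (t + 1)) (h' : ¬ Rankable G Set.univ t) :
    rankNumber G = t + 1 := by
  refine le_antisymm (Nat.sInf_le (isRanking_iff.2 h)) ?_
  by_contra! hlt
  have hne : {k | ∃ f : V → ℕ, IsRanking G k f}.Nonempty := ⟨_, isRanking_iff.2 h⟩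
  have := Nat.sInf_mem hne
  exact h' ((isRanking_iff.1 this).mono_right (Nat.lt_succ_iff.1 hlt))

end Rankable


/-! ### Obstructions found by computation

A finite set of cells of the four-row strip is coded by a natural number: the cell in row `r` and
column `c` is the bit `4 * c + r`. -/

/-- The strip of four rows and columns `0, 1, …`, with cells numbered column by column. -/
def bitGraph : SimpleGraph ℕ where
  Adj i j := i = j + 4 ∨ j = i + 4 ∨ (i = j + 1 ∧ j % 4 ≠ 3) ∨ (j = i + 1 ∧ i % 4 ≠ 3)
  symm := ⟨by intro i j h; omega⟩
  loopless := ⟨by intro i h; omega⟩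

/-- The set of bits of a number. -/
def bits (m : ℕ) : Set ℕ := {i | m.testBit i = true}

/-- One step of breadth-first search from `c` inside `m`. -/
def growStep (m c : ℕ) : ℕ :=
  -- The mask holds rows 0, 1, 2 of nine columns, so that a shift by one cannot pass from row 3 of a
  -- column to row 0 of the next.
  (c ||| c <<< 4 ||| c >>> 4 ||| (c &&& 0x777777777) <<< 1 ||| ((c >>> 1) &&& 0x777777777)) &&& m

/-- Breadth-first search with bounded depth. -/
def growN (m : ℕ) : ℕ → ℕ → ℕ
  | 0, c => c
  | n + 1, c => if growStep m c = c then c else growN m n (growStep m c)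

/-- Exchange of the rows `0, 1, 2, 3` with `3, 2, 1, 0`. -/
def flipBits (m : ℕ) : ℕ :=
  (m &&& 0x1111111) <<< 3 ||| (m &&& 0x2222222) <<< 1 |||
    (m &&& 0x4444444) >>> 1 ||| (m &&& 0x8888888) >>> 3

/-- Reversal of the order of the first seven columns. -/
def mirrorBits (m : ℕ) : ℕ :=
  (m &&& 15) <<< 24 ||| ((m >>> 4) &&& 15) <<< 20 ||| ((m >>> 8) &&& 15) <<< 16 |||
    ((m >>> 12) &&& 15) <<< 12 ||| ((m >>> 16) &&& 15) <<< 8 ||| ((m >>> 20) &&& 15) <<< 4 |||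
    ((m >>> 24) &&& 15)

/-- The copy of a listed set of cells which is described by a code: the position in the list, one of
four symmetries, and a number of columns by which the set is moved. The result is `0` if the code
does not describe a copy. -/
def copyOf (tbl : List ℕ) (code : ℕ) : ℕ :=
  let y := tbl.getD (code / 32) 0
  let s := 4 * (code % 8)
  match code / 8 % 4 with
  | 0 => y <<< s
  | 1 => flipBits y <<< s
  -- A set that begins in column 0 is moved by the mirror to end in column 6, so it is moved back to
  -- smaller columns. The comparison rejects moves that would lose cells.
  | 2 => if (mirrorBits y >>> s) <<< s = mirrorBits y then mirrorBits y >>> s else 0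
  | _ => if (mirrorBits (flipBits y) >>> s) <<< s = mirrorBits (flipBits y) then
      mirrorBits (flipBits y) >>> s else 0

/-- The common part of `acc` and the listed copies, or `1` if one of them is empty or not contained
in `m`. -/
def commonPart (tbl : List ℕ) (m : ℕ) : List ℕ → ℕ → ℕ
  | [], acc => acc
  | c :: cs, acc =>
    let y := copyOf tbl c
    if y = 0 then 1 else if y &&& m = y then commonPart tbl m cs (acc &&& y) else 1

/-- `m` is connected and the listed copies inside `m` have no common cell. -/
def checkObstruction (tbl : List ℕ) (p : ℕ × List ℕ) : Bool :=
  decide (p.1 < 2 ^ 28) && decide (p.1 ≠ 0) &&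
    decide (growN p.1 24 (1 <<< p.1.log2) = p.1) && decide (commonPart tbl p.1 p.2 p.1 = 0)

/-! ### Soundness of the obstruction certificates -/

section

variable {m c t : ℕ}

theorem mem_bits {i : ℕ} : i ∈ bits m ↔ m.testBit i = true := Iff.rfl

theorem lt_of_testBit {k : ℕ} (h : m < 2 ^ k) {i : ℕ} (hi : m.testBit i = true) : i < k := by
  by_contra! hc
  have := Nat.testBit_lt_two_pow (lt_of_lt_of_le h (Nat.pow_le_pow_right (by norm_num) hc))
  simp_all

theorem testBit_rowMask : ∀ i, (0x777777777 : ℕ).testBit i = true → i % 4 ≠ 3 := by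
  intro i hi
  have := lt_of_testBit (k := 36) (by norm_num) hi
  revert hi
  revert i
  decide

theorem bits_growStep {i : ℕ} (h : i ∈ bits (growStep m c)) :
    i ∈ bits m ∧ (i ∈ bits c ∨ ∃ j ∈ bits c, bitGraph.Adj j i) := by
  simp only [mem_bits, growStep, Nat.testBit_and, Nat.testBit_or, Nat.testBit_shiftLeft,
    Nat.testBit_shiftRight, Bool.and_eq_true, Bool.or_eq_true, decide_eq_true_eq] at h ⊢
  obtain ⟨h, hm⟩ := h
  refine ⟨hm, ?_⟩
  rcases h with (((h | h) | h) | h) | h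
  · exact Or.inl h
  · exact Or.inr ⟨_, h.2, by simp only [bitGraph]; omega⟩
  · exact Or.inr ⟨_, h, by simp only [bitGraph]; omega⟩
  · have := testBit_rowMask _ h.2.2
    exact Or.inr ⟨_, h.2.1, by simp only [bitGraph]; omega⟩
  · have := testBit_rowMask _ h.2
    exact Or.inr ⟨_, h.1, by simp only [bitGraph]; omega⟩

theorem connIn_growN {r : ℕ} : ∀ (n c : ℕ),
    (∀ i ∈ bits c, i ∈ bits m ∧ ConnIn bitGraph (bits m) r i) →
    ∀ i ∈ bits (growN m n c), ConnIn bitGraph (bits m) r i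
  | 0, _, hc, i, hi => (hc i hi).2
  | n + 1, c, hc, i, hi => by
    rw [growN] at hi
    split_ifs at hi with h
    · exact (hc i hi).2
    · refine connIn_growN n _ (fun j hj => ?_) i hi
      obtain ⟨hjm, hj | ⟨k, hk, hadj⟩⟩ := bits_growStep hj
      · exact hc j hj
      · exact ⟨hjm, (hc k hk).2.trans (.single hadj (hc k hk).1 hjm)⟩

theorem rankable_bits_shift {s : ℕ} (h : Rankable bitGraph (bits (m <<< (4 * s))) t) :
    Rankable bitGraph (bits m) t := by
  refine h.comap (fun i => i + 4 * s) (fun _ _ _ _ h => by simpa using h) ?_ ?_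
  · intro a _ b _ hab
    simp only [bitGraph] at hab ⊢
    omega
  · intro a ha
    simp only [mem_bits] at ha
    simp [mem_bits, Nat.testBit_shiftLeft, ha]

theorem rankable_bits_flip (hm : m < 2 ^ 28) (h : Rankable bitGraph (bits (flipBits m)) t) :
    Rankable bitGraph (bits m) t := by
  refine h.comap (fun i => 4 * (i / 4) + (3 - i % 4)) ?_ ?_ ?_
  · intro a _ b _ hab
    simp only at hab
    omega
  · intro a _ b _ hab
    simp only [bitGraph] at hab ⊢
    omega
  · intro a ha
    have hlt := lt_of_testBit hm ha
    simp only [mem_bits] at ha ⊢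
    obtain ⟨q, r, hr, rfl⟩ : ∃ q r, r < 4 ∧ a = 4 * q + r := ⟨a / 4, a % 4, by omega, by omega⟩
    have hq : q < 7 := by omega
    have h0 : ∀ q < 7, (0x1111111 : ℕ).testBit (4 * q) = true := by decide
    have h1 : ∀ q < 7, (0x2222222 : ℕ).testBit (4 * q + 1) = true := by decide
    have h2 : ∀ q < 7, (0x4444444 : ℕ).testBit (4 * q + 2) = true := by decide
    have h3 : ∀ q < 7, (0x8888888 : ℕ).testBit (4 * q + 3) = true := by decide
    have hdm : (4 * q + r) / 4 = q ∧ (4 * q + r) % 4 = r := by omega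
    rw [hdm.1, hdm.2, flipBits]
    simp only [Nat.testBit_or, Nat.testBit_and, Nat.testBit_shiftLeft, Nat.testBit_shiftRight,
      Bool.or_eq_true, Bool.and_eq_true, decide_eq_true_eq]
    obtain rfl | rfl | rfl | rfl : r = 0 ∨ r = 1 ∨ r = 2 ∨ r = 3 := by omega
    · exact Or.inl (Or.inl (Or.inl ⟨by omega, by simpa using ha, by simpa using h0 q hq⟩))
    · refine Or.inl (Or.inl (Or.inr ⟨by omega, ?_⟩))
      exact ⟨by simpa using ha, by simpa using h1 q hq⟩
    · refine Or.inl (Or.inr ?_)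
      rw [show 1 + (4 * q + (3 - 2)) = 4 * q + 2 by omega]
      exact ⟨ha, h2 q hq⟩
    · refine Or.inr ?_
      rw [show 3 + (4 * q + (3 - 3)) = 4 * q + 3 by omega]
      exact ⟨ha, h3 q hq⟩

theorem flipBits_lt (m : ℕ) : flipBits m < 2 ^ 28 := by
  simp only [flipBits]
  refine Nat.or_lt_two_pow (Nat.or_lt_two_pow (Nat.or_lt_two_pow ?_ ?_) ?_) ?_
  · rw [Nat.shiftLeft_eq]
    have : m &&& 0x1111111 ≤ 0x1111111 := Nat.and_le_right
    omega
  · rw [Nat.shiftLeft_eq]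
    have : m &&& 0x2222222 ≤ 0x2222222 := Nat.and_le_right
    omega
  · rw [Nat.shiftRight_eq_div_pow]
    have : m &&& 0x4444444 ≤ 0x4444444 := Nat.and_le_right
    omega
  · rw [Nat.shiftRight_eq_div_pow]
    have : m &&& 0x8888888 ≤ 0x8888888 := Nat.and_le_right
    omega

theorem rankable_bits_mirror (hm : m < 2 ^ 28) (h : Rankable bitGraph (bits (mirrorBits m)) t) :
    Rankable bitGraph (bits m) t := by
  refine h.comap (fun i => 4 * (6 - i / 4) + i % 4) ?_ ?_ ?_
  · intro a ha b hb hab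
    have := lt_of_testBit hm ha
    have := lt_of_testBit hm hb
    simp only at hab
    omega
  · intro a ha b hb hab
    have := lt_of_testBit hm ha
    have := lt_of_testBit hm hb
    simp only [bitGraph] at hab ⊢
    omega
  · intro a ha
    have hlt := lt_of_testBit hm ha
    simp only [mem_bits] at ha ⊢
    obtain ⟨q, r, hr, rfl⟩ : ∃ q r, r < 4 ∧ a = 4 * q + r := ⟨a / 4, a % 4, by omega, by omega⟩
    have hq : q < 7 := by omega
    have h15 : ∀ r < 4, (15 : ℕ).testBit r = true := by decide
    replace h15 := h15 r hr
    have hdm : (4 * q + r) / 4 = q ∧ (4 * q + r) % 4 = r := by omega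
    rw [hdm.1, hdm.2, mirrorBits]
    simp only [Nat.testBit_or, Nat.testBit_and, Nat.testBit_shiftLeft, Nat.testBit_shiftRight,
      Bool.or_eq_true, Bool.and_eq_true, decide_eq_true_eq]
    interval_cases q <;> simp_all

/-- Each listed set of cells has no ranking with `t` labels. -/
def AllObstructions (t : ℕ) (tbl : List ℕ) : Prop :=
  ∀ y ∈ tbl, y < 2 ^ 28 ∧ ¬ Rankable bitGraph (bits y) t

theorem not_rankable_copyOf {tbl : List ℕ} (htbl : AllObstructions t tbl) {code : ℕ}
    (h0 : copyOf tbl code ≠ 0) : ¬ Rankable bitGraph (bits (copyOf tbl code)) t := by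
  have hy : ∀ d, tbl.getD d 0 = 0 ∨
      (tbl.getD d 0 < 2 ^ 28 ∧ ¬ Rankable bitGraph (bits (tbl.getD d 0)) t) := by
    intro d
    by_cases hd : d < tbl.length
    · right
      rw [List.getD_eq_getElem _ _ hd]
      exact htbl _ (List.getElem_mem hd)
    · left
      exact List.getD_eq_default _ _ (not_lt.1 hd)
  have hm0 : mirrorBits 0 = 0 := by decide
  have hf0 : flipBits 0 = 0 := by decide
  rcases hy (code / 32) with hz | ⟨hlt, hbad⟩
  · exfalso
    apply h0
    simp only [copyOf, hz]
    split <;> simp [hm0, hf0]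
  · intro hr
    apply hbad
    have back : ∀ {y s : ℕ}, (y >>> (4 * s)) <<< (4 * s) = y →
        Rankable bitGraph (bits (y >>> (4 * s))) t → Rankable bitGraph (bits y) t := by
      intro y s h hr
      refine hr.comap (fun i => i - 4 * s) ?_ ?_ ?_
      · intro a ha b hb hab
        have hs : ∀ c ∈ bits y, 4 * s ≤ c := by
          intro c hc
          rw [mem_bits, ← h, Nat.testBit_shiftLeft] at hc
          simp only [Bool.and_eq_true, decide_eq_true_eq] at hc
          exact hc.1
        have := hs a ha
        have := hs b hb
        simp only at hab
        omega
      · intro a ha b hb hab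
        have hs : ∀ c ∈ bits y, 4 * s ≤ c := by
          intro c hc
          rw [mem_bits, ← h, Nat.testBit_shiftLeft] at hc
          simp only [Bool.and_eq_true, decide_eq_true_eq] at hc
          exact hc.1
        have := hs a ha
        have := hs b hb
        simp only [bitGraph] at hab ⊢
        omega
      · intro a ha
        rw [mem_bits, ← h, Nat.testBit_shiftLeft] at ha
        simp only [Bool.and_eq_true, decide_eq_true_eq] at ha
        exact ha.2
    simp only [copyOf] at h0 hr
    split at hr
    · exact rankable_bits_shift hr
    · exact rankable_bits_flip hlt (rankable_bits_shift hr)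
    · rename_i h2
      simp only [h2] at h0
      split_ifs at hr h0 with h
      · exact rankable_bits_mirror hlt (back h hr)
      · exact absurd rfl h0
    · rename_i h1 h2 h3
      split_ifs at hr with h
      · exact rankable_bits_flip hlt (rankable_bits_mirror (flipBits_lt _) (back h hr))
      · exfalso
        apply h0
        split <;> simp_all

/-- A listed copy that misses `v` would lie inside the rankable set `bits m \ {v}`. Hence every copy
contains `v`, and `v` survives in the intersection. -/
theorem commonPart_zero {tbl : List ℕ} (htbl : AllObstructions t tbl) {v : ℕ}
    (hr : Rankable bitGraph (bits m \ {v}) t) : ∀ (cs : List ℕ) (acc : ℕ),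
    acc.testBit v = true → commonPart tbl m cs acc ≠ 0
  | [], acc, hacc => by
    rintro h
    rw [commonPart] at h
    simp [h] at hacc
  | c :: cs, acc, hacc => by
    intro h
    simp only [commonPart] at h
    split_ifs at h with h0 hsub
    refine commonPart_zero htbl hr cs _ ?_ h
    rw [Nat.testBit_and, hacc, Bool.true_and]
    by_contra hv
    refine not_rankable_copyOf htbl h0 (hr.mono fun i hi => ⟨?_, ?_⟩)
    · rw [mem_bits, ← hsub, Nat.testBit_and, Bool.and_eq_true] at hi
      exact hi.2
    · rintro rfl
      exact hv hi

/-- A ranking of a connected set with `t + 1` labels yields a cell whose deletion leaves a set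
rankable with `t` labels. This cell would belong to every listed copy, but the copies have no common
cell. -/
theorem not_rankable_of_check {tbl : List ℕ} (htbl : AllObstructions t tbl) {p : ℕ × List ℕ}
    (h : checkObstruction tbl p = true) :
    p.1 < 2 ^ 28 ∧ ¬ Rankable bitGraph (bits p.1) (t + 1) := by
  simp only [checkObstruction, Bool.and_eq_true, decide_eq_true_eq] at h
  obtain ⟨⟨⟨hlt, h0⟩, hconn⟩, hcommon⟩ := h
  refine ⟨hlt, fun hr => ?_⟩
  have hroot : p.1.testBit p.1.log2 = true := Nat.testBit_log2 h0
  have hc : ∀ i ∈ bits p.1, ConnIn bitGraph (bits p.1) p.1.log2 i := by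
    intro i hi
    refine connIn_growN 24 (1 <<< p.1.log2) (fun j hj => ?_) i (by rwa [hconn])
    have : j = p.1.log2 := by
      simp only [mem_bits, Nat.testBit_shiftLeft, Bool.and_eq_true, decide_eq_true_eq,
        Nat.testBit_one_eq_true_iff_self_eq_zero] at hj
      omega
    subst this
    exact ⟨hroot, .refl _⟩
  obtain ⟨v, hv, hr'⟩ := hr.exists_diff_singleton ⟨_, hroot⟩
    fun u hu w hw => (hc u hu).symm.trans (hc w hw)
  exact commonPart_zero htbl hr' p.2 p.1 hv hcommon

theorem AllObstructions.succ {tbl : List ℕ} (htbl : AllObstructions t tbl)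
    {data : List (ℕ × List ℕ)} (h : data.all (checkObstruction tbl) = true) :
    AllObstructions (t + 1) (data.map Prod.fst) := by
  intro y hy
  obtain ⟨p, hp, rfl⟩ := List.mem_map.1 hy
  exact not_rankable_of_check htbl (List.all_eq_true.1 h p hp)

end


/-! ### Certified obstructions for up to eight labels -/

/-- In the list with number t, each entry consists of a set of cells without a ranking with t labels
and of codes of copies from the preceding list, as read by `copyOf`. The first list refers to the
single cells `[1, 2]`. -/
def obstructionData1 : List (ℕ × List ℕ) :=
  [(17, [0, 1]), (6, [32, 40]), (34, [32, 33]), (3, [0, 32])]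

def obstructionData2 : List (ℕ × List ℕ) :=
  [(23, [0, 32]), (306, [1, 64]), (275, [1, 96]), (54, [32, 97]), (15, [96, 104]), (550, [32, 65]),
  (46, [64, 104]), (612, [65, 72]), (51, [0, 64]), (4369, [0, 2]), (547, [65, 96]), (8738, [64,
  66]), (102, [32, 33])]

def obstructionData3 : List (ℕ × List ℕ) :=
  [(959, [8, 52]), (2495, [32, 72]), (1503, [0, 60]), (111, [125, 117, 128]), (371, [1, 64, 117]),
  (983, [84, 104]), (567, [0, 52, 160]), (615, [117, 160, 200, 224]), (6092, [2, 264]), (5624, [60,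
  65]), (1823, [20, 128]), (2463, [72, 64]), (1871, [128, 220]), (5934, [2, 192]), (4415, [65,
  128]), (742, [104, 160, 193]), (4604, [264, 65]), (479, [264, 64]), (958, [8, 257]), (28951, [0,
  19]), (12668, [83, 125]), (12631, [83, 200]), (10067, [64, 225]), (4913, [33, 52, 65, 84]),
  (1254980, [35, 188]), (1120068, [188, 290]), (206406, [168, 338]), (205366, [96, 338]), (9010,
  [32, 51, 321, 340]), (201014, [82, 96]), (142988, [72, 162]), (190604, [72, 195]), (78568, [29,
  34]), (71624, [60, 66]), (11918, [8, 194]), (142052, [40, 353]), (156788, [221, 226]), (11946,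
  [352, 92]), (9047, [51, 200]), (79560, [34, 60]), (2009, [60, 84]), (6120, [2, 29]), (25367, [0,
  115]), (9826, [161, 180, 225, 232]), (13870, [98, 192]), (13932, [98, 125]), (13895, [98, 200]),
  (70508, [125, 66]), (78444, [34, 125]), (4542, [8, 65]), (70516, [66, 221]), (94820, [3, 224]),
  (71494, [168, 66]), (95302, [3, 168]), (10070, [168, 51]), (25262, [8, 179]), (78390, [34, 96]),
  (79430, [34, 168]), (5038, [8, 33]), (927, [8, 84]), (78435, [34, 117]), (97348, [3, 348]),
  (73540, [348, 66]), (221734, [99, 160]), (201510, [82, 160]), (205420, [125, 338]), (140846, [162,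
  192]), (70423, [0, 66]), (200983, [0, 82]), (139950, [8, 353]), (95812, [3, 188]), (10926, [352,
  72]), (4477, [125, 288]), (1375, [328, 64]), (70006, [289, 384]), (69975, [289, 200]), (5959, [2,
  200]), (1726, [8, 116]), (5911, [0, 2]), (4567, [104, 288]), (6097, [124, 288]), (69950, [192,
  289]), (156780, [125, 226]), (140908, [125, 162]), (140998, [104, 162]), (140854, [96, 162]),
  (402022, [178, 384]), (6086, [2, 104]), (158860, [72, 226]), (5500, [328, 65]), (81476, [34,
  348]), (13158, [384, 258]), (13164, [125, 258]), (2298131, [49, 64]), (78382, [34, 192]), (140851,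
  [162, 256]), (143667, [50, 256]), (1126706, [32, 67]), (1118518, [290, 96]), (1127970, [180, 67]),
  (70454, [66, 96]), (14022, [98, 104]), (143670, [50, 96]), (8076, [2, 72]), (819, [32, 52, 64,
  320]), (765, [264, 52]), (79436, [34, 328]), (95308, [3, 328]), (1253937, [35, 52]), (11830, [96,
  194]), (1126950, [160, 67]), (1254178, [35, 340]), (1638, [160, 168, 385]), (17896226, [291,
  340]), (1119014, [160, 290]), (189516, [195, 328]), (2240787, [64, 323]), (70012, [125, 289]),
  (78438, [34, 384]), (2237027, [117, 354]), (17904162, [291, 352]), (20062754, [36, 352]), (8894,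
  [8, 321]), (1885, [328, 84]), (11847, [194, 200]), (9815, [0, 225]), (403014, [168, 178]), (119,
  [0, 21, 384]), (71508, [188, 289]), (12662, [83, 384]), (2253350, [160, 163]), (5463, [168, 288]),
  (5973, [188, 288]), (71026, [232, 289]), (70502, [384, 66]), (156774, [226, 384]), (25446, [115,
  384]), (94514, [3, 32]), (2238022, [168, 354]), (2237030, [354, 384]), (1879, [0, 220]), (1530,
  [60, 32]), (7140, [33, 40]), (2237203, [64, 354]), (12606, [83, 192])]

def obstructionData4 : List (ℕ × List ℕ) :=
  [(1023, [96, 117, 0, 148, 160]), (1791, [97, 200, 192]), (6135, [97, 128, 129, 160, 244]), (6142,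
  [200, 129, 117]), (6139, [97, 128, 129, 180, 244]), (6141, [97, 129, 148, 256, 288]), (3999, [328,
  320, 340, 348, 372, 352]), (3951, [96, 116, 392, 384]), (5951, [129, 192, 320, 416, 448]), (6126,
  [200, 244, 256, 416, 480]), (4607, [96, 128, 448, 512, 544]), (2015, [200, 160, 320, 180, 604]),
  (63903, [352, 371, 608, 616]), (12671, [96, 128, 448, 640, 672]), (10099, [128, 225, 212, 244,
  704]), (1259332, [194, 738, 768, 800]), (206454, [225, 488, 832, 864]), (209718, [737, 864, 897,
  928]), (192140, [155, 482, 960, 992]), (1258870, [488, 738]), (81640, [156, 481, 1024, 1082]),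
  (161140, [705, 1115, 1146, 1152, 1211, 1217]), (1273078, [117, 488, 1249]), (6137, [97, 736, 288,
  1280, 1312]), (1257974, [117, 738]), (1566966, [117, 1314]), (32159, [352, 691, 1281, 1352]),
  (9079, [128, 192, 193, 224, 1216]), (13935, [224, 232, 1376, 1408, 1440, 1472]), (6140, [97, 129,
  256, 512]), (129763, [314, 648, 417, 1203, 1427]), (1305843, [1081, 1473, 520]), (78716, [193,
  737, 640, 1504, 1536]), (1521378, [131, 500]), (1519987, [128, 131]), (73704, [116, 156, 1056,
  315, 1569]), (1305075, [128, 1081]), (95092, [130, 193, 1115, 1600, 1632]), (96070, [130, 507,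
  1664, 1696]), (10102, [193, 488, 212, 244, 1728]), (26455, [507, 1096, 1216, 1768]), (79478, [225,
  488, 1792, 1824]), (71542, [129, 488, 1664, 1600]), (1015, [117, 148, 160, 192, 224]), (5055,
  [192, 736, 1568, 1856, 1888]), (78707, [128, 737, 1920]), (98116, [98, 130, 1952, 1984]),
  (1261048, [156, 738]), (226086, [130, 897, 146, 2016, 2048]), (227836, [146, 136]), (206446, [232,
  832, 1376, 2080, 2112]), (483951, [96, 242]), (471663, [96, 210]), (70519, [128, 1600, 224,
  2144]), (201527, [192, 736, 928, 2048, 2144]), (480599, [2176, 2194, 2234, 2216]), (141038, [200,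
  1376, 2208, 2266]), (30039, [1768, 1787, 672, 691, 2299, 2280]), (5503, [128, 232, 448, 2304,
  2336]), (518863, [242, 456]), (1008543, [114, 1888]), (1022367, [370, 2176, 2184]), (70015, [96,
  128, 448, 2304, 2368, 2400]), (514463, [352, 1282, 954, 2176]), (6103, [2432, 2492, 2472, 2496,
  2528, 2560]), (464830, [416, 928, 2464, 2514]), (482750, [168, 690, 1882]), (510655, [192, 2618]),
  (515001, [736, 2618]), (514791, [224, 1594]), (514519, [1300, 1594, 2176]), (190060, [251, 1377,
  1178, 1384, 2624, 2656]), (143084, [136, 481, 960, 2266]), (141046, [97, 117, 2688, 2720]),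
  (403054, [232, 858, 1376, 2112, 2752]), (2515702, [117, 1378]), (455271, [99, 224]), (79470, [232,
  1376, 1536, 1408, 1824]), (2288355, [648, 2113, 961, 1185, 1203, 1427]), (20893222, [202, 1080,
  840, 1672]), (20368950, [1250, 1826, 2792]), (20367606, [117, 1250]), (1783, [97, 192, 117, 224,
  2472]), (158956, [136, 201, 2624, 2816]), (3039974, [480, 483]), (20368102, [480, 1250]),
  (4106486, [117, 2873]), (20858102, [117, 2882]), (20876406, [488, 1080]), (78710, [193, 737, 2368,
  1792, 2912]), (20125490, [739, 212]), (2356787, [195, 898, 2963]), (20945202, [370, 1080, 2993]),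
  (2357491, [195, 520]), (2357715, [961, 2976, 371]), (20946466, [978, 739]), (2334675, [137,
  2976]), (78654, [737, 896, 2592, 3008]), (5630, [117, 200, 288, 232, 1568]), (79838, [200, 737]),
  (14204, [129, 193, 1440, 147, 640]), (14167, [147, 672, 1472, 704, 2432]), (423023, [96, 506]),
  (225782, [117, 146]), (2577398, [117, 706]), (20945094, [936, 739]), (4061382, [163, 936, 1371]),
  (237366, [928, 1890, 2792]), (409083, [156, 946]), (2079174, [936, 738]), (145203, [129, 194,
  3040, 3072]), (20961476, [3098, 739]), (2079026, [370, 313, 1290, 3104]), (2074870, [117, 313]),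
  (1939958, [353, 936, 3136]), (1128242, [737, 212, 3104, 3168]), (1678838, [1299, 3136, 3208]),
  (442329, [744, 3218]), (1964342, [154, 3136]), (1929718, [117, 2577]), (1964486, [936, 1371,
  2577]), (95030, [130, 896, 1363, 1792, 3200]), (1169206, [2530, 3136, 3240]), (1703222, [138,
  3136]), (457629, [699, 3218, 954]), (2079942, [131, 3208]), (392150, [737, 3272]), (383990, [169,
  3200, 3272]), (78840, [193, 737, 1024, 449, 3323]), (8172, [116, 136, 256, 315]), (409055, [946,
  3336]), (206587, [3040, 3368, 3418, 3450]), (20063222, [117, 865, 3457]), (3304694, [117, 3417,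
  488]), (20080582, [769, 1922, 2081, 3496]), (20082628, [220, 769, 1922]), (20127684, [220, 739]),
  (1277380, [904, 738]), (1138166, [201, 3136, 904]), (1277366, [3136, 1249, 179]), (1258289, [736,
  738, 3456]), (1258278, [738, 897, 2048, 3520, 3552]), (20124646, [480, 739]), (3356262, [3331,
  3584]), (2309836, [898, 3336]), (2323174, [195, 480]), (1273510, [1025, 2016, 1249, 1736]),
  (20125046, [488, 739]), (20945698, [370, 1080, 3616]), (20876006, [480, 1080]), (1940454, [681,
  936, 3648]), (20927714, [739, 3698]), (1957670, [3648, 3338]), (2817427, [745, 3712]), (2800115,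
  [353, 3712, 3752]), (226766, [146, 200]), (4183142, [145, 3784]), (4167910, [145, 2376]),
  (20376098, [1026, 1138, 1250, 3825]), (20132386, [739, 898, 3840, 3872]), (2277139, [3304, 3712,
  3906]), (20437794, [3616, 1250, 178]), (224953, [1288, 1530, 1938]), (12119, [340, 704, 1216,
  1728, 2356, 3956, 3968]), (2579436, [136, 706]), (32190, [179, 168, 1352, 1363]), (20437190,
  [3272, 739]), (1432550, [169, 3272, 3648]), (9847, [192, 225, 224, 488, 4000]), (71534, [232, 244,
  1504, 416, 1664]), (403062, [225, 488, 2752, 2720, 4032]), (423150, [506, 4072]), (87924, [129,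
  1384, 1211, 1600, 4096]), (2079970, [131, 1608]), (95846, [243, 3584, 1696, 1632]), (40248038,
  [480, 1379]), (107360630, [3588, 4128]), (36922486, [488, 899]), (108282998, [488, 504]),
  (104011126, [488, 3216]), (350039, [968, 1664, 2216, 1192, 2144]), (6450854, [1721, 1736, 1849,
  4160]), (6648599, [608, 2144, 1344, 1745]), (49056486, [480, 1624]), (95602, [723, 2433, 1235,
  1747, 2497, 4019, 4193, 4225]), (41247862, [488, 1731]), (41227638, [488, 4272]), (41236070, [707,
  3584]), (1144420, [243, 1384, 1632, 1665, 2240, 4289]), (157542, [226, 3584, 4320, 4352]),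
  (2517740, [136, 1378]), (6710175, [1888, 3587]), (2517919, [1378, 352]), (2559, [352, 128, 136]),
  (6710231, [160, 3587]), (6710206, [3587, 576]), (6771630, [505, 1856]), (11966, [168, 1088, 3488,
  3904, 188, 1184]), (4027110, [480, 163]), (6768318, [505, 2464]), (6467287, [4000, 1576, 1721]),
  (2299838, [416, 928, 2464, 4401]), (6771134, [505, 1568]), (41236194, [500, 707]), (41794786,
  [1608, 707]), (6802519, [505, 1864]), (6548567, [1768, 1864, 2809]), (210894, [200, 3330]),
  (2542579, [2817, 3328]), (40680946, [953, 723, 2818]), (3609078, [117, 145]), (204726, [928, 2484,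
  3322]), (2357484, [136, 195]), (107098614, [117, 3792]), (104776806, [2712, 2808, 3784]),
  (2238070, [225, 488, 2720, 4416, 4448]), (6770350, [505, 4488]), (6450422, [117, 1849, 488]),
  (37184882, [196, 1747]), (6802094, [505, 4200]), (5599734, [117, 4241]), (1523186, [131, 3380]),
  (3042292, [483, 3388]), (81884, [3336, 737]), (245242, [3090, 744]), (10234, [97, 896, 244, 4512,
  4571]), (391959, [608, 2144, 1344, 4514]), (114648, [744, 737]), (113631, [737, 456]), (1965362,
  [3104, 3338]), (3136245, [3363, 4520]), (3136469, [3121, 3098]), (472782, [200, 210]), (253399,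
  [2176, 3337]), (37600626, [2834, 3120]), (41250290, [1731, 3380]), (41238002, [707, 3380]),
  (2334681, [3121, 744]), (37338610, [1608, 3120]), (2612189, [3080, 3121]), (2612807, [1145, 424,
  4569]), (41270642, [707, 4552]), (41782770, [4568, 3380]), (2356807, [195, 832, 1416]), (2357455,
  [195, 456]), (2306835, [737, 898, 2976, 4576]), (2357959, [898, 4616]), (2309847, [898, 584]),
  (14142, [129, 896, 1408, 147, 4608]), (2325719, [195, 584]), (2324183, [195, 2472]), (7283390,
  [100, 3904]), (7287342, [100, 3008, 497]), (7287102, [100, 4608]), (251702, [162, 928, 3240]),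
  (463869, [512, 2162, 1362, 3360]), (179707, [744, 3072]), (1555826, [131, 4552]), (2611965, [4569,
  3360]), (95976, [233, 243, 1024, 1050]), (2323662, [195, 200]), (2324142, [195, 4008, 898]),
  (6547015, [832, 3505, 1416, 2713]), (7284311, [100, 4000])]

def obstructionData5 : List (ℕ × List ℕ) :=
  [(4095, [0, 8, 20, 28, 192, 224]), (6143, [32, 64, 128, 160, 256, 288, 320, 352]), (63999, [193,
  384, 424, 416]), (1259382, [467, 480, 512, 544, 602, 608]), (1306358, [475, 512, 641, 698, 704]),
  (1571318, [193, 738, 768, 800, 833]), (32255, [353, 416, 832, 872]), (1306355, [307, 641, 897,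
  936, 978, 992]), (1521651, [448, 417, 562, 1025, 1056, 1088]), (1571315, [193, 1088, 833, 1145,
  1152]), (96118, [883, 1184, 1216, 1267, 1299, 1312, 1344]), (32703, [1288, 832, 1395, 1408]),
  (1261560, [640, 321, 1025, 1409, 1441, 1498, 1504]), (1539580, [353, 665, 672, 1504, 1562, 1568]),
  (1009263, [1618, 1600, 1626, 1608, 1632, 1640]), (471935, [864, 416, 1024, 1664, 1696, 1746]),
  (481143, [1298, 1728, 1760, 1800]), (518895, [424, 1289, 1632, 1832, 1864, 1888]), (1011615, [192,
  226, 1920, 1928]), (1022463, [385, 1952, 1984, 1992]), (515999, [192, 2016, 2066, 2106]), (515007,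
  [1408, 1728, 2016, 2138, 2144, 2176]), (515063, [1376, 833, 1728, 2208, 2240]), (192236, [456,
  576, 698, 1210, 2272, 2304]), (3041014, [520, 2273, 2336, 2386, 2400, 2458]), (20901414, [642,
  1224, 2386, 2466, 2513, 2528]), (20369142, [2344, 2560, 2592, 2652, 2657]), (20900582, [1307, 642,
  1833, 2688, 2720]), (4108022, [2652, 697, 2336, 2513, 2752]), (20892918, [1049, 2592, 2784, 2816,
  2856]), (20152114, [449, 1026, 418, 1442, 2880, 2929]), (20946738, [194, 2880, 1153, 2944, 2993,
  3025, 3040]), (20969778, [1379, 338, 642, 2944, 738, 1411, 3089]), (79870, [467, 2632, 1024, 288,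
  3104, 3136, 3168]), (2359251, [866, 1403, 3008, 3072, 954]), (14207, [448, 256, 416, 896, 3200,
  3232]), (2061686, [434, 1299, 1217, 608, 1825, 1874, 3282]), (2585590, [450, 2848, 2400, 3296,
  3328]), (2578422, [2644, 673, 1825, 2344, 3250, 3328]), (20969670, [1379, 577, 1145, 1411, 3360,
  3392]), (409595, [1242, 562, 20, 3442, 3456]), (2080710, [194, 480, 3258, 3432, 3488]), (20963268,
  [194, 673, 1505, 3546, 3552]), (2079222, [768, 3488, 841, 3584, 3616, 3648]), (2076406, [2652,
  961, 512, 3258, 3616]), (2080562, [194, 961, 3584, 362, 3680]), (1687542, [1352, 1409, 3680, 3712,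
  3770]), (1964534, [193, 3304, 3648, 3776, 3808, 3840]), (1703734, [322, 1224, 3680, 3872, 3904,
  3936]), (458683, [1370, 562, 19, 3752, 3976]), (2096326, [665, 552, 346, 1473, 3880, 4000]),
  (64447, [1408, 1427, 1832, 384]), (392182, [193, 2848, 680, 3872, 4032, 4064]), (2092278, [890,
  704, 552, 3616, 2458, 4121]), (2096438, [1402, 434, 3936, 162, 3584, 4130, 4178]), (20082678,
  [1248, 52, 4193, 4224, 4256, 4288]), (20152260, [866, 480, 481, 418, 1442, 4320, 4352]), (1277430,
  [353, 608, 704, 768, 4384, 4416, 4448]), (20132854, [544, 4224, 768, 1729, 4481, 4513, 4544]),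
  (3374822, [1256, 1601, 4576, 4633, 4640, 4672]), (20127734, [2652, 2880, 4352, 4544, 4704]),
  (20893414, [475, 1049, 520, 594, 2528, 2720]), (20945894, [858, 4544, 3360, 4736, 4768, 4800]),
  (20928486, [520, 3234, 4544, 4832]), (1957862, [475, 520, 552, 594, 4800, 4864]), (2817523, [193,
  1032, 3251, 4896, 4928]), (4185318, [1049, 2856, 4961, 4992, 5024]), (20701158, [609, 1505, 4544,
  2856]), (20445986, [450, 4098, 130, 5056, 5088, 5137, 5152]), (20376566, [361, 5056, 4224, 2592,
  5185]), (2580460, [673, 1120, 1562, 5234, 5248]), (20437990, [4544, 2720, 5152, 5281, 5312,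
  5344]), (20446166, [4481, 5185, 4032, 5312]), (456303, [530, 538, 896, 904, 2432, 2440]), (130795,
  [915, 640, 3208, 960, 1883, 4122]), (257785, [307, 1050, 744, 897, 978, 5184]), (1537766, [1217,
  1056, 1818, 5394, 5409, 5448, 5498]), (2080482, [378, 594, 1056, 1833, 5512, 5536]), (107378038,
  [672, 690, 5584, 5608, 5632]), (108291958, [1248, 2712, 5680, 5696]), (104035702, [3888, 5664,
  1299, 5728]), (6649687, [1233, 1280, 1824, 3232, 5760, 5817, 5824]), (49195750, [1833, 5528, 5600,
  1769, 5856]), (41252214, [1299, 5904, 5920, 5952]), (41236342, [1729, 5952, 1248, 3680, 5841,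
  5984]), (2518764, [1242, 1275, 1562, 5594, 6041, 6074, 6080]), (6713247, [192, 5585, 5593, 6112,
  6120]), (2518015, [6080, 1554, 6144, 6176]), (6713278, [380, 5585, 1288, 6216, 6240]), (98238,
  [883, 380, 1146, 1288, 3104, 5280]), (6779838, [450, 3104, 529, 585, 6240, 6272]), (6778558, [529,
  5434, 6216, 6304, 6361]), (6772670, [2080, 1282, 6368, 6408, 6432, 6464]), (41795298, [594, 5282,
  2137, 5512, 6496, 6528]), (41811170, [355, 1192, 674, 569, 6528]), (7304110, [1536, 2353, 2627,
  6272, 6568, 6600]), (108474102, [1264, 2652]), (2586574, [450, 666, 1626, 673, 4960, 5378, 6624]),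
  (2096354, [1192, 346, 1217, 1434, 5536]), (475103, [192, 1746, 6650, 4160]), (40681458, [467, 594,
  3465, 4169, 6657, 6688]), (3612662, [3297, 2652, 6720, 6752, 6809]), (107100150, [1553, 2336,
  2644, 6816, 6872]), (41252582, [674, 5568, 5984, 6888, 6937]), (6483702, [475, 6880, 1241, 698,
  6944]), (37188978, [867, 690, 1825, 3233, 3696, 6976]), (7304535, [2627, 1824, 1760, 2361, 7016]),
  (7288663, [3232, 6969, 1746, 6920, 7016, 7057]), (41248758, [1248, 2377, 6888, 5800, 5920, 6952,
  6992]), (3135349, [370, 602, 648, 1825, 7089, 7129]), (245754, [640, 321, 1409, 1498, 3538, 7162,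
  7168]), (393047, [5216, 1824, 5760, 7226, 7232]), (114655, [192, 3232, 264, 1416, 7264, 7296]),
  (2096562, [1402, 434, 4121, 162, 3584, 7265, 7328]), (3137269, [1434, 7129, 425, 7208, 7360]),
  (3137493, [194, 673, 1434, 3546, 7345, 7392]), (3136501, [385, 3601, 5553, 7089, 858, 7176, 7250,
  7314, 7360, 7392]), (997343, [274, 352, 1746, 2152, 7424]), (483263, [192, 3250, 360, 1408, 2112,
  5224]), (113663, [864, 328, 1409, 1408, 1864, 7296]), (1013215, [1824, 1690, 2002, 1760, 2152]),
  (482815, [872, 1825, 320, 1760, 2112]), (515551, [1760, 1416, 2016, 3130]), (37617010, [371, 2674,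
  690, 3089, 7344, 7457, 7488]), (41254386, [353, 674, 1761, 5904, 7520, 7552]), (40697330, [193,
  2658, 690, 569, 6688]), (37354994, [193, 1192, 5888, 1417, 7585, 7616]), (2613213, [354, 570, 673,
  7584, 3528, 7648]), (41287026, [371, 674, 1761, 5904, 7697, 7712]), (41807346, [265, 2658, 7520,
  2105, 7681, 7744]), (41795058, [2017, 6528, 6688, 7552, 7409, 7504, 7616, 7649, 7728, 7744]),
  (2359257, [505, 7264, 3697, 7345]), (2358991, [264, 505, 443, 4608, 7776, 7808]), (37731698,
  [3696, 850, 6673, 5289, 7488, 7841, 7873]), (2358999, [954, 7776, 7872, 7904, 7944, 7968]),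
  (7304919, [922, 1265, 5817, 6376, 8000, 8040]), (7288638, [274, 3104, 4657, 3313, 8064, 8096]),
  (6520758, [5792, 544, 737, 6752, 8145]), (7337278, [1273, 585, 2170, 6769, 7880, 8096]), (514559,
  [833, 424, 2016, 1984]), (2612221, [833, 3464, 3601, 5248, 2176, 7648, 8160, 8200, 8241, 8256]),
  (2324206, [5384, 1600, 4640, 8288, 8320, 8352]), (7304878, [2386, 2627, 8064, 8352, 8392, 8424]),
  (7305727, [2627, 6176])]

def obstructionData6 : List (ℕ × List ℕ) :=
  [(65535, [32, 40, 51, 59, 83, 64]), (1572854, [1, 34, 96, 128, 160, 193]), (1572851, [1, 34, 193,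
  224, 256, 288]), (1572860, [34, 33, 193, 346, 321, 353, 384, 416]), (1013631, [320, 338, 448, 480,
  498, 512, 530, 552]), (1023999, [65, 32, 40, 594, 608, 658, 666]), (523263, [64, 353, 480, 544,
  672, 722]), (20901622, [328, 737, 768, 800, 832, 864, 896, 928]), (20971314, [225, 50, 960, 992,
  1024, 1058, 1105]), (4159478, [320, 761, 768, 96, 1138, 1152, 1184, 1216]), (20971462, [737, 761,
  385, 1248, 1306, 1312, 1344]), (2080758, [96, 65, 1312, 201, 1376, 1408, 1440, 1472]), (1966070,
  [1, 320, 328, 1306, 1472, 1504, 1536, 1594]), (2096630, [1152, 160, 1376, 1504, 1600, 1641, 1672,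
  1696, 1728]), (20152310, [33, 960, 1760, 1792, 1824, 1856, 1888, 1920]), (20963302, [378, 1825,
  1344, 1952, 1984, 2016, 2048, 2097, 2112, 2144]), (20446198, [1856, 160, 1664, 2176, 2208, 2265,
  2272, 2304]), (7305209, [338, 153, 113, 1121, 1169, 1433, 1721, 2337, 2394]), (6553593, [1121,
  1553, 51, 59, 1337, 1457, 1625, 1745, 2400]), (6782969, [33, 113, 338, 337, 1169, 1625, 2457,
  2489]), (108361590, [320, 2512, 2528, 2576, 2609, 2648, 2672, 2688]), (6713343, [0, 2720, 2728,
  2752, 2792, 2784]), (41811686, [328, 2241, 2841, 2873, 2905, 2937, 2969, 2976, 3008]), (108523254,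
  [128, 2544, 2456, 2504, 3065, 3072]), (49086450, [1, 489, 3024, 754, 3121, 3152, 3177, 3200]),
  (49201142, [201, 2624, 2480, 3057, 2785, 2992, 3200, 3240]), (108478454, [96, 112, 3072, 1185,
  2688, 2704, 3232, 3264]), (41252854, [320, 513, 2609, 2656, 2688, 3296, 3336, 3376, 3409, 3441,
  3456]), (3137525, [65, 3153, 378, 1641, 3488, 3528, 3570, 3602, 3633, 3648, 3680, 3712]),
  (1032159, [3584, 3610, 648, 658, 680, 690, 3744, 3770, 3794, 3784]), (1031167, [480, 1633, 608,
  690, 3808, 3866, 3880, 3930]), (41811442, [641, 3008, 3697, 3905, 3952, 3968, 4000, 4032, 4065,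
  4112, 4128, 4160]), (37748210, [82, 3360, 3136, 4032, 361, 1641, 4193, 4225, 4256]), (7337918,
  [50, 2944, 3040, 4296, 4328, 4352, 4401, 4416]), (41795574, [673, 2688, 1472, 2976, 3200, 4160,
  4272, 4441, 4449, 4481]), (116879094, [776, 784, 2544, 2536, 3072, 3096, 4513, 4537, 4545, 4569]),
  (117399542, [1232, 3232, 3080, 920, 904, 2632, 2648, 3096, 4417, 4433]), (7338495, [64, 608, 626,
  3249, 3257, 4584, 4576])]

def obstructionData7 : List (ℕ × List ℕ) :=
  [(1048575, [0, 1, 136, 128, 178, 160, 210, 200]), (20971510, [1, 224, 256, 288, 320, 352, 384,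
  416, 448, 480, 512]), (7340025, [1, 49, 57, 369, 377, 409, 401, 441, 433, 544, 552, 584, 576]),
  (108527606, [32, 609, 640, 656, 673, 728, 736, 776, 808, 832]), (50200566, [161, 384, 704, 768,
  864, 897, 937, 969, 1008, 1040, 1081, 1088]), (117407734, [640, 545, 561, 760, 656, 832, 1057,
  1073, 1128, 1152]), (117424118, [368, 352, 800, 816, 832, 848, 961, 977, 1088, 1104, 1160, 1201])]

def obstructionData8 : List (ℕ × List ℕ) :=
  [(117440502, [81, 65, 104, 96, 112, 120, 136, 128, 152, 144, 160, 168, 200, 192])]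

/-- Single cells in rows 0 and 1 suffice, since the flip supplies rows 3 and 2. -/
theorem allObstructions_zero : AllObstructions 0 [1, 2] := by
  intro y hy
  simp only [List.mem_cons, List.not_mem_nil, or_false] at hy
  rcases hy with rfl | rfl
  · exact ⟨by norm_num, fun h => Set.notMem_empty 0 (h.eq_empty ▸ (by decide : (1 : ℕ).testBit 0 = true))⟩
  · exact ⟨by norm_num, fun h => Set.notMem_empty 1 (h.eq_empty ▸ (by decide : (2 : ℕ).testBit 1 = true))⟩

theorem allObstructions_one : AllObstructions 1 (obstructionData1.map Prod.fst) :=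
  allObstructions_zero.succ (by decide +kernel)

theorem allObstructions_two : AllObstructions 2 (obstructionData2.map Prod.fst) :=
  allObstructions_one.succ (by decide +kernel)

theorem allObstructions_three : AllObstructions 3 (obstructionData3.map Prod.fst) :=
  allObstructions_two.succ (by decide +kernel)

theorem allObstructions_four : AllObstructions 4 (obstructionData4.map Prod.fst) :=
  allObstructions_three.succ (by decide +kernel)

theorem allObstructions_five : AllObstructions 5 (obstructionData5.map Prod.fst) :=
  allObstructions_four.succ (by decide +kernel)

theorem allObstructions_six : AllObstructions 6 (obstructionData6.map Prod.fst) :=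
  allObstructions_five.succ (by decide +kernel)

theorem allObstructions_seven : AllObstructions 7 (obstructionData7.map Prod.fst) :=
  allObstructions_six.succ (by decide +kernel)

theorem allObstructions_eight : AllObstructions 8 (obstructionData8.map Prod.fst) :=
  allObstructions_seven.succ (by decide +kernel)


/-! ### The strip with four rows -/

/-- The grid with four rows and infinitely many columns. -/
def strip : SimpleGraph (Fin 4 × ℤ) where
  Adj u v := (u.1 = v.1 ∧ (u.2 = v.2 + 1 ∨ v.2 = u.2 + 1)) ∨
    (u.2 = v.2 ∧ (u.1.val = v.1.val + 1 ∨ v.1.val = u.1.val + 1))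
  symm := ⟨by
    rintro u v (⟨h, h'⟩ | ⟨h, h'⟩)
    · exact Or.inl ⟨h.symm, h'.symm⟩
    · exact Or.inr ⟨h.symm, h'.symm⟩⟩
  loopless := ⟨by rintro u (⟨-, h⟩ | ⟨-, h⟩) <;> omega⟩

/-- The cells `(r, c)` with `lo r ≤ c ≤ hi r`. -/
def Region (lo hi : Fin 4 → ℤ) : Set (Fin 4 × ℤ) := {v | lo v.1 ≤ v.2 ∧ v.2 ≤ hi v.1}

/-- The vertices joined to `v` inside `A`. -/
def component {V : Type*} (G : SimpleGraph V) (A : Set V) (v : V) : Set V := {u | ConnIn G A v u}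

section Strip

variable {lo hi lo' hi' : Fin 4 → ℤ} {A : Set (Fin 4 × ℤ)} {t : ℕ}

theorem strip_adj_row (r : Fin 4) (c : ℤ) : strip.Adj (r, c) (r, c + 1) := Or.inl ⟨rfl, Or.inr rfl⟩

theorem strip_adj_col {r r' : Fin 4} (h : r.val + 1 = r'.val) (c : ℤ) :
    strip.Adj (r, c) (r', c) := Or.inr ⟨rfl, Or.inr h.symm⟩

theorem Region.subset (h : ∀ r, lo r ≤ lo' r) (h' : ∀ r, hi' r ≤ hi r) :
    Region lo' hi' ⊆ Region lo hi :=
  fun v hv => ⟨(h v.1).trans hv.1, hv.2.trans (h' v.1)⟩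

theorem connIn_row {r : Fin 4} {c c' : ℤ} (hcc : c ≤ c') (h : ∀ x, c ≤ x → x ≤ c' → (r, x) ∈ A) :
    ConnIn strip A (r, c) (r, c') := by
  induction c', hcc using Int.leInduction with
  | base => exact .refl _
  | succ n hn ih =>
    exact (ih fun x h1 h2 => h x h1 (by omega)).trans
      (.single (strip_adj_row r n) (h n hn (by omega)) (h (n + 1) (by omega) le_rfl))

theorem connIn_col {c : ℤ} (h : ∀ r, (r, c) ∈ A) (r r' : Fin 4) :
    ConnIn strip A (r, c) (r', c) := by
  have key : ∀ r, ConnIn strip A (0, c) (r, c) := by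
    have h1 : ConnIn strip A (0, c) (1, c) := .single (strip_adj_col rfl c) (h _) (h _)
    have h2 : ConnIn strip A (1, c) (2, c) := .single (strip_adj_col rfl c) (h _) (h _)
    have h3 : ConnIn strip A (2, c) (3, c) := .single (strip_adj_col rfl c) (h _) (h _)
    intro r
    fin_cases r
    · exact .refl _
    · exact h1
    · exact h1.trans h2
    · exact (h1.trans h2).trans h3
  exact (key r).symm.trans (key r')

theorem connIn_adj_rows {r r' : Fin 4} {c : ℤ}
    (hr : r = r' ∨ r.val + 1 = r'.val ∨ r'.val + 1 = r.val)
    (h : (r, c) ∈ A) (h' : (r', c) ∈ A) : ConnIn strip A (r, c) (r', c) := by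
  rcases hr with rfl | hr | hr
  · exact .refl _
  · exact .single (strip_adj_col hr c) h h'
  · exact (ConnIn.single (strip_adj_col hr c) h' h).symm

theorem mem_component_closed {V : Type*} {G : SimpleGraph V} {A : Set V} {v : V} :
    ∀ a ∈ component G A v, ∀ b ∈ A, a ∈ A → G.Adj a b → b ∈ component G A v :=
  fun _ ha _ hb haA hab => ConnIn.trans ha (.single hab haA hb)

/-- A cell of a region is blocked if a deleted cell lies between it and the column `γ`, in its
row. -/
def Blocked (H : Finset (Fin 4 × ℤ)) (γ : ℤ) (v : Fin 4 × ℤ) : Prop :=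
  ∃ c, (v.1, c) ∈ H ∧ (v.2 ≤ c ∧ c < γ ∨ γ < c ∧ c ≤ v.2)

variable {H : Finset (Fin 4 × ℤ)} {γ : ℤ}

/-- The column `γ` is intact, and any cell not blocked is reached from it along its own row. -/
theorem blocked_of_notMem_component (hγ : ∀ r, lo r ≤ γ ∧ γ ≤ hi r) (hγH : ∀ r, (r, γ) ∉ H)
    {v : Fin 4 × ℤ} (hv : v ∈ Region lo hi) (hvC : v ∉ component strip (Region lo hi \ H) (0, γ)) :
    Blocked H γ v := by
  by_contra hb
  simp only [Blocked, not_exists, not_and, not_or] at hb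
  apply hvC
  have hcol : ConnIn strip (Region lo hi \ H) (0, γ) (v.1, γ) :=
    connIn_col (A := Region lo hi \ H) (fun r => ⟨hγ r, hγH r⟩) 0 v.1
  refine hcol.trans ?_
  obtain ⟨r, c⟩ := v
  have key : ∀ x, (c ≤ x ∧ x ≤ γ ∨ γ ≤ x ∧ x ≤ c) → (r, x) ∈ Region lo hi \ H := by
    intro x hx
    refine ⟨?_, fun hxH => ?_⟩
    · have h1 := hγ r
      have h2 := hv.1
      have h3 := hv.2
      simp only [Region, Set.mem_ofPred_eq] at h1 h2 h3 ⊢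
      omega
    · have h1 := hb x hxH
      have h2 : x ≠ γ := by rintro rfl; exact hγH r hxH
      simp only at h1
      omega
  rcases le_total c γ with h | h
  · exact (connIn_row h fun x h1 h2 => key x (Or.inl ⟨h1, h2⟩)).symm
  · exact connIn_row h fun x h1 h2 => key x (Or.inr ⟨h1, h2⟩)

theorem exists_row_notMem (hH : H.card ≤ 3) : ∃ r : Fin 4, ∀ c, (r, c) ∉ H := by
  by_contra! h
  choose g hg using h
  have : (Finset.univ.image fun r : Fin 4 => (r, g r)).card = 4 := by
    rw [Finset.card_image_of_injective _ fun a b hab => (Prod.ext_iff.1 hab).1]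
    rfl
  have h2 := Finset.card_le_card (show (Finset.univ.image fun r : Fin 4 => (r, g r)) ⊆ H by
    intro v hv
    obtain ⟨r, -, rfl⟩ := Finset.mem_image.1 hv
    exact hg r)
  omega

/-- Three deleted cells leave one row untouched, and this row joins all untouched full columns. -/
theorem hit_column_of_notMem_component (hγ : ∀ r, lo r ≤ γ ∧ γ ≤ hi r) (hγH : ∀ r, (r, γ) ∉ H)
    (hH : H.card ≤ 3) {v : Fin 4 × ℤ} (hv : ∀ r, lo r ≤ v.2 ∧ v.2 ≤ hi r)
    (hvC : v ∉ component strip (Region lo hi \ H) (0, γ)) : ∃ r, (r, v.2) ∈ H := by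
  by_contra! hb
  apply hvC
  obtain ⟨q, hq⟩ := exists_row_notMem hH
  have hcol : ConnIn strip (Region lo hi \ H) (0, γ) (q, γ) :=
    connIn_col (A := Region lo hi \ H) (fun r => ⟨hγ r, hγH r⟩) 0 q
  have hcol' : ConnIn strip (Region lo hi \ H) (q, v.2) v :=
    connIn_col (A := Region lo hi \ H) (fun r => ⟨hv r, hb r⟩) q v.1
  refine (hcol.trans ?_).trans hcol'
  have key : ∀ x, (v.2 ≤ x ∧ x ≤ γ ∨ γ ≤ x ∧ x ≤ v.2) → (q, x) ∈ Region lo hi \ H := by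
    intro x hx
    refine ⟨?_, hq x⟩
    have h1 := hγ q
    have h2 := hv q
    simp only [Region, Set.mem_ofPred_eq]
    omega
  rcases le_total v.2 γ with h | h
  · exact (connIn_row h fun x h1 h2 => key x (Or.inl ⟨h1, h2⟩)).symm
  · exact connIn_row h fun x h1 h2 => key x (Or.inr ⟨h1, h2⟩)

/-- If the component of `γ` left by deleting `S` has a ranking with `t - |S|` labels and a part of
the region is missed by `p` of the deleted cells, then the part has a ranking with `t - p` labels,
provided the cells of the part cut off from `γ` are few. -/
theorem rankable_part {S F : Finset (Fin 4 × ℤ)} {p : ℕ} (hSt : S.card ≤ t)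
    (hQ : Rankable strip (component strip (A \ S) (0, γ)) (t - S.card))
    (hW : Region lo hi ⊆ A) (hγ : ∀ r, lo r ≤ γ ∧ γ ≤ hi r) (hγS : ∀ r, (r, γ) ∉ S)
    (hH : ∀ v, v ∈ H ↔ v ∈ Region lo hi ∧ v ∈ S) (hp : p + H.card ≤ S.card)
    (hF : ∀ v ∈ Region lo hi, v ∉ component strip (Region lo hi \ H) (0, γ) → v ∈ F)
    (hFt : F.card ≤ t - p) : Rankable strip (Region lo hi) (t - p) := by
  set C := component strip (Region lo hi \ H) (0, γ) with hCdef
  have hγH : ∀ r, (r, γ) ∉ H := fun r h => hγS r ((hH _).1 h).2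
  have hsub : Region lo hi \ H ⊆ A \ S := fun v hv => ⟨hW hv.1, fun h => hv.2 ((hH v).2 ⟨hv.1, h⟩)⟩
  have hCsub : C ⊆ Region lo hi \ H := fun v hv => ConnIn.mem ⟨hγ 0, hγH 0⟩ hv
  have hWC : Region lo hi \ C ⊆ F := fun v hv => hF v hv.1 hv.2
  have hfin : (Region lo hi \ C).Finite := F.finite_toSet.subset hWC
  refine Rankable.fill (C := C) (H := H) ?_ (by omega) ?_ hfin ?_ ?_
  · refine (hQ.mono fun v hv => ?_).mono_right (by omega)
    exact ConnIn.mono hv hsub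
  · exact fun a ha b hb hab => mem_component_closed a ha b hb (hCsub ha) hab
  · exact fun v hv => ⟨((hH v).1 hv).1, fun h => (hCsub h).2 hv⟩
  · refine (Set.ncard_le_ncard hWC F.finite_toSet).trans ?_
    rwa [Set.ncard_coe_finset]

/-- This counts the cells cut off from `γ` within the full columns. Such a cell is either deleted or
determined by two deleted cells at different distances from `γ`: the nearer one blocks its row and
the farther one lies in its column. At most half of the off-diagonal pairs are ordered strictly by
`d`. -/
theorem two_mul_card_filter_lt_le (H : Finset (Fin 4 × ℤ)) (d : Fin 4 × ℤ → ℕ) :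
    2 * ((H ×ˢ H).filter fun x => x.1 = x.2 ∨ d x.1 < d x.2).card ≤ H.card * (H.card + 1) := by
  classical
  have h1 : ((H ×ˢ H).filter fun x => x.1 = x.2 ∨ d x.1 < d x.2) ⊆
      H.diag ∪ (H.offDiag.filter fun x => d x.1 < d x.2) := by
    intro x hx
    simp only [Finset.mem_filter, Finset.mem_product, Finset.mem_union, Finset.mem_diag,
      Finset.mem_offDiag] at hx ⊢
    obtain ⟨⟨h1, h2⟩, h3⟩ := hx
    by_cases he : x.1 = x.2
    · exact Or.inl ⟨h1, he⟩
    · exact Or.inr ⟨⟨h1, h2, he⟩, h3.resolve_left he⟩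
  have h2 : ((H.offDiag.filter fun x => d x.1 < d x.2).card +
      (H.offDiag.filter fun x => d x.2 < d x.1).card) ≤ H.offDiag.card := by
    rw [← Finset.card_union_of_disjoint]
    · exact Finset.card_le_card (Finset.union_subset (Finset.filter_subset _ _)
        (Finset.filter_subset _ _))
    · rw [Finset.disjoint_left]
      intro x hx hx'
      have := (Finset.mem_filter.1 hx).2
      have := (Finset.mem_filter.1 hx').2
      omega
  have h3 : (H.offDiag.filter fun x => d x.1 < d x.2).card =
      (H.offDiag.filter fun x => d x.2 < d x.1).card := by
    refine Finset.card_bij (fun x _ => x.swap) ?_ ?_ ?_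
    · intro x hx
      simp only [Finset.mem_filter, Finset.mem_offDiag, Prod.fst_swap, Prod.snd_swap] at hx ⊢
      exact ⟨⟨hx.1.2.1, hx.1.1, Ne.symm hx.1.2.2⟩, hx.2⟩
    · exact fun x _ y _ h => Prod.swap_injective h
    · intro x hx
      simp only [Finset.mem_filter, Finset.mem_offDiag] at hx
      refine ⟨x.swap, ?_, Prod.swap_swap x⟩
      simp only [Finset.mem_filter, Finset.mem_offDiag, Prod.fst_swap, Prod.snd_swap]
      exact ⟨⟨hx.1.2.1, hx.1.1, Ne.symm hx.1.2.2⟩, hx.2⟩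
  have h4 := Finset.card_le_card h1
  have h5 := Finset.card_union_le H.diag (H.offDiag.filter fun x => d x.1 < d x.2)
  rw [Finset.diag_card] at h5
  rw [Finset.offDiag_card] at h2
  have h6 : H.card ≤ H.card * H.card := Nat.le_mul_self _
  have h7 : H.card * (H.card + 1) = H.card * H.card + H.card := by ring
  omega

/-- Cells of the rows met by `H` that lie outside the columns `[α, β]`, at most `e r` of them in the
row `r` on both sides together. -/
noncomputable def extraCells (H : Finset (Fin 4 × ℤ)) (α β : ℤ) (e e' : Fin 4 → ℕ) : Finset (Fin 4 × ℤ) :=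
  (H.image Prod.fst).biUnion fun r =>
    (Finset.Ico (α - e r) α ∪ Finset.Ioc β (β + e' r)).image fun c => (r, c)

theorem card_extraCells_le (α β : ℤ) (e e' : Fin 4 → ℕ) {j K : ℕ} (hj : H.card ≤ j)
    (hK : ∀ s : Finset (Fin 4), s.card ≤ j → ∑ r ∈ s, (e r + e' r) ≤ K) :
    (extraCells H α β e e').card ≤ K := by
  refine le_trans Finset.card_biUnion_le (le_trans (Finset.sum_le_sum fun r _ => ?_)
    (hK (H.image Prod.fst) (Finset.card_image_le.trans hj)))
  refine Finset.card_image_le.trans ((Finset.card_union_le _ _).trans ?_)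
  simp

theorem mem_extraCells {α β : ℤ} {e e' : Fin 4 → ℕ} {v : Fin 4 × ℤ} {c : ℤ}
    (hc : (v.1, c) ∈ H) (h1 : α - e v.1 ≤ v.2) (h2 : v.2 ≤ β + e' v.1)
    (h3 : ¬ (α ≤ v.2 ∧ v.2 ≤ β)) : v ∈ extraCells H α β e e' := by
  simp only [extraCells, Finset.mem_biUnion, Finset.mem_image, Finset.mem_union, Finset.mem_Ico,
    Finset.mem_Ioc]
  exact ⟨v.1, ⟨_, hc, rfl⟩, v.2, by omega, rfl⟩

/-- The crude count: every cell that can be cut off lies in a row met by `H`. It is the better one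
when few cells lie beyond `γ`. -/
theorem rankable_part_of_rows {S : Finset (Fin 4 × ℤ)} {p j K : ℕ} (hSt : S.card ≤ t)
    (hQ : Rankable strip (component strip (A \ S) (0, γ)) (t - S.card))
    (hW : Region lo hi ⊆ A) (hγ : ∀ r, lo r ≤ γ ∧ γ ≤ hi r) (hγS : ∀ r, (r, γ) ∉ S)
    (hHS : H ⊆ S) (hH : ∀ v, v ∈ H ↔ v ∈ Region lo hi ∧ v ∈ S) (hp : p + H.card ≤ S.card)
    (hj : H.card ≤ j) {e e' : Fin 4 → ℕ}
    (hb : ∀ v ∈ Region lo hi, Blocked H γ v → γ - e v.1 ≤ v.2 ∧ v.2 ≤ γ + e' v.1)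
    (hK : ∀ s : Finset (Fin 4), s.card ≤ j → ∑ r ∈ s, (e r + e' r) ≤ K)
    (hKt : K ≤ t - p) : Rankable strip (Region lo hi) (t - p) := by
  refine rankable_part (F := extraCells H γ γ e e') hSt hQ hW hγ hγS hH hp ?_
    ((card_extraCells_le γ γ e e' hj hK).trans hKt)
  intro v hv hvC
  have hγH : ∀ r, (r, γ) ∉ H := fun r h => hγS r (hHS h)
  have hbl := blocked_of_notMem_component hγ hγH hv hvC
  obtain ⟨c, hc, hcv⟩ := hbl
  obtain ⟨h1, h2⟩ := hb v hv ⟨c, hc, hcv⟩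
  exact mem_extraCells hc h1 h2 (by omega)

/-- At most `j` deleted cells cut off at most `j * (j + 1) / 2` cells of the full columns `[α, β]`,
however wide these are. Outside them only the cells in rows met by `H` are counted. -/
theorem rankable_part_of_columns {S : Finset (Fin 4 × ℤ)} {p j K : ℕ} (hSt : S.card ≤ t)
    (hQ : Rankable strip (component strip (A \ S) (0, γ)) (t - S.card))
    (hW : Region lo hi ⊆ A) (hγ : ∀ r, lo r ≤ γ ∧ γ ≤ hi r) (hγS : ∀ r, (r, γ) ∉ S)
    (hHS : H ⊆ S) (hH : ∀ v, v ∈ H ↔ v ∈ Region lo hi ∧ v ∈ S) (hp : p + H.card ≤ S.card)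
    (hj : H.card ≤ j) (hj3 : j ≤ 3) {e e' : Fin 4 → ℕ} {α β : ℤ}
    (hαβ : ∀ r, lo r ≤ α ∧ β ≤ hi r)
    (hb : ∀ v ∈ Region lo hi, Blocked H γ v → α - e v.1 ≤ v.2 ∧ v.2 ≤ β + e' v.1)
    (hK : ∀ s : Finset (Fin 4), s.card ≤ j → ∑ r ∈ s, (e r + e' r) ≤ K)
    (hKt : j * (j + 1) / 2 + K ≤ t - p) : Rankable strip (Region lo hi) (t - p) := by
  classical
  set d : Fin 4 × ℤ → ℕ := fun v => (v.2 - γ).natAbs with hd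
  set F₁ := ((H ×ˢ H).filter fun x => x.1 = x.2 ∨ d x.1 < d x.2).image fun x => (x.1.1, x.2.2)
    with hF₁
  refine rankable_part (F := F₁ ∪ extraCells H α β e e') hSt hQ hW hγ hγS hH hp ?_ ?_
  · intro v hv hvC
    have hγH : ∀ r, (r, γ) ∉ H := fun r h => hγS r (hHS h)
    have hbl := blocked_of_notMem_component hγ hγH hv hvC
    obtain ⟨c, hc, hcv⟩ := hbl
    obtain ⟨h1, h2⟩ := hb v hv ⟨c, hc, hcv⟩
    rw [Finset.mem_union]
    by_cases hin : α ≤ v.2 ∧ v.2 ≤ β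
    · left
      obtain ⟨q, hq⟩ := hit_column_of_notMem_component hγ hγH (hj.trans hj3)
        (fun r => ⟨(hαβ r).1.trans hin.1, hin.2.trans (hαβ r).2⟩) hvC
      rw [hF₁, Finset.mem_image]
      by_cases hvH : v ∈ H
      · exact ⟨(v, v), Finset.mem_filter.2 ⟨Finset.mk_mem_product hvH hvH, Or.inl rfl⟩, rfl⟩
      · refine ⟨((v.1, c), (q, v.2)), Finset.mem_filter.2 ⟨Finset.mk_mem_product hc hq, Or.inr ?_⟩, rfl⟩
        have hne : c ≠ v.2 := by rintro rfl; exact hvH hc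
        simp only [hd]
        omega
    · exact Or.inr (mem_extraCells hc h1 h2 hin)
  · have h1 := card_extraCells_le α β e e' hj hK
    have h2 := Finset.card_union_le F₁ (extraCells H α β e e')
    have h3 : F₁.card ≤ _ := Finset.card_image_le
    have h4 := two_mul_card_filter_lt_le H d
    have h5 : H.card * (H.card + 1) ≤ j * (j + 1) := Nat.mul_le_mul hj (by omega)
    have h6 : F₁.card ≤ j * (j + 1) / 2 := by omega
    omega

end Strip


/-! ### Separating cuts obtained from the largest labels -/

section Cut

variable {lo hi : Fin 4 → ℤ} {N : ℤ} {t : ℕ}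

theorem exists_column_notMem (H : Finset (Fin 4 × ℤ)) {α β : ℤ} (h : H.card < β + 1 - α) :
    ∃ c, α ≤ c ∧ c ≤ β ∧ ∀ r, (r, c) ∉ H := by
  by_contra! hc
  have : Finset.Icc α β ⊆ H.image Prod.snd := by
    intro c hcI
    rw [Finset.mem_Icc] at hcI
    obtain ⟨r, hr⟩ := hc c hcI.1 hcI.2
    exact Finset.mem_image.2 ⟨_, hr, rfl⟩
  have := (Finset.card_le_card this).trans Finset.card_image_le
  rw [Int.card_Icc] at this
  omega

/-- After the deletion of `S` every column missed by `S` lies in a component that has a ranking with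
`t - |S|` labels. -/
def Survives (lo hi : Fin 4 → ℤ) (N : ℤ) (t : ℕ) (S : Finset (Fin 4 × ℤ)) : Prop :=
  ∀ c, 1 ≤ c → c ≤ N → (∀ r, (r, c) ∉ S) →
    Rankable strip (component strip (Region lo hi \ S) (0, c)) (t - S.card)

/-- The deletion of `S` separates the columns `a` and `b`. -/
def Separates (lo hi : Fin 4 → ℤ) (S : Finset (Fin 4 × ℤ)) (a b : ℤ) : Prop :=
  (∀ r, (r, a) ∉ S) ∧ (∀ r, (r, b) ∉ S) ∧ ¬ ConnIn strip (Region lo hi \ S) (0, a) (0, b)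

/-- As long as nothing is separated, all untouched columns lie in one component. A cell whose
deletion saves a label there is added to `S`, which serves all these columns simultaneously. An
untouched column exists because fewer than `N` cells have been deleted. -/
theorem exists_survives (hlo : ∀ r, lo r ≤ 1) (hhi : ∀ r, N ≤ hi r)
    (hX : Rankable strip (Region lo hi) t) (j : ℕ) (hjN : (j : ℤ) ≤ N) (hjt : j ≤ t) :
    ∃ S, Survives lo hi N t S ∧ S.card ≤ j ∧
      ((∃ a b, 1 ≤ a ∧ a < b ∧ b ≤ N ∧ Separates lo hi S a b) ∨ S.card = j) := by
  classical
  induction j with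
  | zero =>
    refine ⟨∅, fun c h1 h2 _ => ?_, by simp, Or.inr rfl⟩
    simp only [Finset.coe_empty, Set.sdiff_empty, Finset.card_empty, Nat.sub_zero]
    exact hX.mono fun v hv => ConnIn.mem ⟨(hlo 0).trans h1, h2.trans (hhi 0)⟩ hv
  | succ j ih =>
    obtain ⟨S, hS, hj, hsep⟩ := ih (by omega) (by omega)
    by_cases hsep' : ∃ a b, 1 ≤ a ∧ a < b ∧ b ≤ N ∧ Separates lo hi S a b
    · exact ⟨S, hS, by omega, Or.inl hsep'⟩
    have hcard := hsep.resolve_left hsep'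
    obtain ⟨γ, h1, h2, hγ⟩ := exists_column_notMem S (α := 1) (β := N) (by omega)
    have hγA : ((0 : Fin 4), γ) ∈ Region lo hi \ S := ⟨⟨(hlo 0).trans h1, h2.trans (hhi 0)⟩, hγ 0⟩
    have hconn : ∀ c, 1 ≤ c → c ≤ N → (∀ r, (r, c) ∉ S) →
        ConnIn strip (Region lo hi \ S) (0, γ) (0, c) := by
      intro c hc1 hc2 hc
      rcases lt_trichotomy γ c with h | rfl | h
      · by_contra hn
        exact hsep' ⟨γ, c, h1, h, hc2, hγ, hc, hn⟩
      · exact .refl _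
      · by_contra hn
        exact hsep' ⟨c, γ, hc1, h, h2, hc, hγ, fun h => hn h.symm⟩
    have hr := hS γ h1 h2 hγ
    set C := component strip (Region lo hi \ S) (0, γ) with hC
    obtain ⟨s, hs⟩ : ∃ s, t - S.card = s + 1 := ⟨t - S.card - 1, by omega⟩
    rw [hs] at hr
    have hCC : ∀ u ∈ C, ConnIn strip C (0, γ) u := by
      intro u hu
      refine (ConnIn.closed (C := C) ?_ (ConnIn.refl _) hu).2.mono Set.inter_subset_right
      exact fun a ha b hb hab => mem_component_closed a ha b hb (ConnIn.mem hγA ha) hab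
    obtain ⟨v, hv, hvr⟩ := hr.exists_diff_singleton ⟨_, ConnIn.refl _⟩
      fun u hu w hw => (hCC u hu).symm.trans (hCC w hw)
    have hvS : v ∉ S := (ConnIn.mem hγA hv).2
    have hcard' : (insert v S).card = j + 1 := by rw [Finset.card_insert_of_notMem hvS, hcard]
    refine ⟨insert v S, fun c hc1 hc2 hc => ?_, hcard'.le, Or.inr hcard'⟩
    have hcS : ∀ r, (r, c) ∉ S := fun r h => hc r (Finset.mem_insert_of_mem h)
    rw [hcard', show t - (j + 1) = s by omega]
    refine hvr.mono fun u hu => ⟨?_, ?_⟩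
    · refine (hconn c hc1 hc2 hcS).trans (ConnIn.mono hu ?_)
      exact Set.sdiff_subset_sdiff_right (by simp)
    · rintro rfl
      have := (ConnIn.mem (A := Region lo hi \ ↑(insert u S))
        ⟨⟨(hlo 0).trans hc1, hc2.trans (hhi 0)⟩, hc 0⟩ hu).2
      simp at this

/-- An untouched column strictly between is separated from one of the two ends, so the pair can be
moved closer together. -/
theorem exists_consecutive_separates {S : Finset (Fin 4 × ℤ)} (n : ℕ) :
    ∀ a b : ℤ, b - a ≤ n → a < b → Separates lo hi S a b →
      ∃ a' b', a ≤ a' ∧ a' < b' ∧ b' ≤ b ∧ Separates lo hi S a' b' ∧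
        ∀ c, a' < c → c < b' → ∃ r, (r, c) ∈ S := by
  induction n with
  | zero => intro a b h h'; omega
  | succ n ih =>
    intro a b hn hab hS
    by_cases h : ∀ c, a < c → c < b → ∃ r, (r, c) ∈ S
    · exact ⟨a, b, le_rfl, hab, le_rfl, hS, h⟩
    push Not at h
    obtain ⟨c, hac, hcb, hc⟩ := h
    by_cases hconn : ConnIn strip (Region lo hi \ S) (0, a) (0, c)
    · obtain ⟨a', b', h1, h2, h3, h4⟩ := ih c b (by omega) hcb
        ⟨hc, hS.2.1, fun h => hS.2.2 (hconn.trans h)⟩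
      exact ⟨a', b', by omega, h2, h3, h4⟩
    · obtain ⟨a', b', h1, h2, h3, h4⟩ := ih a c (by omega) hac ⟨hS.1, hc, hconn⟩
      exact ⟨a', b', h1, h2, by omega, h4⟩

/-- A set `P` of cells in the columns strictly between `a` and `b` that separates these columns. The
first and the last cell of `P` in the row `r` are in the columns `f r` and `l r`, and the two parts of
the region on both sides of `P` have rankings with `t - |P|` labels. -/
structure IsCut (lo hi : Fin 4 → ℤ) (N : ℤ) (t : ℕ) (P : Finset (Fin 4 × ℤ)) (a b : ℤ)
    (f l : Fin 4 → ℤ) : Prop where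
  one_le : 1 ≤ a
  le : b ≤ N
  card_le : P.card ≤ 6
  mem : ∀ v ∈ P, a < v.2 ∧ v.2 < b
  f_mem : ∀ r, (r, f r) ∈ P
  l_mem : ∀ r, (r, l r) ∈ P
  f_le : ∀ v ∈ P, f v.1 ≤ v.2
  le_l : ∀ v ∈ P, v.2 ≤ l v.1
  column : ∀ c, a < c → c < b → ∃ r, (r, c) ∈ P
  -- The excluded path enters along row `r` up to column `x`, runs in row `q` from `x` to `y`, and
  -- leaves along row `s`.
  no_path : ∀ r q s : Fin 4, ∀ x y : ℤ, (r = q ∨ r.val + 1 = q.val ∨ q.val + 1 = r.val) →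
    (q = s ∨ q.val + 1 = s.val ∨ s.val + 1 = q.val) → a < x → x ≤ y → y < b →
    x < f r → (∀ z, x ≤ z → z ≤ y → (q, z) ∉ P) → l s < y → False
  -- `A` is the first full column, and row `r` has at most `e r` cells before it. At most `6 - |P|`
  -- deleted cells outside `P` can fall on this side; the last condition says that the cells they
  -- cut off are few enough to be filled in.
  left : ∀ (lo' : Fin 4 → ℤ) (A : ℤ) (e : Fin 4 → ℕ) (K : ℕ), (∀ r, lo r ≤ lo' r) →
    (∀ r, lo' r ≤ A) → (∀ r, A - e r ≤ lo' r) → A ≤ a →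
    (∀ s : Finset (Fin 4), s.card ≤ 6 - P.card → ∑ r ∈ s, e r ≤ K) →
    (6 - P.card) * (6 - P.card + 1) / 2 + K ≤ t - P.card →
    Rankable strip (Region lo' fun r => f r - 1) (t - P.card)
  right : ∀ (hi' : Fin 4 → ℤ) (B : ℤ) (e : Fin 4 → ℕ) (K : ℕ), (∀ r, hi' r ≤ hi r) →
    (∀ r, B ≤ hi' r) → (∀ r, hi' r ≤ B + e r) → b ≤ B →
    (∀ s : Finset (Fin 4), s.card ≤ 6 - P.card → ∑ r ∈ s, e r ≤ K) →
    (6 - P.card) * (6 - P.card + 1) / 2 + K ≤ t - P.card →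
    Rankable strip (Region (fun r => l r + 1) hi') (t - P.card)
  -- Here `e` counts the cells beyond `b` rather than beyond the last full column.
  right_of_rows : ∀ (hi' : Fin 4 → ℤ) (e : Fin 4 → ℕ) (K : ℕ), (∀ r, hi' r ≤ hi r) →
    (∀ r, b ≤ hi' r) → (∀ r, hi' r ≤ b + e r) →
    (∀ s : Finset (Fin 4), s.card ≤ 6 - P.card → ∑ r ∈ s, e r ≤ K) → K ≤ t - P.card →
    Rankable strip (Region (fun r => l r + 1) hi') (t - P.card)

/-- Between two consecutive untouched columns `a`, `b` that are separated, the deleted cells alone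
block every crossing; they form `P`. The remaining deleted cells are restored on each side by
`rankable_part_of_columns` or `rankable_part_of_rows`, with `γ = a` or `γ = b`. -/
theorem Survives.exists_isCut (hlo : ∀ r, lo r ≤ 1) (hhi : ∀ r, N ≤ hi r)
    {S : Finset (Fin 4 × ℤ)} (hS : Survives lo hi N t S) (hS6 : S.card ≤ 6) (ht : 6 ≤ t) {a b : ℤ}
    (ha : 1 ≤ a) (hab : a < b) (hb : b ≤ N) (hsep : Separates lo hi S a b) :
    ∃ P a b f l, IsCut lo hi N t P a b f l := by
  classical
  obtain ⟨a', b', h1, h2, h3, ⟨haS, hbS, hsep'⟩, hcol⟩ :=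
    exists_consecutive_separates (b - a).toNat a b (by omega) hab hsep
  replace ha : 1 ≤ a' := by omega
  replace hb : b' ≤ N := by omega
  clear hsep hab h1 h3 a b
  rename' a' => a, b' => b, h2 => hab, hsep' => hsep
  set P := S.filter fun v => a < v.2 ∧ v.2 < b with hP
  have hPS : ∀ v, v ∈ P ↔ v ∈ S ∧ a < v.2 ∧ v.2 < b := fun v => Finset.mem_filter
  have hfull : ∀ r c, a ≤ c → c ≤ b → (r, c) ∈ Region lo hi := fun r c h1 h2 =>
    ⟨by have := hlo r; simp only; omega, by have := hhi r; simp only; omega⟩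
  have hfree : ∀ r c, a ≤ c → c ≤ b → (r, c) ∉ P → (r, c) ∈ Region lo hi \ S := by
    refine fun r c h1 h2 hc => ⟨hfull r c h1 h2, fun h => ?_⟩
    rcases eq_or_lt_of_le h1 with rfl | h1
    · exact haS r h
    rcases eq_or_lt_of_le h2 with rfl | h2
    · exact hbS r h
    exact hc ((hPS _).2 ⟨h, h1, h2⟩)
  have hPa : ∀ r, (r, a) ∉ P := fun r h => haS r ((hPS _).1 h).1
  have hPb : ∀ r, (r, b) ∉ P := fun r h => hbS r ((hPS _).1 h).1
  have hca : ∀ r, ConnIn strip (Region lo hi \ S) (0, a) (r, a) := fun r =>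
    connIn_col (fun r => hfree r a le_rfl hab.le (hPa r)) 0 r
  have hcb : ∀ r, ConnIn strip (Region lo hi \ S) (r, b) (0, b) := fun r =>
    connIn_col (fun r => hfree r b hab.le le_rfl (hPb r)) r 0
  have hrow : ∀ r, ∃ c, (r, c) ∈ P := by
    intro r
    by_contra! h
    exact hsep (((hca r).trans (connIn_row hab.le fun x h1 h2 => hfree r x h1 h2 (h x))).trans
      (hcb r))
  have hne : ∀ r, (P.filter fun v => v.1 = r).Nonempty := fun r => by
    obtain ⟨c, hc⟩ := hrow r
    exact ⟨_, Finset.mem_filter.2 ⟨hc, rfl⟩⟩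
  have hf : ∀ r, ∃ c, (r, c) ∈ P ∧ ∀ v ∈ P, v.1 = r → c ≤ v.2 := by
    intro r
    obtain ⟨⟨q, c⟩, hv, hm⟩ := Finset.exists_min_image _ Prod.snd (hne r)
    obtain ⟨h1, rfl⟩ := Finset.mem_filter.1 hv
    exact ⟨c, h1, fun v h h' => hm v (Finset.mem_filter.2 ⟨h, h'⟩)⟩
  have hl : ∀ r, ∃ c, (r, c) ∈ P ∧ ∀ v ∈ P, v.1 = r → v.2 ≤ c := by
    intro r
    obtain ⟨⟨q, c⟩, hv, hm⟩ := Finset.exists_max_image _ Prod.snd (hne r)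
    obtain ⟨h1, rfl⟩ := Finset.mem_filter.1 hv
    exact ⟨c, h1, fun v h h' => hm v (Finset.mem_filter.2 ⟨h, h'⟩)⟩
  choose f hfP hfm using hf
  choose l hlP hlm using hl
  have hfab : ∀ r, a < f r ∧ f r < b := fun r => ((hPS _).1 (hfP r)).2
  have hlab : ∀ r, a < l r ∧ l r < b := fun r => ((hPS _).1 (hlP r)).2
  have h4P : 4 ≤ P.card := by
    have h := Finset.card_le_card (show (Finset.univ.image fun r : Fin 4 => (r, f r)) ⊆ P by
      intro v hv
      obtain ⟨r, -, rfl⟩ := Finset.mem_image.1 hv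
      exact hfP r)
    rwa [Finset.card_image_of_injective _ fun a b hab => (Prod.ext_iff.1 hab).1] at h
  have hPcard : P.card ≤ S.card := Finset.card_le_card (Finset.filter_subset _ _)
  have hdis : ∀ W : Set (Fin 4 × ℤ), (∀ v ∈ W, v ∉ P) →
      P.card + (S.filter (· ∈ W)).card ≤ S.card := by
    intro W hW
    rw [← Finset.card_union_of_disjoint]
    · exact Finset.card_le_card (Finset.union_subset (Finset.filter_subset _ _)
        (Finset.filter_subset _ _))
    · exact Finset.disjoint_left.2 fun v hv hv' => hW v (Finset.mem_filter.1 hv').2 hv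
  have hmem : ∀ (W : Set (Fin 4 × ℤ)) v, v ∈ S.filter (· ∈ W) ↔ v ∈ W ∧ v ∈ S := fun W v => by
    rw [Finset.mem_filter, and_comm]
  refine ⟨P, a, b, f, l, ha, hb, hPcard.trans hS6, fun v hv => ((hPS v).1 hv).2, hfP, hlP,
    fun v hv => hfm _ v hv rfl, fun v hv => hlm _ v hv rfl, ?_, ?_, ?_, ?_, ?_⟩
  · intro c h1 h2
    obtain ⟨r, hr⟩ := hcol c h1 h2
    exact ⟨r, (hPS _).2 ⟨hr, h1, h2⟩⟩
  · intro r q s x y hrq hqs hax hxy hyb hx hxy' hy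
    have h1 : ∀ z, a ≤ z → z ≤ x → (r, z) ∉ P := fun z h1 h2 h => by
      have := hfm r _ h rfl
      simp only at this
      omega
    have h2 : ∀ z, y ≤ z → z ≤ b → (s, z) ∉ P := fun z h1 h2 h => by
      have := hlm s _ h rfl
      simp only at this
      omega
    refine hsep ((hca r).trans ?_ |>.trans (hcb s))
    refine (connIn_row hax.le fun z h h' => hfree r z h (by omega) (h1 z h h')).trans ?_
    refine (connIn_adj_rows hrq (hfree _ _ (by omega) (by omega) (h1 _ (by omega) le_rfl))
      (hfree _ _ (by omega) (by omega) (hxy' x le_rfl hxy))).trans ?_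
    refine (connIn_row hxy fun z h h' => hfree q z (by omega) (by omega) (hxy' z h h')).trans ?_
    refine (connIn_adj_rows hqs (hfree _ _ (by omega) (by omega) (hxy' y hxy le_rfl))
      (hfree _ _ (by omega) (by omega) (h2 _ le_rfl (by omega)))).trans ?_
    exact connIn_row hyb.le fun z h h' => hfree s z (by omega) h' (h2 z h h')
  · intro lo' A e K hlo' hA hAe hAa hK hKt
    have hWP : ∀ v ∈ Region lo' fun r => f r - 1, v ∉ P := fun v hv hvP => by
      have h1 := hfm _ v hvP rfl
      have h2 := hv.2
      simp only at h2
      omega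
    have hd := hdis _ hWP
    refine rankable_part_of_columns (A := Region lo hi) (γ := a) (j := 6 - P.card) (K := K) (α := A)
      (β := a) (e := e) (e' := fun _ => 0) (H := S.filter (· ∈ Region lo' fun r => f r - 1))
      (hS6.trans ht) (hS a ha (by omega) haS) ?_ ?_ haS (Finset.filter_subset _ _) (hmem _) hd
      (by omega) ?_ ?_ ?_ (by simpa using hK) hKt
    · refine Region.subset hlo' fun r => ?_
      have := hfab r
      have := hhi r
      omega
    · intro r
      have := hfab r
      have := hA r
      omega
    · omega
    · intro r
      have := hfab r
      have := hA r
      omega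
    · rintro v hv ⟨c, hc, hcv⟩
      have h1 := hAe v.1
      have h2 := hv.1
      have h3 := hv.2
      simp only at h2 h3
      have hcS := (Finset.mem_filter.1 hc).1
      have hcv : v.2 ≤ c ∧ c < a := by
        refine hcv.resolve_right fun h => ?_
        refine hWP _ ((hmem _ _).1 hc).1 ((hPS _).2 ⟨hcS, h.1, ?_⟩)
        have := hfab v.1
        simp only
        omega
      push_cast
      omega
  · intro hi' B e K hhi' hB hBe hbB hK hKt
    have hWP : ∀ v ∈ Region (fun r => l r + 1) hi', v ∉ P := fun v hv hvP => by
      have h1 := hlm _ v hvP rfl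
      have h2 := hv.1
      simp only at h2
      omega
    have hd := hdis _ hWP
    refine rankable_part_of_columns (A := Region lo hi) (γ := b) (j := 6 - P.card) (K := K) (α := b)
      (β := B) (e := fun _ => 0) (e' := e) (H := S.filter (· ∈ Region (fun r => l r + 1) hi'))
      (hS6.trans ht) (hS b (by omega) hb hbS) ?_ ?_ hbS (Finset.filter_subset _ _) (hmem _) hd
      (by omega) ?_ ?_ ?_ (by simpa using hK) hKt
    · refine Region.subset (fun r => ?_) hhi'
      have := hlab r
      have := hlo r
      omega
    · intro r
      have := hlab r
      have := hB r
      omega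
    · omega
    · intro r
      have := hlab r
      have := hB r
      omega
    · rintro v hv ⟨c, hc, hcv⟩
      have h1 := hBe v.1
      have h2 := hv.1
      have h3 := hv.2
      simp only at h2 h3
      have hcS := (Finset.mem_filter.1 hc).1
      have hcv : b < c ∧ c ≤ v.2 := by
        refine hcv.resolve_left fun h => ?_
        refine hWP _ ((hmem _ _).1 hc).1 ((hPS _).2 ⟨hcS, ?_, h.2⟩)
        have := hlab v.1
        simp only
        omega
      push_cast
      omega
  · intro hi' e K hhi' hB hBe hK hKt
    have hWP : ∀ v ∈ Region (fun r => l r + 1) hi', v ∉ P := fun v hv hvP => by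
      have h1 := hlm _ v hvP rfl
      have h2 := hv.1
      simp only at h2
      omega
    have hd := hdis _ hWP
    refine rankable_part_of_rows (A := Region lo hi) (γ := b) (j := 6 - P.card) (K := K)
      (e := fun _ => 0) (e' := e) (H := S.filter (· ∈ Region (fun r => l r + 1) hi'))
      (hS6.trans ht) (hS b (by omega) hb hbS) ?_ ?_ hbS (Finset.filter_subset _ _) (hmem _) hd
      (by omega) ?_ (by simpa using hK) hKt
    · refine Region.subset (fun r => ?_) hhi'
      have := hlab r
      have := hlo r
      omega
    · intro r
      have := hlab r
      have := hB r
      omega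
    · rintro v hv ⟨c, hc, hcv⟩
      have h1 := hBe v.1
      have h2 := hv.1
      have h3 := hv.2
      simp only at h2 h3
      have hcS := (Finset.mem_filter.1 hc).1
      have hcv : b < c ∧ c ≤ v.2 := by
        refine hcv.resolve_left fun h => ?_
        refine hWP _ ((hmem _ _).1 hc).1 ((hPS _).2 ⟨hcS, ?_, h.2⟩)
        have := hlab v.1
        simp only
        omega
      push_cast
      omega

/-- A part of the region with at least four full columns and at most three of the seven deleted
cells has a ranking with `t - 4` labels. -/
theorem Survives.rankable_window {S : Finset (Fin 4 × ℤ)} (hS : Survives lo hi N t S)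
    (hS7 : S.card = 7) (ht : 7 ≤ t) {lo' hi' : Fin 4 → ℤ} (hW : Region lo' hi' ⊆ Region lo hi)
    {α β : ℤ} (hα : 1 ≤ α) (hβ : β ≤ N) (hαβ : α + 3 ≤ β) {e e' : Fin 4 → ℕ}
    (h1 : ∀ r, lo' r ≤ α ∧ α - e r ≤ lo' r) (h2 : ∀ r, β ≤ hi' r ∧ hi' r ≤ β + e' r)
    {H : Finset (Fin 4 × ℤ)} (hH : ∀ v, v ∈ H ↔ v ∈ Region lo' hi' ∧ v ∈ S) (hH3 : H.card ≤ 3)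
    {K : ℕ} (hK : ∀ s : Finset (Fin 4), s.card ≤ 3 → ∑ r ∈ s, (e r + e' r) ≤ K)
    (hKt : 6 + K ≤ t - 4) : Rankable strip (Region lo' hi') (t - 4) := by
  obtain ⟨γ, hγ1, hγ2, hγ⟩ := exists_column_notMem H (α := α) (β := β) (by omega)
  have hγW : ∀ r, lo' r ≤ γ ∧ γ ≤ hi' r := fun r => by
    have := h1 r
    have := h2 r
    omega
  have hγS : ∀ r, (r, γ) ∉ S := fun r h => hγ r ((hH _).2 ⟨hγW r, h⟩)
  refine rankable_part_of_columns (A := Region lo hi) (γ := γ) (H := H) (α := α) (β := β) (j := 3)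
    (by omega) (hS γ (by omega) (by omega) hγS) hW hγW hγS (fun v hv => ((hH v).1 hv).2) hH
    (by omega) hH3 le_rfl (fun r => ⟨(h1 r).1, (h2 r).1⟩) ?_ hK (by simpa using hKt)
  intro v hv _
  have h3 := h1 v.1
  have h4 := h2 v.1
  have h5 := hv.1
  have h6 := hv.2
  omega

/-- Seven deletions without a separation are impossible: one of the halves `≤ μ` and `> μ` has at
most three of them, so it would be rankable with `t - 4` labels. Three deletions cut off at most 6
cells in the full columns and `K` beyond. -/
theorem exists_isCut (hX : Rankable strip (Region lo hi) t) (hlo : ∀ r, lo r ≤ 1)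
    (hhi : ∀ r, N ≤ hi r) (hN : 7 ≤ N) (ht : 7 ≤ t) {μ : ℤ} (hμ : 4 ≤ μ) (hμN : μ + 4 ≤ N)
    {e e' : Fin 4 → ℕ} (he : ∀ r, lo r ≤ 1 - e r) (he' : ∀ r, N + e' r ≤ hi r) {K : ℕ}
    (hK : ∀ s : Finset (Fin 4), s.card ≤ 3 → ∑ r ∈ s, e r ≤ K)
    (hK' : ∀ s : Finset (Fin 4), s.card ≤ 3 → ∑ r ∈ s, e' r ≤ K) (hKt : 6 + K ≤ t - 4)
    (hL : ¬ Rankable strip (Region (fun r => 1 - e r) fun _ => μ) (t - 4))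
    (hR : ¬ Rankable strip (Region (fun _ => μ + 1) fun r => N + e' r) (t - 4)) :
    ∃ P a b f l, IsCut lo hi N t P a b f l := by
  classical
  obtain ⟨S, hS, hS7, hcase⟩ := exists_survives hlo hhi hX 7 (by omega) ht
  have hsep : S.card < 7 → ∃ P a b f l, IsCut lo hi N t P a b f l := by
    intro h7
    obtain ⟨a, b, h1, h2, h3, h4⟩ := hcase.resolve_right h7.ne
    exact hS.exists_isCut hlo hhi (by omega) (by omega) h1 h2 h3 h4
  rcases lt_or_eq_of_le hS7 with h7 | h7
  · exact hsep h7
  exfalso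
  have hmem : ∀ (W : Set (Fin 4 × ℤ)) v, v ∈ S.filter (· ∈ W) ↔ v ∈ W ∧ v ∈ S := fun W v => by
    rw [Finset.mem_filter, and_comm]
  have hsum : (S.filter (· ∈ Region (fun r => 1 - e r) fun _ => μ)).card +
      (S.filter (· ∈ Region (fun _ => μ + 1) fun r => N + e' r)).card ≤ 7 := by
    rw [← Finset.card_union_of_disjoint, ← h7]
    · exact Finset.card_le_card (Finset.union_subset (Finset.filter_subset _ _)
        (Finset.filter_subset _ _))
    · refine Finset.disjoint_left.2 fun v hv hv' => ?_
      have h1 := (Finset.mem_filter.1 hv).2.2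
      have h2 := (Finset.mem_filter.1 hv').2.1
      simp only at h1 h2
      omega
  by_cases h3 : (S.filter (· ∈ Region (fun r => 1 - e r) fun _ => μ)).card ≤ 3
  · refine hL (hS.rankable_window h7 ht (Region.subset he fun r => ?_) (α := 1)
      (β := μ) le_rfl (by omega) (by omega) (e := e) (e' := fun _ => 0) (fun r => by simp)
      (fun r => by simp) (hmem _) h3 (by simpa using hK) hKt)
    have := hhi r
    omega
  · refine hR (hS.rankable_window h7 ht (Region.subset (fun r => ?_) he') (α := μ + 1)
      (β := N) (by omega) le_rfl (by omega) (e := fun _ => 0) (e' := e') (fun r => by simp)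
      (fun r => by simp) (hmem _) (by omega) (by simpa using hK') hKt)
    have := hlo r
    omega

end Cut


/-! ### Shapes without rankings and the geometry of cuts -/

/-- `n` full columns with `L r` further cells on the left and `R r` further cells on the right of the
row `r` have no ranking with `t` labels. -/
def BadShape (t : ℕ) (n : ℤ) (L R : Fin 4 → ℕ) : Prop :=
  ¬ Rankable strip (Region (fun r => 1 - L r) fun r => n + R r) t

section Shape

variable {lo hi : Fin 4 → ℤ} {N n : ℤ} {t τ : ℕ} {L R : Fin 4 → ℕ}

theorem forall_fin_four {p : Fin 4 → Prop} : (∀ r, p r) ↔ p 0 ∧ p 1 ∧ p 2 ∧ p 3 :=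
  ⟨fun h => ⟨h 0, h 1, h 2, h 3⟩, fun h r => by
    fin_cases r
    exacts [h.1, h.2.1, h.2.2.1, h.2.2.2]⟩

theorem exists_fin_four {p : Fin 4 → Prop} : (∃ r, p r) ↔ p 0 ∨ p 1 ∨ p 2 ∨ p 3 := by
  constructor
  · rintro ⟨r, hr⟩
    fin_cases r
    exacts [Or.inl hr, Or.inr (Or.inl hr), Or.inr (Or.inr (Or.inl hr)), Or.inr (Or.inr (Or.inr hr))]
  · rintro (h | h | h | h)
    exacts [⟨_, h⟩, ⟨_, h⟩, ⟨_, h⟩, ⟨_, h⟩]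

theorem rankable_region_translate (x : ℤ) (h : Rankable strip (Region lo hi) t) :
    Rankable strip (Region (fun r => lo r - x) fun r => hi r - x) t := by
  refine h.comap (fun v => (v.1, v.2 + x)) ?_ ?_ ?_
  · rintro ⟨a, b⟩ _ ⟨c, d⟩ _ h
    simp only [Prod.mk.injEq] at h ⊢
    exact ⟨h.1, by omega⟩
  · rintro ⟨a, b⟩ _ ⟨c, d⟩ _ h
    simp only [strip] at h ⊢
    omega
  · intro v hv
    have h1 := hv.1
    have h2 := hv.2
    simp only at h1 h2
    exact ⟨by simp only; omega, by simp only; omega⟩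

theorem rankable_region_flip (h : Rankable strip (Region lo hi) t) :
    Rankable strip (Region (fun r => lo r.rev) fun r => hi r.rev) t := by
  refine h.comap (fun v => (v.1.rev, v.2)) ?_ ?_ ?_
  · rintro ⟨a, b⟩ _ ⟨c, d⟩ _ h
    simpa using h
  · rintro ⟨a, b⟩ _ ⟨c, d⟩ _ h
    simp only [strip, Fin.rev_inj, Fin.val_rev] at h ⊢
    omega
  · exact fun v hv => hv

theorem rankable_region_mirror (x : ℤ) (h : Rankable strip (Region lo hi) t) :
    Rankable strip (Region (fun r => x - hi r) fun r => x - lo r) t := by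
  refine h.comap (fun v => (v.1, x - v.2)) ?_ ?_ ?_
  · rintro ⟨a, b⟩ _ ⟨c, d⟩ _ h
    simp only [Prod.mk.injEq] at h ⊢
    exact ⟨h.1, by omega⟩
  · rintro ⟨a, b⟩ _ ⟨c, d⟩ _ h
    simp only [strip] at h ⊢
    omega
  · intro v hv
    have h1 := hv.1
    have h2 := hv.2
    simp only at h1 h2
    exact ⟨by simp only; omega, by simp only; omega⟩

theorem BadShape.not_rankable (h : BadShape τ n L R) (ht : t ≤ τ) (x : ℤ)
    (hL : ∀ r, lo r ≤ x + 1 - L r) (hR : ∀ r, x + n + R r ≤ hi r) :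
    ¬ Rankable strip (Region lo hi) t := fun hr => by
  refine h ((rankable_region_translate x (hr.mono_right ht)).mono (Region.subset ?_ ?_))
  · intro r
    have := hL r
    omega
  · intro r
    have := hR r
    omega

theorem BadShape.mirror (h : BadShape t n L R) : BadShape t n R L := fun hr => by
  refine h ((rankable_region_mirror (n + 1) hr).mono (Region.subset ?_ ?_))
  · intro r
    omega
  · intro r
    omega

theorem BadShape.flip (h : BadShape t n L R) :
    BadShape t n (fun r => L r.rev) fun r => R r.rev := fun hr => by
  refine h ((rankable_region_flip hr).mono (Region.subset ?_ ?_)) <;> simp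

theorem BadShape.mono {n' : ℤ} {L' R' : Fin 4 → ℕ} (h : BadShape τ n L R) (ht : t ≤ τ) (x : ℤ)
    (hL : ∀ r, (L r : ℤ) ≤ x + L' r) (hR : ∀ r, x + n + R r ≤ n' + R' r) :
    BadShape t n' L' R' :=
  h.not_rankable ht x (fun r => by have := hL r; omega) hR

/-- One further cell in the two middle rows and two further cells in one of the outer rows. -/
def tapered : Fin 2 → Fin 4 → ℕ := ![![0, 1, 1, 2], ![2, 1, 1, 0]]

/-- One further cell in two neighbouring rows. -/
def paired : Fin 3 → Fin 4 → ℕ := ![![1, 1, 0, 0], ![0, 1, 1, 0], ![0, 0, 1, 1]]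

/-- Few extra cells lie in at most two rows. -/
abbrev Light (e : Fin 4 → ℕ) : Prop :=
  (∀ s : Finset (Fin 4), s.card ≤ 2 → ∑ r ∈ s, e r ≤ 3) ∧
    ∀ s : Finset (Fin 4), s.card ≤ 1 → ∑ r ∈ s, e r ≤ 2

variable {P : Finset (Fin 4 × ℤ)} {a b : ℤ} {f l : Fin 4 → ℤ}

theorem IsCut.four_le (h : IsCut lo hi N t P a b f l) : 4 ≤ P.card := by
  have h := Finset.card_le_card (show (Finset.univ.image fun r : Fin 4 => (r, f r)) ⊆ P by
    intro v hv
    obtain ⟨r, -, rfl⟩ := Finset.mem_image.1 hv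
    exact h.f_mem r)
  rwa [Finset.card_image_of_injective _ fun a b hab => (Prod.ext_iff.1 hab).1] at h

theorem IsCut.width_le (h : IsCut lo hi N t P a b f l) : b - a - 1 ≤ P.card := by
  have : Finset.Ioo a b ⊆ P.image Prod.snd := by
    intro c hc
    rw [Finset.mem_Ioo] at hc
    obtain ⟨r, hr⟩ := h.column c hc.1 hc.2
    exact Finset.mem_image.2 ⟨_, hr, rfl⟩
  have := (Finset.card_le_card this).trans Finset.card_image_le
  rw [Int.card_Ioo] at this
  omega

theorem IsCut.bounds (h : IsCut lo hi N t P a b f l) (r : Fin 4) :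
    a < f r ∧ f r ≤ l r ∧ l r < b :=
  ⟨(h.mem _ (h.f_mem r)).1, h.f_le _ (h.l_mem r), (h.mem _ (h.l_mem r)).2⟩

/-- Otherwise one could come along row `r` to column `l s + 1`, step into row `s` and leave. -/
theorem IsCut.adj_rows (h : IsCut lo hi N t P a b f l) {r s : Fin 4}
    (hrs : r.val + 1 = s.val ∨ s.val + 1 = r.val) : f r ≤ l s + 1 := by
  by_contra! hlt
  have h1 := h.bounds r
  have h2 := h.bounds s
  refine h.no_path r s s (l s + 1) (l s + 1) (Or.inr hrs) (Or.inl rfl) (by omega) le_rfl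
    (by omega) hlt (fun z h1 h2 hz => ?_) (by omega)
  have := h.le_l _ hz
  simp only at this
  omega

theorem IsCut.eq_image (h : IsCut lo hi N t P a b f l) (hP : P.card = 4) :
    P = Finset.univ.image fun r : Fin 4 => (r, f r) := by
  symm
  apply Finset.eq_of_subset_of_card_le
  · intro v hv
    obtain ⟨r, -, rfl⟩ := Finset.mem_image.1 hv
    exact h.f_mem r
  · rw [Finset.card_image_of_injective _ fun a b hab => (Prod.ext_iff.1 hab).1, hP]
    rfl

theorem IsCut.eq_of_mem (h : IsCut lo hi N t P a b f l) (hP : P.card = 4) {v : Fin 4 × ℤ}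
    (hv : v ∈ P) : v.2 = f v.1 := by
  rw [h.eq_image hP] at hv
  obtain ⟨r, -, rfl⟩ := Finset.mem_image.1 hv
  rfl

/-- A cut with four cells has one of them in each row. -/
theorem IsCut.four (h : IsCut lo hi N t P a b f l) (hP : P.card = 4) :
    (∀ r, l r = f r) ∧ (a < f 0 ∧ a < f 1 ∧ a < f 2 ∧ a < f 3) ∧
      (f 0 < b ∧ f 1 < b ∧ f 2 < b ∧ f 3 < b) ∧
      (f 0 ≤ f 1 + 1 ∧ f 1 ≤ f 0 + 1 ∧ f 1 ≤ f 2 + 1 ∧ f 2 ≤ f 1 + 1 ∧ f 2 ≤ f 3 + 1 ∧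
        f 3 ≤ f 2 + 1) ∧ b ≤ a + 5 ∧ a + 2 ≤ b ∧
      ∀ c, a < c → c < b → c = f 0 ∨ c = f 1 ∨ c = f 2 ∨ c = f 3 := by
  have hl : ∀ r, l r = f r := fun r => h.eq_of_mem hP (h.l_mem r)
  have hb := h.bounds
  have hw := h.width_le
  simp only [hl] at hb
  have hadj : ∀ {r s : Fin 4}, (r.val + 1 = s.val ∨ s.val + 1 = r.val) → f r ≤ f s + 1 :=
    fun {r s} hrs => by simpa [hl] using h.adj_rows hrs
  have h0 := hb 0
  have h1 := hb 1
  have h2 := hb 2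
  have h3 := hb 3
  refine ⟨hl, by omega, by omega, ⟨hadj (by decide), hadj (by decide), hadj (by decide),
    hadj (by decide), hadj (by decide), hadj (by decide)⟩, by omega, by omega, fun c h1 h2 => ?_⟩
  obtain ⟨r, hr⟩ := h.column c h1 h2
  exact (exists_fin_four (p := fun r => c = f r)).1 ⟨r, h.eq_of_mem hP hr⟩

/-- For `|P| = 4` two further deleted cells can cut off 3 + 3 cells, which must not exceed `t - 4`;
hence `10 ≤ t`. For `|P| = 5` the count is 1 + 2, and for `|P| = 6` it is 0, so `9 ≤ t` is enough.
`Light` provides the second summands. -/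
theorem IsCut.not_left (h : IsCut lo hi N t P a b f l)
    (ht : 10 ≤ t ∨ 9 ≤ t ∧ P.card ≠ 4) (hbad : BadShape τ n L R)
    (hτ : t - P.card ≤ τ) (hL : Light L) (hlo : ∀ r, lo r ≤ 1 - L r)
    (hR : ∀ r, n + R r < f r) : False := by
  have hP := h.four_le
  have hP' := h.card_le
  have key : ∃ K, (∀ s : Finset (Fin 4), s.card ≤ 6 - P.card → ∑ r ∈ s, L r ≤ K) ∧
      (6 - P.card) * (6 - P.card + 1) / 2 + K ≤ t - P.card := by
    obtain hp | hp | hp : P.card = 4 ∨ P.card = 5 ∨ P.card = 6 := by omega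
    · exact ⟨3, by rw [hp]; exact hL.1, by rw [hp]; omega⟩
    · exact ⟨2, by rw [hp]; exact hL.2, by rw [hp]; omega⟩
    · refine ⟨0, fun s hs => ?_, by rw [hp]; omega⟩
      rw [Finset.card_eq_zero.1 (by omega : s.card = 0)]
      simp
  obtain ⟨K, hK, hKt⟩ := key
  refine hbad.not_rankable hτ 0 ?_ ?_
    (h.left (fun r => 1 - L r) 1 L K hlo (fun r => by omega) (fun r => le_rfl) h.one_le hK hKt)
  · intro r
    omega
  · intro r
    have := hR r
    omega

theorem IsCut.not_right (h : IsCut lo hi N t P a b f l)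
    (ht : 10 ≤ t ∨ 9 ≤ t ∧ P.card ≠ 4) (hbad : BadShape τ n L R)
    (hτ : t - P.card ≤ τ) (hR : Light R) (hhi : ∀ r, N + R r ≤ hi r)
    (hL : ∀ r, l r < N - n + 1 - L r) : False := by
  have hP := h.four_le
  have hP' := h.card_le
  have key : ∃ K, (∀ s : Finset (Fin 4), s.card ≤ 6 - P.card → ∑ r ∈ s, R r ≤ K) ∧
      (6 - P.card) * (6 - P.card + 1) / 2 + K ≤ t - P.card := by
    obtain hp | hp | hp : P.card = 4 ∨ P.card = 5 ∨ P.card = 6 := by omega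
    · exact ⟨3, by rw [hp]; exact hR.1, by rw [hp]; omega⟩
    · exact ⟨2, by rw [hp]; exact hR.2, by rw [hp]; omega⟩
    · refine ⟨0, fun s hs => ?_, by rw [hp]; omega⟩
      rw [Finset.card_eq_zero.1 (by omega : s.card = 0)]
      simp
  obtain ⟨K, hK, hKt⟩ := key
  refine hbad.not_rankable hτ (N - n) ?_ ?_
    (h.right (fun r => N + R r) N R K hhi (fun r => by omega) (fun r => le_rfl) h.le hK hKt)
  · intro r
    have := hL r
    omega
  · intro r
    omega

set_option synthInstance.maxSize 1000 in
set_option synthInstance.maxHeartbeats 400000 in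
/-- Five deleted cells in five consecutive columns, one in each column, such that no path crosses,
leave many cells on one side. -/
theorem five_cells_decide : ∀ h : Fin 5 → Fin 4, (∀ r, ∃ i, h i = r) →
    (∃ k, (∀ i, tapered k (h i) ≤ i.val) ∨ ∀ i, tapered k (h i) + i.val ≤ 4) ∨
    ∃ q : Fin 4, ∃ x y : Fin 5, x ≤ y ∧ (∀ z, x ≤ z → z ≤ y → h z ≠ q) ∧
      (∃ r : Fin 4, (r = q ∨ r.val + 1 = q.val ∨ q.val + 1 = r.val) ∧ ∀ i, h i = r → x < i) ∧
      ∃ s : Fin 4, (q = s ∨ q.val + 1 = s.val ∨ s.val + 1 = q.val) ∧ ∀ i, h i = s → i < y := by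
  decide +kernel

/-- There is exactly one cell in each of the five columns, so the finite check `five_cells_decide`
applies. It is what makes the tapered shapes necessary. -/
theorem IsCut.five (h : IsCut lo hi N t P a b f l) (hP : P.card = 5) (hab : b = a + 6) :
    ∃ k, (∀ r, a + 1 + tapered k r ≤ f r) ∨ ∀ r, l r + 1 + tapered k r ≤ b := by
  subst hab
  have hcol : ∀ i : Fin 5, ∃ r, (r, a + 1 + (i : ℤ)) ∈ P := fun i =>
    h.column _ (by omega) (by omega)
  choose g hg using hcol
  have himg : (Finset.univ.image fun i : Fin 5 => (g i, a + 1 + (i : ℤ))) = P := by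
    apply Finset.eq_of_subset_of_card_le
    · intro v hv
      obtain ⟨i, -, rfl⟩ := Finset.mem_image.1 hv
      exact hg i
    · rw [Finset.card_image_of_injective, hP]
      · rfl
      · intro i j hij
        have := (Prod.ext_iff.1 hij).2
        simp only at this
        exact Fin.ext (by omega)
  have hiff : ∀ r c, (r, c) ∈ P ↔ ∃ i : Fin 5, g i = r ∧ c = a + 1 + (i : ℤ) := by
    intro r c
    rw [← himg]
    simp only [Finset.mem_image, Finset.mem_univ, true_and, Prod.mk.injEq]
    exact ⟨fun ⟨i, h1, h2⟩ => ⟨i, h1, h2.symm⟩, fun ⟨i, h1, h2⟩ => ⟨i, h1, h2.symm⟩⟩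
  have hf : ∀ r, ∃ i : Fin 5, g i = r ∧ f r = a + 1 + (i : ℤ) := fun r => (hiff _ _).1 (h.f_mem r)
  have hl : ∀ r, ∃ i : Fin 5, g i = r ∧ l r = a + 1 + (i : ℤ) := fun r => (hiff _ _).1 (h.l_mem r)
  rcases five_cells_decide g (fun r => (hf r).imp fun i h => h.1) with
    ⟨k, h1 | h1⟩ | ⟨q, x, y, hxy, hz, ⟨r, hrq, hr⟩, s, hqs, hs⟩
  · refine ⟨k, Or.inl fun r => ?_⟩
    obtain ⟨i, rfl, hi⟩ := hf r
    have := h1 i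
    omega
  · refine ⟨k, Or.inr fun r => ?_⟩
    obtain ⟨i, rfl, hi⟩ := hl r
    have := h1 i
    omega
  · exfalso
    obtain ⟨i, hir, hi⟩ := hf r
    obtain ⟨j, hjs, hj⟩ := hl s
    have h1 : x.val < i.val := hr i hir
    have h2 : j.val < y.val := hs j hjs
    have h3 : x.val ≤ y.val := hxy
    refine h.no_path r q s (a + 1 + x) (a + 1 + y) hrq hqs (by omega) (by omega) (by omega)
      (by omega) (fun z hz1 hz2 hzP => ?_) (by omega)
    obtain ⟨k, hk, hkz⟩ := (hiff _ _).1 hzP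
    exact hz k (Fin.le_def.2 (by omega)) (Fin.le_def.2 (by omega)) hk

end Shape


/-! ### Small shapes read off from the obstruction lists -/

section Base

variable {lo hi : Fin 4 → ℤ} {N n : ℤ} {t τ : ℕ} {L R : Fin 4 → ℕ}

/-- Column 0 of the code becomes column `1 - s` of the strip, so `s` is the number of code columns
that lie to the left of the full columns. -/
theorem badShape_of_bits {m : ℕ} (h : m < 2 ^ 28 ∧ ¬ Rankable bitGraph (bits m) t) (n : ℤ)
    (L R : Fin 4 → ℕ) (s : ℕ)
    (hm : ∀ i < 28, m.testBit i = true → s ≤ i / 4 + L (Fin.ofNat 4 i) ∧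
      (i / 4 : ℕ) + 1 ≤ n + s + R (Fin.ofNat 4 i)) : BadShape t n L R := fun hr => by
  refine h.2 (hr.comap (fun i => (Fin.ofNat 4 i, (i / 4 : ℕ) + 1 - (s : ℤ))) ?_ ?_ ?_)
  · intro i _ j _ hij
    simp only [Prod.mk.injEq, Fin.ext_iff, Fin.val_ofNat] at hij
    omega
  · intro i _ j _ hij
    simp only [bitGraph, strip, Fin.ext_iff, Fin.val_ofNat] at hij ⊢
    omega
  · intro i hi
    have := hm i (lt_of_testBit h.1 hi) hi
    refine ⟨?_, ?_⟩ <;> simp only <;> omega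

theorem not_rankable_getElem {d : List (ℕ × List ℕ)} (h : AllObstructions t (d.map Prod.fst))
    {m : ℕ} (i : ℕ) (hi : (d.map Prod.fst)[i]? = some m) :
    m < 2 ^ 28 ∧ ¬ Rankable bitGraph (bits m) t :=
  h m (List.mem_of_getElem? hi)

/-- The rows outside `i`, one cell each. -/
def threeRows (i : Fin 4) : Fin 4 → ℕ := fun r => if r = i then 0 else 1

theorem tapered_rev (k : Fin 2) : (fun r : Fin 4 => tapered k r.rev) = tapered k.rev := by
  revert k; decide

theorem paired_rev (k : Fin 3) : (fun r : Fin 4 => paired k r.rev) = paired k.rev := by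
  revert k; decide

theorem threeRows_rev (k : Fin 4) : (fun r : Fin 4 => threeRows k r.rev) = threeRows k.rev := by
  revert k; decide

theorem badShape_three_middle : BadShape 3 1 0 ![0, 1, 1, 0] :=
  badShape_of_bits (not_rankable_getElem allObstructions_three (m := 111) 3 rfl) _ _ _ 0
    (by decide)

theorem badShape_three_deep₀ : BadShape 3 1 0 ![2, 2, 0, 1] :=
  badShape_of_bits (not_rankable_getElem allObstructions_three (m := 959) 0 rfl) _ _ _ 0
    (by decide)

theorem badShape_three_deep₁ : BadShape 3 1 0 ![2, 1, 0, 2] :=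
  badShape_of_bits (not_rankable_getElem allObstructions_three (m := 2495) 1 rfl) _ _ _ 0
    (by decide)

theorem badShape_three_deep₂ : BadShape 3 1 0 ![2, 0, 2, 1] :=
  badShape_of_bits (not_rankable_getElem allObstructions_three (m := 1503) 2 rfl) _ _ _ 0
    (by decide)

theorem badShape_four_paired₀ : BadShape 4 2 0 (paired 0) :=
  badShape_of_bits (not_rankable_getElem allObstructions_four (m := 1023) 0 rfl) _ _ _ 0
    (by decide)

theorem badShape_four_paired₁ : BadShape 4 2 0 (paired 1) :=
  badShape_of_bits (not_rankable_getElem allObstructions_four (m := 1791) 1 rfl) _ _ _ 0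
    (by decide)

theorem badShape_four_paired (k : Fin 3) : BadShape 4 2 0 (paired k) := by
  fin_cases k
  · exact badShape_four_paired₀
  · exact badShape_four_paired₁
  · have := badShape_four_paired₀.flip
    rwa [paired_rev] at this

theorem badShape_four_threeRows₃ : BadShape 4 1 (threeRows 3) (tapered 1) :=
  badShape_of_bits (not_rankable_getElem allObstructions_four (m := 6135) 2 rfl) _ _ _ 1
    (by decide)

theorem badShape_four_threeRows₀ : BadShape 4 1 (threeRows 0) (tapered 1) :=
  badShape_of_bits (not_rankable_getElem allObstructions_four (m := 6142) 3 rfl) _ _ _ 1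
    (by decide)

theorem badShape_four_threeRows₂ : BadShape 4 1 (threeRows 2) (tapered 1) :=
  badShape_of_bits (not_rankable_getElem allObstructions_four (m := 6139) 4 rfl) _ _ _ 1
    (by decide)

theorem badShape_four_threeRows₁ : BadShape 4 1 (threeRows 1) (tapered 1) :=
  badShape_of_bits (not_rankable_getElem allObstructions_four (m := 6141) 5 rfl) _ _ _ 1
    (by decide)

theorem badShape_four_threeRows (i : Fin 4) (k : Fin 2) :
    BadShape 4 1 (threeRows i) (tapered k) := by
  have h : ∀ i, BadShape 4 1 (threeRows i) (tapered 1) := by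
    intro i
    fin_cases i
    · exact badShape_four_threeRows₀
    · exact badShape_four_threeRows₁
    · exact badShape_four_threeRows₂
    · exact badShape_four_threeRows₃
  fin_cases k
  · have := (h i.rev).flip
    rwa [tapered_rev, threeRows_rev, Fin.rev_rev] at this
  · exact h i

theorem badShape_five_rect : BadShape 5 3 0 0 :=
  badShape_of_bits (not_rankable_getElem allObstructions_five (m := 4095) 0 rfl) _ _ _ 0
    (by decide)

theorem badShape_five_tapered₁ : BadShape 5 2 0 (tapered 1) :=
  badShape_of_bits (not_rankable_getElem allObstructions_five (m := 6143) 1 rfl) _ _ _ 0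
    (by decide)

theorem badShape_five_tapered (k : Fin 2) : BadShape 5 2 0 (tapered k) := by
  fin_cases k
  · have := badShape_five_tapered₁.flip
    rwa [tapered_rev] at this
  · exact badShape_five_tapered₁

theorem badShape_six_rect : BadShape 6 4 0 0 :=
  badShape_of_bits (not_rankable_getElem allObstructions_six (m := 65535) 0 rfl) _ _ _ 0
    (by decide)

theorem badShape_six_paired₁ : BadShape 6 3 (paired 1) (tapered 1) :=
  badShape_of_bits (not_rankable_getElem allObstructions_six (m := 1572854) 1 rfl) _ _ _ 1
    (by decide)

theorem badShape_six_paired₀ : BadShape 6 3 (paired 0) (tapered 1) :=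
  badShape_of_bits (not_rankable_getElem allObstructions_six (m := 1572851) 2 rfl) _ _ _ 1
    (by decide)

theorem badShape_six_paired₂ : BadShape 6 3 (paired 2) (tapered 1) :=
  badShape_of_bits (not_rankable_getElem allObstructions_six (m := 1572860) 3 rfl) _ _ _ 1
    (by decide)

theorem badShape_six (i : Fin 3) (k : Fin 2) : BadShape 6 3 (tapered k) (paired i) := by
  have h : ∀ i, BadShape 6 3 (paired i) (tapered 1) := by
    intro i
    fin_cases i
    · exact badShape_six_paired₀
    · exact badShape_six_paired₁
    · exact badShape_six_paired₂
  apply BadShape.mirror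
  fin_cases k
  · have := (h i.rev).flip
    rwa [tapered_rev, paired_rev, Fin.rev_rev] at this
  · exact h i

theorem badShape_seven_rect : BadShape 7 5 0 0 :=
  badShape_of_bits (not_rankable_getElem allObstructions_seven (m := 1048575) 0 rfl) _ _ _ 0
    (by decide)

theorem badShape_seven_corner : BadShape 7 4 ![0, 1, 1, 0] ![2, 1, 0, 0] :=
  badShape_of_bits (not_rankable_getElem allObstructions_seven (m := 20971510) 1 rfl) _ _ _ 1
    (by decide)

theorem badShape_eight : BadShape 8 5 ![0, 1, 1, 0] ![0, 1, 1, 0] :=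
  badShape_of_bits (not_rankable_getElem allObstructions_eight (m := 117440502) 0 rfl) _ _ _ 1
    (by decide)

end Base


/-! ### Doubling the shapes without rankings -/

section Step

variable {lo hi : Fin 4 → ℤ} {N v : ℤ} {t τ : ℕ} {P : Finset (Fin 4 × ℤ)} {a b : ℤ}
  {f l : Fin 4 → ℤ}

/-- One further cell in the two middle rows. -/
abbrev middle : Fin 4 → ℕ := ![0, 1, 1, 0]

theorem light_zero : Light 0 := by decide

theorem light_middle : Light middle := by decide

theorem light_paired (i : Fin 3) : Light (paired i) := by revert i; decide

theorem light_tapered (i : Fin 2) : Light (tapered i) := by revert i; decide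

/-- Some row has its cell at most at `v + middle r`, and some row at least at `v + 4 - middle r`.
The jump needed is 4 between outer rows, 3 between an outer and an inner row, and 2 between inner
rows, always more than one column per row step. -/
theorem IsCut.four_not_middle (h : IsCut lo hi N t P a b f l) (hP : P.card = 4) (ht : 10 ≤ t)
    (hN : N = 2 * v + 3) (hlo : ∀ r, lo r ≤ 1 - middle r) (hhi : ∀ r, N + middle r ≤ hi r)
    (hbad : BadShape (t - 4) v middle middle) : False := by
  obtain ⟨hl, -, -, hadj, -⟩ := h.four hP
  have h1 : ¬ ∀ r, v + middle r < f r := fun h' =>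
    h.not_left (Or.inl ht) hbad (by omega) light_middle hlo h'
  have h2 : ¬ ∀ r, f r < N - v + 1 - middle r := fun h' =>
    h.not_right (Or.inl ht) hbad (by omega) light_middle hhi fun r => by rw [hl]; exact h' r
  rw [forall_fin_four] at h1 h2
  simp [middle] at h1 h2
  omega

/-- Some cell is at `v + 1` or before and some cell at `v + 4` or after, so the cut is the full
diagonal from `v + 1` to `v + 4`. Its left side then contains one of the two tapered shapes. -/
theorem IsCut.four_not_tapered (h : IsCut lo hi N t P a b f l) (hP : P.card = 4) (ht : 10 ≤ t)
    (hlo : ∀ r, lo r ≤ 1) {e : Fin 4 → ℕ} (he : Light e) (hhi : ∀ r, N + e r ≤ hi r)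
    (hN : N = 2 * v + 4 ∧ e = 0 ∨ N = 2 * v + 3 ∧ ∃ k, e = tapered k)
    (hbad : ∀ k, BadShape (t - 4) v 0 (tapered k)) (hbad' : BadShape (t - 4) (v + 1) 0 0) :
    False := by
  obtain ⟨hl, -, -, hadj, -⟩ := h.four hP
  have h1 : ∀ k, ¬ ∀ r, v + tapered k r < f r := fun k h' =>
    h.not_left (Or.inl ht) (hbad k) (by omega) light_zero (by simpa using hlo) h'
  have h2 : ¬ ∀ r, v + 1 < f r := fun h' =>
    h.not_left (Or.inl ht) hbad' (by omega) light_zero (by simpa using hlo) (by simpa using h')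
  have h3 : ¬ ∀ r, f r < v + 4 := by
    intro h'
    rcases hN with ⟨rfl, rfl⟩ | ⟨rfl, k, rfl⟩
    · refine h.not_right (Or.inl ht) hbad' (by omega) he hhi fun r => ?_
      have := h' r
      rw [hl]
      simp only [Pi.zero_apply]
      omega
    · refine h.not_right (Or.inl ht) (hbad k) (by omega) he hhi fun r => ?_
      have := h' r
      rw [hl]
      simp only [Pi.zero_apply]
      omega
  have h10 := h1 0
  have h11 := h1 1
  rw [forall_fin_four] at h10 h11 h2 h3
  simp [tapered] at h10 h11
  omega

/-- Each shape that must not fit on a side bounds the position of the cut in some row. These bounds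
are incompatible with a change of at most one column between neighbouring rows. -/
theorem IsCut.four_not_paired (h : IsCut lo hi N t P a b f l) (hP : P.card = 4) (ht : 10 ≤ t)
    {e e' : Fin 4 → ℕ} (hlo : ∀ r, lo r ≤ 1 - e r) (hhi : ∀ r, N + e' r ≤ hi r)
    (hN : (N = 2 * v + 4 ∧ e = 0 ∧ ∃ i, e' = paired i) ∨
      N = 2 * v + 3 ∧ (∃ k, e = tapered k) ∧ ∃ i, e' = paired i)
    (hbad : ∀ k i, BadShape (t - 4) v (tapered k) (paired i))
    (hbad' : ∀ i, BadShape (t - 4) (v + 1) 0 (paired i)) : False := by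
  obtain ⟨hl, -, -, hadj, -⟩ := h.four hP
  rcases hN with ⟨rfl, rfl, i, rfl⟩ | ⟨rfl, ⟨k, rfl⟩, i, rfl⟩
  · have h1 : ∀ i, ¬ ∀ r, v + 1 + paired i r < f r := fun i h' =>
      h.not_left (Or.inl ht) (hbad' i) (by omega) light_zero hlo h'
    have h2 : ¬ ∀ r, f r < v + 4 := fun h' =>
      h.not_right (Or.inl ht) (hbad' i) (by omega) (light_paired i) hhi fun r => by
        have := h' r
        rw [hl]
        simp only [Pi.zero_apply]
        omega
    have h3 : ∀ k, ¬ ∀ r, f r < v + 5 - tapered k r := fun k h' =>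
      h.not_right (Or.inl ht) (hbad k i) (by omega) (light_paired i) hhi fun r => by
        have := h' r
        rw [hl]
        omega
    have h10 := h1 0
    have h11 := h1 1
    have h12 := h1 2
    have h30 := h3 0
    have h31 := h3 1
    rw [forall_fin_four] at h10 h11 h12 h2 h30 h31
    simp [paired, tapered] at h10 h11 h12 h30 h31
    omega
  -- The tapered left end contains a pair, so one full column more together with this pair is also
  -- excluded on the left.
  · have hsub : ∀ k : Fin 2, ∃ j, ∀ r, paired j r ≤ tapered k r := by decide
    obtain ⟨j, hj⟩ := hsub k
    have h1 : ¬ ∀ r, v + 1 < f r := fun h' =>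
      h.not_left (Or.inl ht) (hbad' j).mirror (by omega) (light_paired j) (fun r => by
        have := hlo r
        have := hj r
        omega) (by simpa using h')
    have h2 : ¬ ∀ r, f r < v + 3 := fun h' =>
      h.not_right (Or.inl ht) (hbad' i) (by omega) (light_paired i) hhi fun r => by
        have := h' r
        rw [hl]
        simp only [Pi.zero_apply]
        omega
    have h3 : ∀ i, ¬ ∀ r, v + paired i r < f r := fun i h' =>
      h.not_left (Or.inl ht) (hbad k i) (by omega) (light_tapered k) hlo h'
    have h4 : ∀ k, ¬ ∀ r, f r < v + 4 - tapered k r := fun k h' =>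
      h.not_right (Or.inl ht) (hbad k i) (by omega) (light_paired i) hhi fun r => by
        have := h' r
        rw [hl]
        omega
    have h30 := h3 0
    have h31 := h3 1
    have h32 := h3 2
    have h40 := h4 0
    have h41 := h4 1
    rw [forall_fin_four] at h1 h2 h30 h31 h32 h40 h41
    simp [paired, tapered] at h30 h31 h32 h40 h41
    omega

theorem IsCut.left_lt (h : IsCut lo hi N t P a b f l) (ht : 10 ≤ t) (hlo : ∀ r, lo r ≤ 1) {n : ℤ}
    (hbad : BadShape τ n 0 0) (hτ : t - P.card ≤ τ) : a < n := by
  by_contra! hn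
  refine h.not_left (Or.inl ht) hbad hτ light_zero (by simpa using hlo) fun r => ?_
  have := h.bounds r
  simp only [Pi.zero_apply]
  omega

theorem IsCut.right_lt (h : IsCut lo hi N t P a b f l) (ht : 10 ≤ t) (hhi : ∀ r, N ≤ hi r) {n : ℤ}
    (hbad : BadShape τ n 0 0) (hτ : t - P.card ≤ τ) : N - b + 1 < n := by
  by_contra! hn
  refine h.not_right (Or.inl ht) hbad hτ light_zero (by simpa using hhi) fun r => ?_
  have := h.bounds r
  simp only [Pi.zero_apply]
  omega

/-- The two halves may use only the parts `e`, `e'` of the extra cells, which keeps the count `K` of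
cells cut off small. -/
theorem badShape_of_cut {n : ℤ} {L R : Fin 4 → ℕ} (hn : 7 ≤ n) (ht : 7 ≤ t) {μ : ℤ} (hμ : 4 ≤ μ)
    (hμn : μ + 4 ≤ n) (e e' : Fin 4 → ℕ) (he : ∀ r, e r ≤ L r) (he' : ∀ r, e' r ≤ R r) {K : ℕ}
    (hK : ∀ s : Finset (Fin 4), s.card ≤ 3 → ∑ r ∈ s, e r ≤ K)
    (hK' : ∀ s : Finset (Fin 4), s.card ≤ 3 → ∑ r ∈ s, e' r ≤ K) (hKt : 6 + K ≤ t - 4)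
    (hL : BadShape (t - 4) μ e 0) (hR : BadShape (t - 4) (n - μ) 0 e')
    (hcut : ∀ P a b f l, IsCut (fun r => 1 - L r) (fun r => n + R r) n t P a b f l → False) :
    BadShape t n L R := fun hX => by
  have hL' := hL.not_rankable (lo := fun r => 1 - e r) (hi := fun _ => μ) le_rfl 0
    (fun r => by omega) (fun r => by simp)
  have hR' := hR.not_rankable (lo := fun _ => μ + 1) (hi := fun r => n + e' r) le_rfl μ
    (fun r => by simp) (fun r => by omega)
  obtain ⟨P, a, b, f, l, h⟩ := exists_isCut hX (fun r => by omega) (fun r => by omega) hn ht hμ hμn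
    (e := e) (e' := e') (fun r => by have := he r; omega) (fun r => by have := he' r; omega) hK hK'
    hKt hL' hR'
  exact hcut P a b f l h

theorem IsCut.card_cases (h : IsCut lo hi N t P a b f l) :
    P.card = 4 ∨ P.card = 5 ∨ P.card = 6 := by
  have := h.four_le
  have := h.card_le
  omega

/-- The shapes without rankings that double in width when four labels are added. -/
structure LowerBlock (s : ℕ) (m : ℤ) : Prop where
  -- A subscript is the number of labels beyond `s`. For the shapes extended by a cut argument, with
  -- subscript `i` and `s + 4 + i` labels, cuts of 4, 5 and 6 cells lead to subscripts `i`, `i - 1`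
  -- and `i - 2`; this determines which auxiliary shapes are carried along.
  rect₀ : BadShape s (4 * m - 4) 0 0
  rect₁ : BadShape (s + 1) (4 * m - 3) 0 0
  taper₁ : ∀ k, BadShape (s + 1) (4 * m - 4) middle (tapered k)
  bump₂ : BadShape (s + 2) (4 * m - 3) middle middle
  rect₃ : BadShape (s + 3) (5 * m - 2) 0 0
  taper₃ : ∀ k, BadShape (s + 3) (5 * m - 3) 0 (tapered k)
  pair₄ : ∀ i, BadShape (s + 4) (6 * m - 2) 0 (paired i)
  taper₄ : ∀ k i, BadShape (s + 4) (6 * m - 3) (tapered k) (paired i)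
  bump₅ : BadShape (s + 5) (7 * m - 3) middle middle

variable {s : ℕ} {m : ℤ}

theorem middle_le (r : Fin 4) : middle r ≤ 1 := by revert r; decide

theorem paired_le (i : Fin 3) (r : Fin 4) : paired i r ≤ 1 := by revert i r; decide

theorem LowerBlock.rect₂ (h : LowerBlock s m) : BadShape (s + 2) (4 * m - 1) 0 0 :=
  h.bump₂.mono le_rfl 1 (fun r => by have := middle_le r; simp only [Pi.zero_apply]; omega)
    (fun r => by have := middle_le r; simp only [Pi.zero_apply]; omega)

theorem LowerBlock.rect₄ (h : LowerBlock s m) : BadShape (s + 4) (6 * m - 1) 0 0 :=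
  (h.pair₄ 0).mono le_rfl 0 (fun r => by simp)
    (fun r => by have := paired_le 0 r; simp only [Pi.zero_apply]; omega)

theorem LowerBlock.rect₅ (h : LowerBlock s m) : BadShape (s + 5) (7 * m - 1) 0 0 :=
  h.bump₅.mono le_rfl 1 (fun r => by have := middle_le r; simp only [Pi.zero_apply]; omega)
    (fun r => by have := middle_le r; simp only [Pi.zero_apply]; omega)

theorem sum_middle_le : ∀ s : Finset (Fin 4), s.card ≤ 3 → ∑ r ∈ s, middle r ≤ 2 := by decide

theorem sum_paired_le (i : Fin 3) :
    ∀ s : Finset (Fin 4), s.card ≤ 3 → ∑ r ∈ s, paired i r ≤ 2 := by revert i; decide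

theorem sum_zero_le (K : ℕ) :
    ∀ s : Finset (Fin 4), s.card ≤ 3 → ∑ r ∈ s, (0 : Fin 4 → ℕ) r ≤ K := by simp

/-- This is the tightest step: six cells are too narrow by one column, and five cells fit only with
one cell per column. -/
theorem LowerBlock.bump₂_step (h : LowerBlock s m) (hs : 6 ≤ s) (hm : 2 ≤ m) :
    BadShape (s + 4 + 2) (4 * (2 * m) - 3) middle middle := by
  refine badShape_of_cut (by omega) (by omega) (μ := 4 * m - 2) (by omega) (by omega) middle middle
    (fun _ => le_rfl) (fun _ => le_rfl) sum_middle_le sum_middle_le (by omega) ?_ ?_ ?_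
  · exact h.bump₂.mono (by omega) 0 (fun r => by omega)
      (fun r => by have := middle_le r; simp only [Pi.zero_apply]; omega)
  · exact h.bump₂.mono (by omega) 1 (fun r => by have := middle_le r; omega) (fun r => by omega)
  intro P a b f l hc
  have hlo : ∀ r, 1 - (middle r : ℤ) ≤ 1 := fun r => by omega
  have hhi : ∀ r, 4 * (2 * m) - 3 ≤ 4 * (2 * m) - 3 + (middle r : ℤ) := fun r => by omega
  have hw := hc.width_le
  rcases hc.card_cases with hP | hP | hP
  · exact hc.four_not_middle hP (by omega) (v := 4 * m - 3) (by omega) (fun _ => le_rfl)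
      (fun _ => le_rfl) h.bump₂
  · have h1 := hc.left_lt (by omega) hlo h.rect₁ (by omega)
    have h2 := hc.right_lt (by omega) hhi h.rect₁ (by omega)
    -- The rectangles force `b = a + 6` with exactly `4 * m - 4` columns left on either side.
    obtain ⟨k, hk | hk⟩ := hc.five hP (by omega)
    · refine hc.not_left (by omega) (h.taper₁ k) (by omega) light_middle (fun _ => le_rfl) fun r => ?_
      have := hk r
      omega
    · refine hc.not_right (by omega) (h.taper₁ k).mirror (by omega) light_middle (fun _ => le_rfl)
        fun r => ?_
      have := hk r
      omega
  · have h1 := hc.left_lt (by omega) hlo h.rect₀ (by omega)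
    have h2 := hc.right_lt (by omega) hhi h.rect₀ (by omega)
    omega

theorem LowerBlock.three_step (h : LowerBlock s m) (hs : 6 ≤ s) (hm : 2 ≤ m) {n : ℤ}
    {e : Fin 4 → ℕ} (he : Light e)
    (hn : n = 2 * (5 * m - 3) + 4 ∧ e = 0 ∨ n = 2 * (5 * m - 3) + 3 ∧ ∃ k, e = tapered k) :
    BadShape (s + 4 + 3) n 0 e := by
  have hn' : n = 10 * m - 2 ∨ n = 10 * m - 3 := by omega
  refine badShape_of_cut (by omega) (by omega) (μ := 5 * m - 2) (by omega) (by omega) 0 0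
    (fun _ => le_rfl) (fun _ => by simp) (sum_zero_le 0) (sum_zero_le 0) (by omega) h.rect₃ ?_ ?_
  · exact h.rect₃.mono (by omega) 0 (fun r => by simp)
      (fun r => by simp only [Pi.zero_apply]; omega)
  intro P a b f l hc
  have hlo : ∀ r, 1 - ((0 : Fin 4 → ℕ) r : ℤ) ≤ 1 := fun r => by simp
  have hhi : ∀ r, n ≤ n + (e r : ℤ) := fun r => by omega
  have hw := hc.width_le
  rcases hc.card_cases with hP | hP | hP
  · refine hc.four_not_tapered hP (by omega) hlo he (fun _ => le_rfl) hn h.taper₃ ?_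
    rw [show 5 * m - 3 + 1 = 5 * m - 2 by ring]
    exact h.rect₃
  · have h1 := hc.left_lt (by omega) hlo h.rect₂ (by omega)
    have h2 := hc.right_lt (by omega) hhi h.rect₂ (by omega)
    -- For `m = 2` the rectangular bounds still allow a cut of five columns. The middle cells of the
    -- tapered end gain the missing column.
    have h3 : n = 10 * m - 3 → n - b + 1 < 4 * m - 2 := by
      intro hn3
      obtain ⟨k, rfl⟩ := (hn.resolve_left (by omega)).2
      have hmid : ∀ k : Fin 2, ∀ r, middle r ≤ tapered k r := by decide
      by_contra! hlt
      refine hc.not_right (by omega) h.bump₂ (by omega) light_middle (fun r => ?_) fun r => ?_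
      · have := hmid k r
        omega
      · have := middle_le r
        have := hc.bounds r
        omega
    omega
  · have h1 := hc.left_lt (by omega) hlo h.rect₁ (by omega)
    have h2 := hc.right_lt (by omega) hhi h.rect₁ (by omega)
    omega

theorem LowerBlock.four_step (h : LowerBlock s m) (hs : 6 ≤ s) (hm : 2 ≤ m) {n : ℤ}
    {e e' : Fin 4 → ℕ}
    (hn : (n = 2 * (6 * m - 3) + 4 ∧ e = 0 ∧ ∃ i, e' = paired i) ∨
      n = 2 * (6 * m - 3) + 3 ∧ (∃ k, e = tapered k) ∧ ∃ i, e' = paired i) :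
    BadShape (s + 4 + 4) n e e' := by
  have hn' : n = 12 * m - 2 ∨ n = 12 * m - 3 := by omega
  -- In the narrower case the left half has one column less, and a pair inside the tapered end makes
  -- up for it. Using only the pair keeps the sum over three rows at 2.
  have hwin : ∃ d : Fin 4 → ℕ, (∀ r, d r ≤ e r) ∧
      (∀ s : Finset (Fin 4), s.card ≤ 3 → ∑ r ∈ s, d r ≤ 2) ∧
      BadShape (s + 4 + 4 - 4) (6 * m - 1 - if n = 12 * m - 3 then 1 else 0) d 0 := by
    rcases hn with ⟨rfl, rfl, -⟩ | ⟨rfl, ⟨k, rfl⟩, -⟩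
    · refine ⟨0, fun _ => le_rfl, sum_zero_le 2, ?_⟩
      rw [if_neg (by omega)]
      exact h.rect₄.mono (by omega) 0 (fun r => by simp) (fun r => by simp)
    · have hsub : ∀ k : Fin 2, ∃ j, ∀ r, paired j r ≤ tapered k r := by decide
      obtain ⟨j, hj⟩ := hsub k
      refine ⟨paired j, hj, sum_paired_le j, ?_⟩
      rw [if_pos (by omega)]
      exact (h.pair₄ j).mirror.mono (by omega) 0 (fun r => by simp)
        (fun r => by simp only [Pi.zero_apply]; omega)
  obtain ⟨d, hde, hd, hdbad⟩ := hwin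
  refine badShape_of_cut (by omega) (by omega) (by split_ifs <;> omega) (by split_ifs <;> omega) d 0
    hde (fun _ => by simp) hd (sum_zero_le 2) (by omega) hdbad ?_ ?_
  · refine h.rect₄.mono (by omega) 0 (fun r => by simp) (fun r => ?_)
    simp only [Pi.zero_apply]
    split_ifs <;> omega
  intro P a b f l hc
  have hlo : ∀ r, 1 - (e r : ℤ) ≤ 1 := fun r => by omega
  have hhi : ∀ r, n ≤ n + (e' r : ℤ) := fun r => by omega
  have hw := hc.width_le
  rcases hc.card_cases with hP | hP | hP
  · refine hc.four_not_paired hP (by omega) (fun _ => le_rfl) (fun _ => le_rfl) hn h.taper₄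
      fun i => ?_
    rw [show 6 * m - 3 + 1 = 6 * m - 2 by ring]
    exact h.pair₄ i
  · have h1 := hc.left_lt (by omega) hlo h.rect₃ (by omega)
    have h2 := hc.right_lt (by omega) hhi h.rect₃ (by omega)
    omega
  · have h1 := hc.left_lt (by omega) hlo h.rect₂ (by omega)
    have h2 := hc.right_lt (by omega) hhi h.rect₂ (by omega)
    omega

theorem LowerBlock.bump₅_step (h : LowerBlock s m) (hs : 6 ≤ s) (hm : 2 ≤ m) :
    BadShape (s + 4 + 5) (7 * (2 * m) - 3) middle middle := by
  refine badShape_of_cut (by omega) (by omega) (μ := 7 * m - 2) (by omega) (by omega) middle middle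
    (fun _ => le_rfl) (fun _ => le_rfl) sum_middle_le sum_middle_le (by omega) ?_ ?_ ?_
  · exact h.bump₅.mono (by omega) 0 (fun r => by omega)
      (fun r => by have := middle_le r; simp only [Pi.zero_apply]; omega)
  · exact h.bump₅.mono (by omega) 1 (fun r => by have := middle_le r; omega) (fun r => by omega)
  intro P a b f l hc
  have hlo : ∀ r, 1 - (middle r : ℤ) ≤ 1 := fun r => by omega
  have hhi : ∀ r, 7 * (2 * m) - 3 ≤ 7 * (2 * m) - 3 + (middle r : ℤ) := fun r => by omega
  have hw := hc.width_le
  rcases hc.card_cases with hP | hP | hP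
  · exact hc.four_not_middle hP (by omega) (v := 7 * m - 3) (by omega) (fun _ => le_rfl)
      (fun _ => le_rfl) h.bump₅
  · have h1 : a < 6 * m - 2 := by
      by_contra! hlt
      -- `paired 1` is the same shape as `middle`.
      refine hc.not_left (by omega) (h.pair₄ 1).mirror (by omega) light_middle (fun _ => le_rfl)
        fun r => ?_
      have := hc.bounds r
      simp only [Pi.zero_apply]
      omega
    have h2 : 7 * (2 * m) - 3 - b + 1 < 6 * m - 2 := by
      by_contra! hlt
      refine hc.not_right (by omega) (h.pair₄ 1) (by omega) light_middle (fun _ => le_rfl)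
        fun r => ?_
      have := hc.bounds r
      simp only [Pi.zero_apply]
      omega
    omega
  · have h1 := hc.left_lt (by omega) hlo h.rect₃ (by omega)
    have h2 := hc.right_lt (by omega) hhi h.rect₃ (by omega)
    omega

theorem LowerBlock.step (h : LowerBlock s m) (hs : 6 ≤ s) (hm : 2 ≤ m) :
    LowerBlock (s + 4) (2 * m) where
  -- For `m ≥ 2` the first three shapes contain old ones: `6m-1 ≤ 8m-4`, `7m-1 ≤ 8m-3` and `7m-3 ≤
  -- 8m-4`.
  rect₀ := h.rect₄.mono (by omega) 0 (fun r => by simp)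
    (fun r => by simp only [Pi.zero_apply]; omega)
  rect₁ := h.rect₅.mono (by omega) 0 (fun r => by simp)
    (fun r => by simp only [Pi.zero_apply]; omega)
  taper₁ k := by
    have hmid : ∀ k : Fin 2, ∀ r, middle r ≤ tapered k r := by decide
    exact h.bump₅.mono (by omega) 0 (fun r => by simp) (fun r => by have := hmid k r; omega)
  bump₂ := h.bump₂_step hs hm
  rect₃ := h.three_step hs hm light_zero (Or.inl ⟨by ring, rfl⟩)
  taper₃ k := h.three_step hs hm (light_tapered k) (Or.inr ⟨by ring, k, rfl⟩)
  pair₄ i := h.four_step hs hm (Or.inl ⟨by ring, rfl, i, rfl⟩)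
  taper₄ k i := h.four_step hs hm (Or.inr ⟨by ring, ⟨k, rfl⟩, i, rfl⟩)
  bump₅ := h.bump₅_step hs hm

theorem lowerBlock_of_base (h : LowerBlock 6 2) (j : ℕ) : LowerBlock (6 + 4 * j) (2 * 2 ^ j) := by
  induction j with
  | zero => simpa using h
  | succ j ih =>
    have h2 : (1 : ℤ) ≤ 2 ^ j := one_le_pow₀ (by norm_num)
    have := ih.step (by omega) (by omega)
    rw [pow_succ, show (2 : ℤ) * (2 ^ j * 2) = 2 * (2 * 2 ^ j) by ring]
    exact this

theorem badShape_ten {n : ℤ} {e e' : Fin 4 → ℕ}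
    (hn : (n = 2 * 3 + 4 ∧ e = 0 ∧ ∃ i, e' = paired i) ∨
      n = 2 * 3 + 3 ∧ (∃ k, e = tapered k) ∧ ∃ i, e' = paired i) : BadShape 10 n e e' := by
  have hn' : n = 10 ∨ n = 9 := by omega
  have h6 : BadShape 6 4 0 0 := badShape_six_rect
  refine badShape_of_cut (by omega) (by omega) (μ := 4) (by omega) (by omega) 0 0
    (fun _ => by simp) (fun _ => by simp) (sum_zero_le 0) (sum_zero_le 0) (by omega) h6 ?_ ?_
  · exact h6.mono (by omega) 0 (fun r => by simp) (fun r => by simp only [Pi.zero_apply]; omega)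
  intro P a b f l hc
  have hlo : ∀ r, 1 - (e r : ℤ) ≤ 1 := fun r => by omega
  have hhi : ∀ r, n ≤ n + (e' r : ℤ) := fun r => by omega
  have hw := hc.width_le
  rcases hc.card_cases with hP | hP | hP
  · refine hc.four_not_paired hP (by omega) (fun _ => le_rfl) (fun _ => le_rfl) hn
      (fun k i => badShape_six i k) fun i => ?_
    exact h6.mono le_rfl 0 (fun r => by simp) (fun r => by simp)
  · have h1 := hc.left_lt (by omega) hlo badShape_five_rect (by omega)
    have h2 := hc.right_lt (by omega) hhi badShape_five_rect (by omega)
    -- Five cells fit only for nine columns, with `a = 2`; two columns with the tapered end are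
    -- already excluded for five labels.
    obtain ⟨rfl, ⟨k, rfl⟩, -⟩ := hn.resolve_left (by omega)
    refine hc.not_left (by omega) (badShape_five_tapered k).mirror (by omega) (light_tapered k)
      (fun _ => le_rfl) fun r => ?_
    have := hc.bounds r
    simp only [Pi.zero_apply]
    omega
  · have h1 := hc.left_lt (by omega) hlo (badShape_five_rect.mono (t := 4) (by omega) 0
      (fun _ => by simp) (fun _ => le_rfl)) (by omega)
    have h2 : n - b + 1 < 2 := by
      obtain ⟨i, rfl⟩ : ∃ i, e' = paired i := by
        rcases hn with h | h
        exacts [h.2.2, h.2.2]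
      by_contra! hlt
      refine hc.not_right (by omega) (badShape_four_paired i) (by omega) (light_paired i)
        (fun _ => le_rfl) fun r => ?_
      have := hc.bounds r
      simp only [Pi.zero_apply]
      omega
    obtain ⟨rfl, ⟨k, rfl⟩, -⟩ := hn.resolve_left (by omega)
    have hsub : ∀ k : Fin 2, ∃ j, ∀ r, paired j r ≤ tapered k r := by decide
    obtain ⟨j, hj⟩ := hsub k
    refine hc.not_left (by omega) (badShape_four_paired j).mirror (by omega) (light_paired j)
      (fun r => by have := hj r; omega) fun r => ?_
    have := hc.bounds r
    simp only [Pi.zero_apply]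
    omega

theorem badShape_eleven : BadShape 11 11 middle middle := by
  have h7 := badShape_seven_rect
  refine badShape_of_cut (by omega) (by omega) (μ := 5) (by omega) (by omega) 0 0
    (fun _ => by simp) (fun _ => by simp) (sum_zero_le 1) (sum_zero_le 1) (by omega) h7 ?_ ?_
  · exact h7.mono (by omega) 0 (fun r => by simp) (fun r => by simp)
  intro P a b f l hc
  have hw := hc.width_le
  have hlo : ∀ r, 1 - (middle r : ℤ) ≤ 1 := fun r => by omega
  have hhi : ∀ r, 11 ≤ 11 + (middle r : ℤ) := fun r => by omega
  rcases hc.card_cases with hP | hP | hP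
  · obtain ⟨hl, -, -, hadj, -⟩ := hc.four hP
    have hcorner : BadShape 7 4 middle ![0, 0, 1, 2] := by
      convert badShape_seven_corner.flip using 1
      · decide
      · decide
    -- The outer end always keeps its middle cells, and the corner faces the cut. Its two
    -- orientations on both sides, together with the rectangle of width 5, exclude every profile.
    have h1 := fun h' => hc.not_left (by omega) badShape_seven_corner (by omega) light_middle
      (fun _ => le_rfl) h'
    have h2 := fun h' => hc.not_left (by omega) hcorner (by omega) light_middle
      (fun _ => le_rfl) h'
    have h3 := fun h' => hc.not_right (by omega) badShape_seven_corner.mirror (by omega)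
      light_middle (fun _ => le_rfl) h'
    have h4 := fun h' => hc.not_right (by omega) hcorner.mirror (by omega)
      light_middle (fun _ => le_rfl) h'
    have h5 := fun h' => hc.not_left (by omega) h7 (by omega) light_zero (by simp) h'
    have h6 := fun h' => hc.not_right (by omega) h7 (by omega) light_zero (by simp) h'
    rw [imp_false, forall_fin_four] at h1 h2 h3 h4 h5 h6
    simp [hl] at h1 h2 h3 h4 h5 h6
    omega
  · have h1 := hc.left_lt (by omega) hlo badShape_six_rect (by omega)
    have h2 := hc.right_lt (by omega) hhi badShape_six_rect (by omega)
    obtain ⟨k, hk | hk⟩ := hc.five hP (by omega)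
    · refine hc.not_left (by omega) (badShape_six 1 k).mirror (by omega) light_middle
        (fun _ => le_rfl) fun r => ?_
      have := hk r
      omega
    · refine hc.not_right (by omega) (badShape_six 1 k) (by omega) light_middle
        (fun _ => le_rfl) fun r => ?_
      have := hk r
      omega
  · have h1 := hc.left_lt (by omega) hlo badShape_five_rect (by omega)
    have h2 := hc.right_lt (by omega) hhi badShape_five_rect (by omega)
    omega

end Step


/-! ### Cuts in the shapes for nine labels -/

section Nine

variable {lo hi : Fin 4 → ℤ} {N : ℤ} {t τ : ℕ} {P : Finset (Fin 4 × ℤ)} {a b : ℤ}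
  {f l : Fin 4 → ℤ}

/-- Every column between `a` and `b` contains a cell of the cut, and the columns in `T` contain two.
-/
theorem IsCut.width_add_card_le (h : IsCut lo hi N t P a b f l) (T : Finset ℤ)
    (hT : ∀ c ∈ T, a < c ∧ c < b ∧ ∃ r s, r ≠ s ∧ (r, c) ∈ P ∧ (s, c) ∈ P) :
    b - a - 1 + T.card ≤ P.card := by
  classical
  have h1 : P.card = ∑ c ∈ Finset.Ioo a b, (P.filter fun v => v.2 = c).card :=
    Finset.card_eq_sum_card_fiberwise fun v hv => Finset.mem_Ioo.2 (h.mem v hv)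
  have h2 : ∑ c ∈ Finset.Ioo a b, (1 + if c ∈ T then 1 else 0) ≤ P.card := by
    rw [h1]
    refine Finset.sum_le_sum fun c hc => ?_
    rw [Finset.mem_Ioo] at hc
    split_ifs with hcT
    · obtain ⟨-, -, r, s, hrs, hr, hs⟩ := hT c hcT
      rw [show 1 + 1 = ({(r, c), (s, c)} : Finset (Fin 4 × ℤ)).card by
        rw [Finset.card_pair fun h => hrs (Prod.ext_iff.1 h).1]]
      refine Finset.card_le_card fun v hv => ?_
      simp only [Finset.mem_insert, Finset.mem_singleton] at hv
      rcases hv with rfl | rfl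
      exacts [Finset.mem_filter.2 ⟨hr, rfl⟩, Finset.mem_filter.2 ⟨hs, rfl⟩]
    · obtain ⟨r, hr⟩ := h.column c hc.1 hc.2
      exact Finset.card_pos.2 ⟨_, Finset.mem_filter.2 ⟨hr, rfl⟩⟩
  rw [Finset.sum_add_distrib, Finset.sum_const, ← Finset.sum_filter, Finset.sum_const,
    Finset.filter_mem_eq_inter, Finset.inter_eq_right.2 fun c hc =>
      Finset.mem_Ioo.2 ⟨(hT c hc).1, (hT c hc).2.1⟩, Int.card_Ioo] at h2
  simp only [smul_eq_mul, mul_one] at h2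
  have := h.bounds 0
  omega

/-- If a cut has no more cells than columns, then each of its columns holds only one of them. -/
theorem IsCut.single_of_width (h : IsCut lo hi N t P a b f l) (hw : (P.card : ℤ) ≤ b - a - 1) {c : ℤ}
    (h1 : a < c) (h2 : c < b) : ∃ ρ, ∀ r, (r, c) ∈ P → r = ρ := by
  obtain ⟨ρ, hρ⟩ := h.column c h1 h2
  refine ⟨ρ, fun r hr => ?_⟩
  by_contra hne
  have := h.width_add_card_le {c} fun c' hc' => by
    rw [Finset.mem_singleton.1 hc']
    exact ⟨h1, h2, r, ρ, hne, hr, hρ⟩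
  simp at this
  omega

/-- With at most one cell more than columns, the first and the last column cannot both contain two
cells. -/
theorem IsCut.single_ends (h : IsCut lo hi N t P a b f l) (hw : (P.card : ℤ) ≤ b - a)
    (hab : a + 3 ≤ b) : (∃ ρ, ∀ r, r ≠ ρ → a + 1 < f r) ∨ ∃ ρ, ∀ r, r ≠ ρ → l r < b - 1 := by
  by_contra! hcon
  obtain ⟨h1, h2⟩ := hcon
  have key : ∀ c ∈ ({a + 1, b - 1} : Finset ℤ),
      a < c ∧ c < b ∧ ∃ r s, r ≠ s ∧ (r, c) ∈ P ∧ (s, c) ∈ P := by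
    intro c hc
    simp only [Finset.mem_insert, Finset.mem_singleton] at hc
    have hf : ∀ r, f r ≤ a + 1 → (r, a + 1) ∈ P := fun r hr => by
      have := h.bounds r
      have h3 := h.f_mem r
      rwa [show f r = a + 1 by omega] at h3
    have hl : ∀ r, b - 1 ≤ l r → (r, b - 1) ∈ P := fun r hr => by
      have := h.bounds r
      have h3 := h.l_mem r
      rwa [show l r = b - 1 by omega] at h3
    rcases hc with rfl | rfl
    · obtain ⟨r, -, hr⟩ := h1 0
      obtain ⟨s, hs, hs'⟩ := h1 r
      exact ⟨by omega, by omega, s, r, hs, hf s hs', hf r hr⟩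
    · obtain ⟨r, -, hr⟩ := h2 0
      obtain ⟨s, hs, hs'⟩ := h2 r
      exact ⟨by omega, by omega, s, r, hs, hl s hs', hl r hr⟩
  have := h.width_add_card_le _ key
  rw [Finset.card_pair (by omega)] at this
  push_cast at this
  omega

/-- A straight outer end has no extra cells, so for `|P| = 4` the count is 3, and nine labels
suffice. -/
theorem IsCut.not_left_of_zero (h : IsCut lo hi N t P a b f l) (ht : 9 ≤ t) {n : ℤ} {R : Fin 4 → ℕ}
    (hbad : BadShape τ n 0 R) (hτ : t - P.card ≤ τ) (hlo : ∀ r, lo r ≤ 1)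
    (hR : ∀ r, n + R r < f r) : False := by
  refine hbad.not_rankable hτ 0 ?_ ?_
    (h.left (fun r => 1) 1 0 0 hlo (fun r => le_rfl) (fun r => by simp) h.one_le (by simp) ?_)
  · intro r
    simp
  · intro r
    have := hR r
    omega
  · rcases h.card_cases with hp | hp | hp <;> rw [hp] <;> omega

theorem IsCut.not_right_of_zero (h : IsCut lo hi N t P a b f l) (ht : 9 ≤ t) {n : ℤ}
    {L : Fin 4 → ℕ} (hbad : BadShape τ n L 0) (hτ : t - P.card ≤ τ) (hhi : ∀ r, N ≤ hi r)
    (hL : ∀ r, l r < N - n + 1 - L r) : False := by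
  refine hbad.not_rankable hτ (N - n) ?_ ?_
    (h.right (fun r => N) N 0 0 hhi (fun r => le_rfl) (fun r => by simp) h.le (by simp) ?_)
  · intro r
    have := hL r
    omega
  · intro r
    simp
  · rcases h.card_cases with hp | hp | hp <;> rw [hp] <;> omega

theorem badShape_three_rect : BadShape 3 2 0 0 :=
  badShape_three_middle.mono le_rfl 0 (fun r => by simp)
    (fun r => by have := middle_le r; simp only [Pi.zero_apply, middle] at *; omega)

/-- Depths of the rows behind a column, two columns being met in one cell each. -/
def deep (ρ ρ' : Fin 4) : Fin 4 → ℕ := fun r => if r = ρ then 0 else if r = ρ' then 1 else 2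

/-- Up to reflection of the rows, each of the sixteen cases contains one of four certified sets. -/
theorem badShape_deep (ρ ρ' : Fin 4) : BadShape 3 1 0 (deep ρ ρ') := by
  have key : ∀ ρ ρ', (∀ r, middle r ≤ deep ρ ρ' r) ∨
      ((∀ r, ![2, 2, 0, 1] r ≤ deep ρ ρ' r) ∨ ∀ r : Fin 4, ![2, 2, 0, 1] r.rev ≤ deep ρ ρ' r) ∨
      ((∀ r, ![2, 1, 0, 2] r ≤ deep ρ ρ' r) ∨ ∀ r : Fin 4, ![2, 1, 0, 2] r.rev ≤ deep ρ ρ' r) ∨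
      ((∀ r, ![2, 0, 2, 1] r ≤ deep ρ ρ' r) ∨ ∀ r : Fin 4, ![2, 0, 2, 1] r.rev ≤ deep ρ ρ' r) := by
    decide
  have mk : ∀ R : Fin 4 → ℕ, BadShape 3 1 0 R → (∀ r, R r ≤ deep ρ ρ' r) →
      BadShape 3 1 0 (deep ρ ρ') := fun R h hR =>
    h.mono le_rfl 0 (fun r => by simp) (fun r => by have := hR r; omega)
  rcases key ρ ρ' with h | (h | h) | (h | h) | (h | h)
  · exact mk _ badShape_three_middle h
  · exact mk _ badShape_three_deep₀ h
  · exact mk _ badShape_three_deep₀.flip h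
  · exact mk _ badShape_three_deep₁ h
  · exact mk _ badShape_three_deep₁.flip h
  · exact mk _ badShape_three_deep₂ h
  · exact mk _ badShape_three_deep₂.flip h

theorem badShape_two : BadShape 2 1 0 0 :=
  badShape_of_bits (not_rankable_getElem allObstructions_two (m := 15) 4 rfl) _ _ _ 0 (by decide)

theorem exists_paired_le_threeRows : ∀ i : Fin 4, ∃ j, ∀ r, paired j r ≤ threeRows i r := by decide

/-- Four cells in four different columns, moving by at most one column per row, form a diagonal. -/
theorem IsCut.four_tapered (h : IsCut lo hi N t P a b f l) (hP : P.card = 4) (hab : b = a + 5) :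
    ∃ k, ∀ r, a + tapered k r < f r := by
  obtain ⟨-, h1, h2, h3, -, -, hc⟩ := h.four hP
  have hc1 := hc (a + 1) (by omega) (by omega)
  have hc4 := hc (a + 4) (by omega) (by omega)
  by_cases h0 : f 0 < f 3
  · refine ⟨0, forall_fin_four.2 ?_⟩
    simp [tapered]
    omega
  · refine ⟨1, forall_fin_four.2 ?_⟩
    simp [tapered]
    omega

/-- With four cells the cut is a diagonal behind two columns. With five cells at least one end
column of the cut contains a single cell, which leaves three further cells beyond the untouched
columns on that side. With six cells there is one cell per column, and the two columns next to `a`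
leave the shape `deep`. -/
theorem IsCut.not_nine_rect (h : IsCut lo hi 8 9 P a b f l) (hlo : ∀ r, lo r ≤ 1)
    (hhi : ∀ r, 8 ≤ hi r) : False := by
  have hb := h.bounds
  have hw := h.width_le
  have hrect : ∀ n : ℤ, BadShape (9 - P.card) n 0 0 → a < n ∧ 8 - b + 1 < n := by
    intro n hn
    constructor
    · by_contra! hlt
      refine h.not_left_of_zero le_rfl hn le_rfl hlo fun r => ?_
      have := hb r
      simp only [Pi.zero_apply]
      omega
    · by_contra! hlt
      refine h.not_right_of_zero le_rfl hn le_rfl hhi fun r => ?_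
      have := hb r
      simp only [Pi.zero_apply]
      omega
  rcases h.card_cases with hP | hP | hP
  · have h1 := hrect 3 (badShape_five_rect.mono (by omega) 0 (fun _ => by simp) (fun _ => by simp))
    obtain ⟨k, hk⟩ := h.four_tapered hP (by omega)
    refine h.not_left_of_zero le_rfl (badShape_five_tapered k) (by omega) hlo fun r => ?_
    have := hk r
    omega
  · have h1 := hrect 3 (badShape_five_rect.mono (by omega) 0 (fun _ => by simp) (fun _ => by simp))
    have hleft : (∃ ρ, ∀ r, r ≠ ρ → a + 1 < f r) → a < 2 := by
      rintro ⟨ρ, hρ⟩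
      by_contra! hlt
      obtain ⟨j, hj⟩ := exists_paired_le_threeRows ρ
      refine h.not_left_of_zero le_rfl (badShape_four_paired j) (by omega) hlo fun r => ?_
      have h3 := hj r
      have h4 := hb r
      by_cases hr : r = ρ
      · simp only [threeRows, hr, if_true] at h3 h4 ⊢
        omega
      · have := hρ r hr
        simp only [threeRows, hr, if_false] at h3
        omega
    have hright : (∃ ρ, ∀ r, r ≠ ρ → l r < b - 1) → 8 - b + 1 < 2 := by
      rintro ⟨ρ, hρ⟩
      by_contra! hlt
      obtain ⟨j, hj⟩ := exists_paired_le_threeRows ρ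
      refine h.not_right_of_zero le_rfl (badShape_four_paired j).mirror (by omega) hhi fun r => ?_
      have h3 := hj r
      have h4 := hb r
      by_cases hr : r = ρ
      · simp only [threeRows, hr, if_true] at h3 h4 ⊢
        omega
      · have := hρ r hr
        simp only [threeRows, hr, if_false] at h3
        omega
    by_cases h6 : b = a + 6
    · have hs := fun c h1 h2 => h.single_of_width (by omega) (c := c) h1 h2
      obtain ⟨ρ, hρ⟩ := hs (a + 1) (by omega) (by omega)
      obtain ⟨ρ', hρ'⟩ := hs (b - 1) (by omega) (by omega)
      have h2 := hleft ⟨ρ, fun r hr => by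
        by_contra! hle
        have h4 := hb r
        have h5 := h.f_mem r
        rw [show f r = a + 1 by omega] at h5
        exact hr (hρ r h5)⟩
      have h3 := hright ⟨ρ', fun r hr => by
        by_contra! hle
        have h4 := hb r
        have h5 := h.l_mem r
        rw [show l r = b - 1 by omega] at h5
        exact hr (hρ' r h5)⟩
      omega
    · rcases h.single_ends (by omega) (by omega) with h2 | h2
      · have := hleft h2
        omega
      · have := hright h2
        omega
  · have h1 := hrect 2 (badShape_three_rect.mono (by omega) 0 (fun _ => by simp) (fun _ => by simp))
    have hs := fun c h1 h2 => h.single_of_width (by omega) (c := c) h1 h2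
    obtain ⟨ρ, hρ⟩ := hs (a + 1) (by omega) (by omega)
    obtain ⟨ρ', hρ'⟩ := hs (a + 2) (by omega) (by omega)
    refine h.not_left_of_zero le_rfl (badShape_deep ρ ρ') (by omega) hlo fun r => ?_
    have h4 := hb r
    have h5 := h.f_mem r
    have h6 : f r = a + 1 → r = ρ := fun h7 => hρ r (h7 ▸ h5)
    have h7 : f r = a + 2 → r = ρ' := fun h7 => hρ' r (h7 ▸ h5)
    unfold deep
    split_ifs with h8 h9
    · omega
    · have := mt h6 h8
      push_cast
      omega
    · have := mt h6 h8
      have := mt h7 h9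
      push_cast
      omega

/-- The tapered end forces `b = 7` for cuts of four or five cells. A five-cell cut whose last column
contains one cell is excluded by `threeRows`; otherwise its first column contains one cell, which
excludes it on the left. For six cells column 7 and the middle of the taper already exceed three
labels. -/
theorem IsCut.not_nine_tapered {k : Fin 2} (h : IsCut lo hi 7 9 P a b f l) (hlo : ∀ r, lo r ≤ 1)
    (hhi : ∀ r, 7 + tapered k r ≤ hi r) : False := by
  have hb := h.bounds
  have hw := h.width_le
  have hle := h.le
  have hhi' : ∀ r, 7 ≤ hi r := fun r => by have := hhi r; omega
  have hrect : ∀ n : ℤ, BadShape (9 - P.card) n 0 0 → a < n ∧ 7 - b + 1 < n := by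
    intro n hn
    constructor
    · by_contra! hlt
      refine h.not_left_of_zero le_rfl hn le_rfl hlo fun r => ?_
      have := hb r
      simp only [Pi.zero_apply]
      omega
    · by_contra! hlt
      refine h.not_right_of_zero le_rfl hn le_rfl hhi' fun r => ?_
      have := hb r
      simp only [Pi.zero_apply]
      omega
  have hmid : ∀ k : Fin 2, ∀ r, middle r ≤ tapered k r := by decide
  rcases h.card_cases with hP | hP | hP
  · have h1 := hrect 3 (badShape_five_rect.mono (by omega) 0 (fun _ => by simp) (fun _ => by simp))
    have h2 : 7 - b + 1 < 2 := by
      by_contra! hlt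
      -- Here `b = 6`. The count by columns would give 3 + 3, one more than the five available
      -- labels; two rows beyond column 6 contain at most 5 cells.
      have hsum : ∀ k : Fin 2, ∀ s : Finset (Fin 4), s.card ≤ 2 →
          ∑ r ∈ s, (1 + tapered k r) ≤ 5 := by decide
      have hr := h.right_of_rows (fun r => 7 + tapered k r) (fun r => 1 + tapered k r) 5 hhi
        (fun r => by omega) (fun r => by push_cast; omega) (by rw [hP]; exact hsum k) (by omega)
      refine (badShape_five_tapered k).not_rankable (by omega) 5 (fun r => ?_) (fun r => by omega) hr
      have := hb r
      simp only [Pi.zero_apply]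
      omega
    obtain ⟨k, hk⟩ := h.four_tapered hP (by omega)
    refine h.not_left_of_zero le_rfl (badShape_five_tapered k) (by omega) hlo fun r => ?_
    have := hk r
    omega
  · have h1 := hrect 3 (badShape_five_rect.mono (by omega) 0 (fun _ => by simp) (fun _ => by simp))
    have h2 : 7 - b + 1 < 2 := by
      by_contra! hlt
      refine h.not_right (by omega) (badShape_five_tapered k) (by omega) (light_tapered k) hhi
        fun r => ?_
      have := hb r
      simp only [Pi.zero_apply]
      omega
    have hright : ¬ ∃ ρ, ∀ r, r ≠ ρ → l r < b - 1 := by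
      rintro ⟨ρ, hρ⟩
      refine h.not_right (by omega) (badShape_four_threeRows ρ k) (by omega) (light_tapered k) hhi
        fun r => ?_
      have h4 := hb r
      by_cases hr : r = ρ
      · simp only [threeRows, hr, if_true] at h4 ⊢
        omega
      · have := hρ r hr
        simp only [threeRows, hr, if_false]
        omega
    have hleft : (∃ ρ, ∀ r, r ≠ ρ → a + 1 < f r) → a < 2 := by
      rintro ⟨ρ, hρ⟩
      by_contra! hlt
      obtain ⟨j, hj⟩ := exists_paired_le_threeRows ρ
      refine h.not_left_of_zero le_rfl (badShape_four_paired j) (by omega) hlo fun r => ?_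
      have h3 := hj r
      have h4 := hb r
      by_cases hr : r = ρ
      · simp only [threeRows, hr, if_true] at h3 h4 ⊢
        omega
      · have := hρ r hr
        simp only [threeRows, hr, if_false] at h3
        omega
    by_cases h6 : b = a + 6
    · obtain ⟨ρ', hρ'⟩ := h.single_of_width (by omega) (c := b - 1) (by omega) (by omega)
      refine hright ⟨ρ', fun r hr => ?_⟩
      by_contra! hle
      have h4 := hb r
      have h5 := h.l_mem r
      rw [show l r = b - 1 by omega] at h5
      exact hr (hρ' r h5)
    · rcases h.single_ends (by omega) (by omega) with h3 | h3
      · have := hleft h3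
        omega
      · exact hright h3
  · refine h.not_right (by omega) badShape_three_middle (by omega) light_middle (fun r => ?_)
      fun r => ?_
    · have := hmid k r
      have := hhi r
      simp only [middle] at *
      omega
    · have := hb r
      simp only [Pi.zero_apply]
      omega

end Nine


/-! ### The shapes for nine labels and the start of the induction -/

section NineBase

variable {lo hi : Fin 4 → ℤ} {N γ : ℤ} {t : ℕ} {A : Set (Fin 4 × ℤ)} {S : Finset (Fin 4 × ℤ)}

theorem region_subset_component {R : Fin 4 → ℕ} (h : Region (fun _ => γ) (fun r => γ + R r) ⊆ A) :
    Region (fun _ => γ) (fun r => γ + R r) ⊆ component strip A (0, γ) := by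
  have hmem : ∀ r c, γ ≤ c → c ≤ γ + R r → (r, c) ∈ A := fun r c h1 h2 => h ⟨h1, h2⟩
  rintro ⟨r, c⟩ ⟨h1, h2⟩
  simp only at h1 h2
  exact (connIn_col (fun r => hmem r γ le_rfl (by omega)) 0 r).trans
    (connIn_row h1 fun x h3 h4 => hmem r x h3 (by omega))

theorem not_rankable_component {R : Fin 4 → ℕ} (hbad : BadShape t 1 0 R)
    (h : Region (fun _ => γ) (fun r => γ + R r) ⊆ A) :
    ¬ Rankable strip (component strip A (0, γ)) t := fun hr =>
  hbad.not_rankable le_rfl (γ - 1) (fun r => by simp) (fun r => by omega)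
    (hr.mono (region_subset_component h))

/-- The halving argument needs ten labels and is replaced here: seven deletions leave one of eight
columns untouched, and this column would be ranked with two labels. -/
theorem badShape_nine_rect : BadShape 9 8 0 0 := fun hX => by
  have hlo : ∀ r : Fin 4, 1 - ((0 : Fin 4 → ℕ) r : ℤ) ≤ 1 := fun r => by simp
  have hhi : ∀ r : Fin 4, 8 ≤ 8 + ((0 : Fin 4 → ℕ) r : ℤ) := fun r => by simp
  obtain ⟨S, hS, hS7, hcase⟩ := exists_survives hlo hhi hX 7 (by norm_num) (by norm_num)
  rcases lt_or_eq_of_le hS7 with h7 | h7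
  · obtain ⟨a, b, h1, h2, h3, h4⟩ := hcase.resolve_right h7.ne
    obtain ⟨P, a, b, f, l, h⟩ := hS.exists_isCut hlo hhi (by omega) (by norm_num) h1 h2 h3 h4
    exact h.not_nine_rect hlo hhi
  · obtain ⟨γ, h1, h2, hγ⟩ := exists_column_notMem S (α := 1) (β := 8) (by rw [h7]; norm_num)
    refine not_rankable_component badShape_two ?_ ((hS γ h1 h2 hγ).mono_right (by omega))
    rintro ⟨r, c⟩ ⟨h3, h4⟩
    simp only [Pi.zero_apply] at h3 h4
    obtain rfl : c = γ := by omega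
    refine ⟨⟨?_, ?_⟩, hγ r⟩ <;> simp only [Pi.zero_apply] <;> omega

/-- Two columns in one component cannot be destroyed by the deletion of one cell. -/
theorem not_rankable_of_two_columns {γ γ' : ℤ} (hne : γ ≠ γ') (h : ∀ r, (r, γ) ∈ A)
    (h' : ∀ r, (r, γ') ∈ A) (hconn : ConnIn strip A (0, γ) (0, γ')) :
    ¬ Rankable strip (component strip A (0, γ)) 3 := fun hr => by
  have hCC : ∀ u ∈ component strip A (0, γ), ConnIn strip (component strip A (0, γ)) (0, γ) u := by
    intro u hu
    refine (ConnIn.closed (C := component strip A (0, γ)) ?_ (ConnIn.refl _) hu).2.mono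
      Set.inter_subset_right
    exact fun a ha b hb hab => mem_component_closed a ha b hb (ConnIn.mem (h 0) ha) hab
  obtain ⟨v, hv, hvr⟩ := hr.exists_diff_singleton ⟨_, ConnIn.refl _⟩
    fun u hu w hw => (hCC u hu).symm.trans (hCC w hw)
  -- The deleted cell must lie in every full column of the component, since a column has no ranking
  -- with two labels.
  have key : ∀ c, (∀ r, (r, c) ∈ component strip A (0, γ)) → v.2 = c := by
    intro c hc
    by_contra hvc
    refine badShape_two.not_rankable (lo := fun _ => c) (hi := fun _ => c) le_rfl (c - 1)
      (fun r => by simp) (fun r => by simp) (hvr.mono ?_)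
    rintro ⟨r, x⟩ ⟨h1, h2⟩
    obtain rfl : x = c := le_antisymm h2 h1
    exact ⟨hc r, fun h => hvc (by rw [← h])⟩
  have h1 := key γ fun r => connIn_col h 0 r
  have h2 := key γ' fun r => ConnIn.trans hconn (connIn_col h' 0 r)
  exact hne (h1.symm.trans h2)

/-- After six deletions without a separation three labels remain, so only one column `γ` is
untouched. Each of the other six columns then contains exactly one deleted cell, and the cells to
the right of `γ` provide a shape `deep` or the middle of the taper, neither rankable with three
labels. -/
theorem badShape_nine_tapered (k : Fin 2) : BadShape 9 7 0 (tapered k) := fun hX => by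
  have hlo : ∀ r : Fin 4, 1 - ((0 : Fin 4 → ℕ) r : ℤ) ≤ 1 := fun r => by simp
  have hhi : ∀ r : Fin 4, 7 ≤ 7 + (tapered k r : ℤ) := fun r => by omega
  obtain ⟨S, hS, hS6, hcase⟩ := exists_survives hlo hhi hX 6 (by norm_num) (by norm_num)
  by_cases hsep : ∃ a b, 1 ≤ a ∧ a < b ∧ b ≤ 7 ∧
      Separates (fun r => 1 - ((0 : Fin 4 → ℕ) r : ℤ)) (fun r => 7 + (tapered k r : ℤ)) S a b
  · obtain ⟨a, b, h1, h2, h3, h4⟩ := hsep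
    obtain ⟨P, a, b, f, l, h⟩ := hS.exists_isCut hlo hhi hS6 (by norm_num) h1 h2 h3 h4
    exact h.not_nine_tapered hlo fun r => le_rfl
  have hS6 := hcase.resolve_left hsep
  set X := Region (fun r => 1 - ((0 : Fin 4 → ℕ) r : ℤ)) (fun r => 7 + (tapered k r : ℤ)) with hXdef
  have hmem : ∀ r c, (r, c) ∈ X ↔ 1 ≤ c ∧ c ≤ 7 + tapered k r := fun r c => by
    simp [hXdef, Region]
  obtain ⟨γ, h1, h2, hγ⟩ := exists_column_notMem S (α := 1) (β := 7) (by rw [hS6]; norm_num)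
  have hγr := hS γ h1 h2 hγ
  rw [hS6] at hγr
  have hfree : ∀ c, 1 ≤ c → c ≤ 7 → (∀ r, (r, c) ∉ S) → ∀ r, (r, c) ∈ X \ S := fun c h1 h2 h r =>
    ⟨(hmem r c).2 ⟨h1, by omega⟩, h r⟩
  have hhit : ∀ c, 1 ≤ c → c ≤ 7 → c ≠ γ → ∃ r, (r, c) ∈ S := by
    intro c hc1 hc2 hne
    by_contra! hc
    refine not_rankable_of_two_columns hne.symm (hfree γ h1 h2 hγ) (hfree c hc1 hc2 hc) ?_ hγr
    by_contra hn
    rcases lt_or_gt_of_ne hne with h | h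
    · exact hsep ⟨c, γ, hc1, h, h2, hc, hγ, fun h => hn h.symm⟩
    · exact hsep ⟨γ, c, h1, h, hc2, hγ, hc, hn⟩
  have hcols : (Finset.Icc (1 : ℤ) 7).erase γ ⊆ S.image Prod.snd := by
    intro c hc
    rw [Finset.mem_erase, Finset.mem_Icc] at hc
    obtain ⟨r, hr⟩ := hhit c hc.2.1 hc.2.2 hc.1
    exact Finset.mem_image.2 ⟨_, hr, rfl⟩
  have hcard : ((Finset.Icc (1 : ℤ) 7).erase γ).card = 6 := by
    rw [Finset.card_erase_of_mem (Finset.mem_Icc.2 ⟨h1, h2⟩)]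
    rfl
  have himg : (S.image Prod.snd).card = S.card :=
    le_antisymm Finset.card_image_le (by rw [hS6, ← hcard]; exact Finset.card_le_card hcols)
  have hinj := Finset.card_image_iff.1 himg
  have heq : (Finset.Icc (1 : ℤ) 7).erase γ = S.image Prod.snd :=
    Finset.eq_of_subset_of_card_le hcols (by rw [himg, hS6, hcard])
  have hSc : ∀ r c, (r, c) ∈ S → c ≤ 7 := by
    intro r c hc
    have : c ∈ (Finset.Icc (1 : ℤ) 7).erase γ := heq ▸ Finset.mem_image.2 ⟨_, hc, rfl⟩
    exact (Finset.mem_Icc.1 (Finset.mem_of_mem_erase this)).2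
  have hsingle : ∀ c, 1 ≤ c → c ≤ 7 → c ≠ γ → ∃ ρ, ∀ r, (r, c) ∈ S → r = ρ := by
    intro c h1 h2 hne
    obtain ⟨ρ, hρ⟩ := hhit c h1 h2 hne
    exact ⟨ρ, fun r hr => (Prod.ext_iff.1 (hinj hr hρ rfl)).1⟩
  have hmid : ∀ k : Fin 2, ∀ r, middle r ≤ tapered k r := by decide
  by_cases h7 : γ = 7
  · refine not_rankable_component badShape_three_middle ?_ hγr
    rintro ⟨r, c⟩ ⟨h3, h4⟩
    simp only at h3 h4
    have := hmid k r
    simp only [middle] at this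
    refine ⟨(hmem r c).2 (by omega), fun hc => ?_⟩
    have := hSc r c hc
    obtain rfl : c = γ := by omega
    exact hγ r hc
  obtain ⟨ρ, hρ⟩ := hsingle (γ + 1) (by omega) (by omega) (by omega)
  -- For `γ = 6` column 8 belongs to the tapered end, which misses just one row; this row plays the
  -- part of the row with a deleted cell.
  obtain ⟨ρ', hρ', hx⟩ : ∃ ρ', (∀ r, (r, γ + 2) ∈ S → r = ρ') ∧
      ∀ r, r ≠ ρ' → γ + 2 ≤ 7 + tapered k r := by
    by_cases h6 : γ = 6
    · have : ∀ k : Fin 2, ∃ ρ', ∀ r, r ≠ ρ' → 1 ≤ tapered k r := by decide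
      obtain ⟨ρ', h⟩ := this k
      refine ⟨ρ', fun r hr => ?_, fun r hr => ?_⟩
      · have := hSc _ _ hr
        omega
      · have := h r hr
        omega
    · obtain ⟨ρ', h⟩ := hsingle (γ + 2) (by omega) (by omega) (by omega)
      exact ⟨ρ', h, fun r _ => by omega⟩
  refine not_rankable_component (badShape_deep ρ ρ') ?_ hγr
  rintro ⟨r, c⟩ ⟨h3, h4⟩
  simp only [deep] at h3 h4
  have h5 : c = γ ∨ (c = γ + 1 ∧ r ≠ ρ) ∨ (c = γ + 2 ∧ r ≠ ρ ∧ r ≠ ρ') := by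
    split_ifs at h4 with h5 h6
    · push_cast at h4
      omega
    · push_cast at h4
      rcases eq_or_ne c γ with h | h
      · exact Or.inl h
      · exact Or.inr (Or.inl ⟨by omega, h5⟩)
    · push_cast at h4
      rcases eq_or_ne c γ with h | h
      · exact Or.inl h
      rcases eq_or_ne c (γ + 1) with h' | h'
      · exact Or.inr (Or.inl ⟨h', h5⟩)
      · exact Or.inr (Or.inr ⟨by omega, h5, h6⟩)
  rcases h5 with rfl | ⟨rfl, h5⟩ | ⟨rfl, h5, h6⟩
  · exact hfree c h1 h2 hγ r
  · exact ⟨(hmem _ _).2 (by omega), fun h => h5 (hρ r h)⟩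
  · exact ⟨(hmem _ _).2 ⟨by omega, hx r h6⟩, fun h => h6 (hρ' r h)⟩

theorem lowerBlock_six_two : LowerBlock 6 2 where
  rect₀ := badShape_six_rect
  rect₁ := badShape_seven_rect
  taper₁ k := by
    have h : BadShape 7 4 middle (tapered 1) := badShape_seven_corner.mono le_rfl 0
      (fun r => by simp) (fun r => by revert r; decide)
    fin_cases k
    · have h' : BadShape 7 4 middle (tapered 0) := by convert h.flip using 1 <;> decide
      exact h'
    · exact h
  bump₂ := badShape_eight
  rect₃ := badShape_nine_rect
  taper₃ := badShape_nine_tapered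
  pair₄ i := badShape_ten (Or.inl ⟨by norm_num, rfl, i, rfl⟩)
  taper₄ k i := badShape_ten (Or.inr ⟨by norm_num, ⟨k, rfl⟩, i, rfl⟩)
  bump₅ := badShape_eleven

theorem lowerBlock (j : ℕ) : LowerBlock (6 + 4 * j) (2 * 2 ^ j) :=
  lowerBlock_of_base lowerBlock_six_two j

end NineBase


/-! ### Rankings found by computation -/

/-- Breadth-first search from each cell of a level, inside this level and the levels below, ends
without meeting a second cell of the level. -/
def checkLevels : List ℕ → ℕ → Bool
  | [], _ => true
  | L :: Ls, acc =>
    ((List.range 36).all fun i => !L.testBit i ||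
      (decide (growStep (acc ||| L) (growN (acc ||| L) 36 (1 <<< i)) =
        growN (acc ||| L) 36 (1 <<< i)) &&
      decide (growN (acc ||| L) 36 (1 <<< i) &&& L = 1 <<< i))) && checkLevels Ls (acc ||| L)

/-- The cells of all levels. -/
def unionLevels (Ls : List ℕ) (acc : ℕ) : ℕ := Ls.foldl (· ||| ·) acc

section Levels

variable {V : Type*} {G : SimpleGraph V} {A B : Set V} {t : ℕ}

/-- `B` receives the new top label, so its condition concerns connections in the whole union; lower
labels never see the new cells. -/
theorem Rankable.union_level (hA : Rankable G A t)
    (hB : ∀ u ∈ B, ∀ v ∈ B, ConnIn G (A ∪ B) u v → u = v) : Rankable G (A ∪ B) (t + 1) := by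
  classical
  obtain ⟨f, hf, hf'⟩ := hA
  refine ⟨fun v => if v ∈ A then f v else t + 1, fun v hv => ?_, fun u hu v hv huv hc => ?_⟩
  · by_cases h : v ∈ A
    · have := hf v h
      simp only [h, if_true]
      omega
    · simp [h]
  · by_cases h : u ∈ A <;> by_cases h' : v ∈ A
    · simp only [h, h', if_true] at huv hc
      refine hf' u h v h' huv (hc.mono fun z hz => ?_)
      have h1 := hz.2
      have h2 := hf u h
      by_cases hz' : z ∈ A
      · simp only [hz', if_true] at h1
        exact ⟨hz', h1⟩
      · simp only [hz', if_false] at h1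
        omega
    · have := hf u h
      simp only [h, h', if_true, if_false] at huv
      omega
    · have := hf v h'
      simp only [h, h', if_true, if_false] at huv
      omega
    · exact hB u (hu.resolve_left h) v (hv.resolve_left h') (hc.mono fun z hz => hz.1)

/-- A set fixed by the search step is closed under adjacency in `m`. The bound `2 ^ 36` is the range
of the row mask, nine columns. -/
theorem growStep_closed {m c : ℕ} (hm : m < 2 ^ 36) (h : growStep m c = c) {i j : ℕ}
    (hi : i ∈ bits c) (hj : j ∈ bits m) (hij : bitGraph.Adj i j) : j ∈ bits c := by
  have hmask : ∀ i < 36, i % 4 ≠ 3 → (0x777777777 : ℕ).testBit i = true := by decide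
  have hc : ∀ k ∈ bits c, k ∈ bits m := by
    intro k hk
    rw [← h] at hk
    exact (bits_growStep hk).1
  have hi36 := lt_of_testBit hm (hc i hi)
  have hj36 := lt_of_testBit hm hj
  rw [mem_bits] at hi hj ⊢
  rw [← h]
  simp only [growStep, Nat.testBit_and, Nat.testBit_or, Nat.testBit_shiftLeft,
    Nat.testBit_shiftRight, Bool.and_eq_true, Bool.or_eq_true, decide_eq_true_eq]
  refine ⟨?_, hj⟩
  rcases hij with rfl | rfl | ⟨rfl, h3⟩ | ⟨rfl, h3⟩
  · exact Or.inl (Or.inl (Or.inr (by rwa [add_comm 4])))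
  · exact Or.inl (Or.inl (Or.inl (Or.inr ⟨by omega, by simpa using hi⟩)))
  · exact Or.inr ⟨by rwa [add_comm 1], hmask _ hj36 h3⟩
  · exact Or.inl (Or.inr ⟨by omega, by simpa using hi, by simpa using hmask _ hi36 h3⟩)

theorem rankable_of_checkLevels : ∀ (Ls : List ℕ) (acc t : ℕ), checkLevels Ls acc = true →
    unionLevels Ls acc < 2 ^ 36 → Rankable bitGraph (bits acc) t →
    Rankable bitGraph (bits (unionLevels Ls acc)) (t + Ls.length)
  | [], acc, t, _, _, hr => hr
  | L :: Ls, acc, t, h, hm, hr => by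
    rw [checkLevels, Bool.and_eq_true] at h
    have hmono : ∀ (Ls : List ℕ) (acc : ℕ), acc ≤ unionLevels Ls acc := by
      intro Ls
      induction Ls with
      | nil => exact fun acc => le_rfl
      | cons L Ls ih => exact fun acc => Nat.left_le_or.trans (ih (acc ||| L))
    have hlt : acc ||| L < 2 ^ 36 := (hmono Ls (acc ||| L)).trans_lt hm
    have hbits : bits (acc ||| L) = bits acc ∪ bits L := by
      ext i
      simp [bits, Nat.testBit_or]
    have hstep : Rankable bitGraph (bits (acc ||| L)) (t + 1) := by
      rw [hbits]
      refine hr.union_level fun u hu v hv hc => ?_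
      rw [← hbits] at hc
      have hu36 : u < 36 := lt_of_testBit hlt (by
        rw [Nat.testBit_or, mem_bits.1 hu, Bool.or_true])
      have hall := List.all_eq_true.1 h.1 u (List.mem_range.2 hu36)
      rw [mem_bits.1 hu, Bool.not_true, Bool.false_or, Bool.and_eq_true, decide_eq_true_eq,
        decide_eq_true_eq] at hall
      obtain ⟨h1, h2⟩ := hall
      set c := growN (acc ||| L) 36 (1 <<< u) with hcdef
      have huc : u ∈ bits c := by
        have : (c &&& L).testBit u = true := by simp [h2, Nat.testBit_shiftLeft]
        rw [Nat.testBit_and, Bool.and_eq_true] at this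
        exact this.1
      have hvc := (ConnIn.closed (C := bits c)
        (fun a ha b hb hab => growStep_closed hlt h1 ha hb hab) huc hc).1
      have : (c &&& L).testBit v = true := by
        rw [Nat.testBit_and, mem_bits.1 hvc, mem_bits.1 hv]
        rfl
      simp only [h2, Nat.testBit_shiftLeft, Bool.and_eq_true, decide_eq_true_eq,
        Nat.testBit_one_eq_true_iff_self_eq_zero] at this
      omega
    have := rankable_of_checkLevels Ls (acc ||| L) (t + 1) h.2 hm hstep
    rwa [List.length_cons, add_comm Ls.length, ← add_assoc]

theorem rankable_region_of_levels {lo hi : Fin 4 → ℤ} (Ls : List ℕ) (x : ℤ) (lo' hi' : Fin 4 → ℕ)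
    (h : checkLevels Ls 0 = true) (hm : unionLevels Ls 0 < 2 ^ 36)
    (hall : ∀ r, ∀ c < 9, lo' r ≤ c → c ≤ hi' r → (unionLevels Ls 0).testBit (4 * c + r.val) = true)
    (hi9 : ∀ r, hi' r < 9) (hlo : ∀ r, x + lo' r ≤ lo r) (hhi : ∀ r, hi r ≤ x + hi' r) :
    Rankable strip (Region lo hi) Ls.length := by
  have hr := rankable_of_checkLevels (t := 0) Ls 0 h hm
    (by rw [show bits 0 = ∅ by ext i; simp [bits]]; exact rankable_empty)
  rw [zero_add] at hr
  have hx : ∀ v ∈ Region lo hi, x ≤ v.2 := fun v hv => by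
    have h1 := hlo v.1
    have h2 := hv.1
    omega
  -- `x` is the column of the strip that corresponds to column 0 of the code.
  refine hr.comap (fun v => 4 * (v.2 - x).toNat + v.1.val) ?_ ?_ ?_
  · rintro ⟨r, c⟩ hv ⟨r', c'⟩ hv' h
    have h1 := hx _ hv
    have h2 := hx _ hv'
    simp only at h h1 h2
    refine Prod.ext (Fin.ext ?_) ?_ <;> simp only <;> omega
  · rintro ⟨r, c⟩ hv ⟨r', c'⟩ hv' h
    have h1 := hx _ hv
    have h2 := hx _ hv'
    simp only at h1 h2
    simp only [strip, bitGraph, Fin.ext_iff] at h ⊢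
    omega
  · rintro ⟨r, c⟩ hv
    have h1 := hx _ hv
    have h2 := hhi r
    have h3 := hlo r
    have h4 := hi9 r
    obtain ⟨h5, h6⟩ := hv
    simp only at h1 h5 h6
    exact hall r _ (by omega) (by omega) (by omega)

/-- Deletion of one cell in each row, in neighbouring positions in neighbouring rows, splits a
region. -/
theorem rankable_of_profile {lo hi : Fin 4 → ℤ} {t : ℕ} (s : Fin 4 → ℤ)
    (hs : ∀ r r' : Fin 4, r.val + 1 = r'.val → s r ≤ s r' + 1 ∧ s r' ≤ s r + 1)
    (hL : Rankable strip (Region lo fun r => s r - 1) t)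
    (hR : Rankable strip (Region (fun r => s r + 1) hi) t) :
    Rankable strip (Region lo hi) (t + 4) := by
  have hcard : (Finset.univ.image fun r : Fin 4 => (r, s r)).card = 4 := by
    rw [Finset.card_image_of_injective _ fun a b hab => (Prod.ext_iff.1 hab).1]
    rfl
  have key : Rankable strip (Region lo hi \ ↑(Finset.univ.image fun r : Fin 4 => (r, s r))) t := by
    refine (hL.union hR ?_).mono ?_
    swap
    · rintro ⟨r, c⟩ ⟨⟨h1, h2⟩, h3⟩
      simp only at h1 h2
      have hne : c ≠ s r := by
        rintro rfl
        exact h3 (by simp)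
      rcases lt_or_gt_of_ne hne with h | h
      · exact Or.inl ⟨h1, by simp only; omega⟩
      · exact Or.inr ⟨by simp only; omega, h2⟩
    rintro ⟨r, c⟩ ⟨-, h1⟩ ⟨r', c'⟩ ⟨h2, -⟩ hadj
    simp only at h1 h2
    rcases hadj with ⟨h3, h4⟩ | ⟨h3, h4 | h4⟩ <;> simp only at h3 h4
    · subst h3
      omega
    · have := hs r' r h4.symm
      omega
    · have := hs r r' h4.symm
      omega
  have := key.of_diff_finset
  rwa [hcard] at this

end Levels


/-! ### Explicit small rankings -/

section UpperBase

/-- The profile of a diagonal cut. -/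
def ramp : Fin 4 → ℤ := ![0, 1, 2, 3]

/-- The profile of a cut with one turn. -/
def kink : Fin 4 → ℤ := ![1, 0, 1, 2]

/-- In each list the entry in place i is the set of cells with label i, beginning with label 1. -/
theorem rankable_rect_three : Rankable strip (Region (fun _ => 1) (fun _ => 3)) 6 :=
  rankable_region_of_levels [2650, 384, 1024, 32, 4, 1] 1 ![0, 0, 0, 0] ![2, 2, 2, 2]
    (by decide +kernel) (by decide) (by decide) (by decide) (by decide) (by decide)

theorem rankable_rect_four : Rankable strip (Region (fun _ => 1) (fun _ => 4)) 7 :=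
  rankable_region_of_levels [23130, 33024, 8196, 1024, 128, 32, 1] 1 ![0, 0, 0, 0] ![3, 3, 3, 3]
    (by decide +kernel) (by decide) (by decide) (by decide) (by decide) (by decide)

theorem rankable_ramp_four : Rankable strip (Region (fun _ => 1) (fun r => 1 + ramp r)) 4 :=
  rankable_region_of_levels [33957, 2050, 64, 8] 1 ![0, 0, 0, 0] ![0, 1, 2, 3]
    (by decide +kernel) (by decide) (by decide) (by decide) (by decide) (by decide)

theorem rankable_slant_four : Rankable strip (Region (fun r => ramp r + 1) (fun r => ramp r + 3)) 4 :=
  rankable_region_of_levels [8693025, 524288, 16400, 512] 1 ![0, 1, 2, 3] ![2, 3, 4, 5]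
    (by decide +kernel) (by decide) (by decide) (by decide) (by decide) (by decide)

theorem rankable_ramp_six : Rankable strip (Region (fun _ => 1) (fun r => 3 + ramp r)) 6 :=
  rankable_region_of_levels [8693157, 524312, 16386, 2048, 512, 64] 1 ![0, 0, 0, 0] ![2, 3, 4, 5]
    (by decide +kernel) (by decide) (by decide) (by decide) (by decide) (by decide)

theorem rankable_slant_six : Rankable strip (Region (fun r => ramp r + 1) (fun r => ramp r + 5)) 6 :=
  rankable_region_of_levels [2225448225, 134221824, 4194816, 524304, 131072, 16384] 1 ![0, 1, 2, 3] ![4, 5, 6, 7]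
    (by decide +kernel) (by decide) (by decide) (by decide) (by decide) (by decide)

theorem rankable_kink_five : Rankable strip (Region (fun _ => 1) (fun r => 2 + kink r)) 5 :=
  rankable_region_of_levels [34213, 2050, 64, 8, 16] 1 ![0, 0, 0, 0] ![2, 1, 2, 3]
    (by decide +kernel) (by decide) (by decide) (by decide) (by decide) (by decide)

theorem rankable_kink_five' : Rankable strip (Region (fun _ => 1) (fun r => 2 + (2 - kink r))) 5 :=
  rankable_region_of_levels [9637, 24, 2, 64, 512] 1 ![0, 0, 0, 0] ![2, 3, 2, 1]
    (by decide +kernel) (by decide) (by decide) (by decide) (by decide) (by decide)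

theorem rankable_ramp_seven : Rankable strip (Region (fun _ => 1) (fun r => 4 + ramp r)) 7 :=
  rankable_region_of_levels [139090522, 8396929, 262148, 32768, 1024, 256, 32] 1 ![0, 0, 0, 0] ![3, 4, 5, 6]
    (by decide +kernel) (by decide) (by decide) (by decide) (by decide) (by decide)

theorem rankable_kink_nine : Rankable strip (Region (fun _ => 1) (fun r => 7 + kink r)) 9 :=
  rankable_of_profile ![3, 4, 5, 4] (by decide)
    (rankable_region_of_levels [19034, 129, 4, 32, 1024] 1
      ![0, 0, 0, 0] ![1, 2, 3, 2] (by decide +kernel) (by decide) (by decide) (by decide) (by decide) (by decide))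
    (rankable_region_of_levels [8725665, 530448, 33024, 16384, 512] 4
      ![0, 1, 2, 1] ![4, 3, 4, 5] (by decide +kernel) (by decide) (by decide) (by decide) (by decide) (by decide))

theorem rankable_kink_nine' : Rankable strip (Region (fun _ => 1) (fun r => 7 + (2 - kink r))) 9 :=
  rankable_of_profile ![3, 4, 5, 4] (by decide)
    (rankable_region_of_levels [19034, 129, 4, 32, 1024] 1
      ![0, 0, 0, 0] ![1, 2, 3, 2] (by decide +kernel) (by decide) (by decide) (by decide) (by decide) (by decide))
    (rankable_region_of_levels [2467233, 133120, 16400, 4096, 512] 4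
      ![0, 1, 2, 1] ![4, 5, 4, 3] (by decide +kernel) (by decide) (by decide) (by decide) (by decide) (by decide))

theorem rankable_bent_nine : Rankable strip (Region (fun r => kink r + 1) (fun r => kink r + 9)) 9 :=
  rankable_of_profile ![5, 6, 7, 6] (by decide)
    (rankable_region_of_levels [4872786, 33024, 262176, 8192, 1024] 1
      ![1, 0, 1, 2] ![3, 4, 5, 4] (by decide +kernel) (by decide) (by decide) (by decide) (by decide) (by decide))
    (rankable_region_of_levels [8725665, 530448, 33024, 16384, 512] 6
      ![0, 1, 2, 1] ![4, 3, 4, 5] (by decide +kernel) (by decide) (by decide) (by decide) (by decide) (by decide))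

theorem rankable_ramp_eleven : Rankable strip (Region (fun _ => 1) (fun r => 11 + ramp r)) 11 :=
  rankable_of_profile ![8, 7, 6, 5] (by decide)
    (rankable_region_of_levels [19244453, 1050626, 131136, 4104, 16384, 512, 16] 1
      ![0, 0, 0, 0] ![6, 5, 4, 3] (by decide +kernel) (by decide) (by decide) (by decide) (by decide) (by decide))
    (rankable_region_of_levels [35607173704, 2147516416, 67175424, 2097280, 8388608, 262144, 8192] 6
      ![3, 2, 1, 0] ![5, 6, 7, 8] (by decide +kernel) (by decide) (by decide) (by decide) (by decide) (by decide))

theorem rankable_slant_eleven : Rankable strip (Region (fun r => ramp r + 1) (fun r => ramp r + 13)) 11 :=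
  rankable_of_profile ![8, 9, 8, 9] (by decide)
    (rankable_region_of_levels [2779096353, 135282704, 33554944, 4194304, 524288, 131072, 4096] 1
      ![0, 1, 2, 3] ![6, 7, 6, 7] (by decide +kernel) (by decide) (by decide) (by decide) (by decide) (by decide))
    (rankable_region_of_levels [2225448357, 134350864, 4194368, 524288, 16384, 4096, 512] 9
      ![0, 1, 0, 1] ![4, 5, 6, 7] (by decide +kernel) (by decide) (by decide) (by decide) (by decide) (by decide))

end UpperBase

/-! ### Doubling the rankings -/

section UpperBlock

variable {s : Fin 4 → ℤ} {c x q : ℤ} {t : ℕ}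

/-- Shapes with rankings that double in width when four labels are added: two shapes with one
straight and one slanted end, and a shape with two parallel slanted ends. -/
structure UpperBlock (s : Fin 4 → ℤ) (c : ℤ) (t : ℕ) (x q : ℤ) : Prop where
  left : Rankable strip (Region (fun _ => 1) fun r => x + s r) t
  left' : Rankable strip (Region (fun _ => 1) fun r => x + (c - s r)) t
  both : Rankable strip (Region (fun r => s r + 1) fun r => s r + q) t

/-- A profile along which the strip can be cut. -/
abbrev IsProfile (s : Fin 4 → ℤ) : Prop :=
  ∀ r r' : Fin 4, r.val + 1 = r'.val → s r ≤ s r' + 1 ∧ s r' ≤ s r + 1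

theorem Rankable.translate {lo hi lo' hi' : Fin 4 → ℤ} (h : Rankable strip (Region lo hi) t) (y : ℤ)
    (h1 : ∀ r, lo r + y ≤ lo' r) (h2 : ∀ r, hi' r ≤ hi r + y) :
    Rankable strip (Region lo' hi') t :=
  (rankable_region_translate (-y) h).mono (Region.subset (fun r => by have := h1 r; omega)
    fun r => by have := h2 r; omega)

/-- Seen from the right end, the profile `s` becomes `c - s` up to translation. The right half of
the rectangle is therefore the mirror image of `left'`. -/
theorem UpperBlock.rect (h : UpperBlock s c t x q) (hs : IsProfile s) :
    Rankable strip (Region (fun _ => 1) fun _ => 2 * x + c + 1) (t + 4) := by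
  refine rankable_of_profile (fun r => x + 1 + s r)
    (fun r r' hr => by have := hs r r' hr; omega) ?_ ?_
  · exact h.left.translate 0 (fun r => by omega) (fun r => by omega)
  · exact (rankable_region_mirror (2 * x + c + 2) h.left').mono (Region.subset (fun r => by omega)
      fun r => by omega)

/-- A parallelogram is attached behind a parallel cut. Two parallelograms of width `q` and the cut
have width `2 * q + 1`. -/
theorem UpperBlock.step (h : UpperBlock s c t x q) (hs : IsProfile s) :
    UpperBlock s c (t + 4) (x + 1 + q) (2 * q + 1) where
  left := by
    refine rankable_of_profile (fun r => x + 1 + s r)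
      (fun r r' hr => by have := hs r r' hr; omega) ?_ ?_
    · exact h.left.translate 0 (fun r => by omega) (fun r => by omega)
    · exact h.both.translate (x + 1) (fun r => by omega) (fun r => by omega)
  left' := by
    refine rankable_of_profile (fun r => x + 1 + (c - s r))
      (fun r r' hr => by have := hs r r' hr; omega) ?_ ?_
    · exact h.left'.translate 0 (fun r => by omega) (fun r => by omega)
    · exact (rankable_region_mirror (x + 2 + c + q) h.both).mono (Region.subset
        (fun r => by omega) fun r => by omega)
  both := by
    refine rankable_of_profile (fun r => s r + q + 1)
      (fun r r' hr => by have := hs r r' hr; omega) ?_ ?_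
    · exact h.both.translate 0 (fun r => by omega) (fun r => by omega)
    · exact h.both.translate (q + 1) (fun r => by omega) (fun r => by omega)

/-- `q + 1` doubles in each step, and `x - q` does not change. -/
theorem UpperBlock.iterate (h : UpperBlock s c t x q) (hs : IsProfile s) (j : ℕ) :
    UpperBlock s c (t + 4 * j) (x - q + (2 ^ j * (q + 1) - 1)) (2 ^ j * (q + 1) - 1) := by
  induction j with
  | zero =>
    simpa using h
  | succ j ih =>
    have := ih.step hs
    convert this using 1 <;> ring

theorem isProfile_ramp : IsProfile ramp := by decide

theorem isProfile_kink : IsProfile kink := by decide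

/-- The complement `3 - ramp` is the flipped ramp, so `left'` comes for free. `kink` lacks this
symmetry and needs its own second ranking. -/
theorem upperBlock_ramp {t : ℕ} {x q : ℤ}
    (h : Rankable strip (Region (fun _ => 1) fun r => x + ramp r) t)
    (h' : Rankable strip (Region (fun r => ramp r + 1) fun r => ramp r + q) t) :
    UpperBlock ramp 3 t x q := by
  refine ⟨h, (rankable_region_flip h).mono (Region.subset (fun r => le_rfl) fun r => ?_), h'⟩
  have : ∀ r : Fin 4, 3 - ramp r = ramp r.rev := by decide
  rw [this]

/-- The widest rectangles that have rankings with a given number of labels. -/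
theorem rankable_rects (j : ℕ) :
    Rankable strip (Region (fun _ => 1) fun _ => 8 * 2 ^ j - 2) (8 + 4 * j) ∧
    Rankable strip (Region (fun _ => 1) fun _ => 10 * 2 ^ j - 3) (9 + 4 * j) ∧
    Rankable strip (Region (fun _ => 1) fun _ => 12 * 2 ^ j - 2) (10 + 4 * j) ∧
    Rankable strip (Region (fun _ => 1) fun _ => 14 * 2 ^ j - 2) (11 + 4 * j) := by
  have shrink : ∀ {t t' : ℕ} {n n' : ℤ}, Rankable strip (Region (fun _ => 1) fun _ => n) t →
      t = t' → n' = n → Rankable strip (Region (fun _ => 1) fun _ => n') t' := by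
    rintro t t' n n' h rfl rfl
    exact h
  refine ⟨?_, ?_, ?_, ?_⟩
  · exact shrink (((upperBlock_ramp rankable_ramp_four rankable_slant_four).iterate
      isProfile_ramp j).rect isProfile_ramp) (by ring) (by ring)
  · cases j with
    -- The smallest rectangle is glued directly; the doubling family starts one size later.
    | zero =>
      have h := rankable_of_profile (lo := fun _ => 1) (hi := fun _ => 7) (t := 5)
        (fun r => 3 + kink r) (fun r r' hr => by have := isProfile_kink r r' hr; omega)
        (rankable_kink_five.translate 0 (fun r => by omega) (fun r => by omega))
        ((rankable_region_mirror 8 rankable_kink_five').mono (Region.subset (fun r => by omega)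
          fun r => by omega))
      exact shrink h (by ring) (by norm_num)
    | succ j =>
      exact shrink (((UpperBlock.mk rankable_kink_nine rankable_kink_nine'
        rankable_bent_nine).iterate isProfile_kink j).rect isProfile_kink) (by ring) (by ring)
  · exact shrink (((upperBlock_ramp rankable_ramp_six rankable_slant_six).iterate
      isProfile_ramp j).rect isProfile_ramp) (by ring) (by ring)
  · cases j with
    | zero =>
      have h := rankable_of_profile (lo := fun _ => 1) (hi := fun _ => 12) (t := 7)
        (fun r => 5 + ramp r) (fun r r' hr => by have := isProfile_ramp r r' hr; omega)
        (rankable_ramp_seven.translate 0 (fun r => by omega) (fun r => by omega))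
        ((rankable_region_mirror 13 (rankable_region_flip rankable_ramp_seven)).mono
          (Region.subset ?_ fun r => by omega))
      · exact shrink h (by ring) (by norm_num)
      · have : ∀ r : Fin 4, 3 - ramp r = ramp r.rev := by decide
        intro r
        have := this r
        omega
    | succ j =>
      exact shrink (((upperBlock_ramp rankable_ramp_eleven rankable_slant_eleven).iterate
        isProfile_ramp j).rect isProfile_ramp) (by ring) (by ring)

end UpperBlock


/-! ### The rank numbers of the grids -/

section GridRank

theorem rankable_gridGraph_iff {n t : ℕ} : Rankable (gridGraph 4 n) Set.univ t ↔
    Rankable strip (Region (fun _ => 1) fun _ => n) t := by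
  constructor
  · intro h
    rcases Nat.eq_zero_or_pos n with rfl | hn
    · refine rankable_empty.mono (B := ∅) fun v hv => ?_
      have h1 := hv.1
      have h2 := hv.2
      simp only at h1 h2
      omega
    have hc : ∀ v ∈ Region (fun _ => 1) (fun _ : Fin 4 => (n : ℤ)), (v.2 - 1).toNat < n ∧
        ((v.2 - 1).toNat : ℤ) + 1 = v.2 := fun v hv => by
      have h1 := hv.1
      have h2 := hv.2
      simp only at h1 h2
      omega
    -- The minimum only makes the column index valid outside the region.
    refine h.comap (fun v => (v.1, ⟨min (v.2 - 1).toNat (n - 1), by omega⟩)) ?_ ?_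
      fun _ _ => trivial
    · rintro ⟨r, c⟩ hv ⟨r', c'⟩ hv' h
      have h1 := hc _ hv
      have h2 := hc _ hv'
      simp only [Prod.mk.injEq, Fin.mk.injEq] at h h1 h2 ⊢
      exact ⟨h.1, by omega⟩
    · rintro ⟨r, c⟩ hv ⟨r', c'⟩ hv' h
      have h1 := hc _ hv
      have h2 := hc _ hv'
      simp only [strip, gridGraph, SimpleGraph.boxProd_adj, SimpleGraph.pathGraph_adj, Fin.ext_iff]
        at h h1 h2 ⊢
      omega
  · intro h
    refine h.comap (fun v => (v.1, (v.2.val : ℤ) + 1)) ?_ ?_ ?_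
    · rintro ⟨r, c⟩ _ ⟨r', c'⟩ _ h
      simp only [Prod.mk.injEq] at h
      exact Prod.ext h.1 (Fin.ext (by simp only; omega))
    · rintro ⟨r, c⟩ _ ⟨r', c'⟩ _ h
      simp only [strip, gridGraph, SimpleGraph.boxProd_adj, SimpleGraph.pathGraph_adj, Fin.ext_iff]
        at h ⊢
      omega
    · rintro ⟨r, c⟩ _
      have := c.isLt
      exact ⟨by simp only; omega, by simp only; omega⟩

theorem gridRank_eq_of_badShape {n t : ℕ} {a b : ℤ} (hbad : BadShape t a 0 0) (ha : a ≤ n)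
    (h : Rankable strip (Region (fun _ => 1) fun _ => b) (t + 1)) (hb : (n : ℤ) ≤ b) :
    gridRank 4 n = t + 1 := by
  refine rankNumber_eq (rankable_gridGraph_iff.2 (h.mono (Region.subset (fun _ => le_rfl)
    fun _ => hb))) fun h' => ?_
  exact hbad.not_rankable le_rfl 0 (fun r => by simp) (fun r => by simpa using ha)
    (rankable_gridGraph_iff.1 h')

theorem gridRank_three : gridRank 4 3 = 6 :=
  gridRank_eq_of_badShape badShape_five_rect (by norm_num) rankable_rect_three (by norm_num)

theorem gridRank_four : gridRank 4 4 = 7 :=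
  gridRank_eq_of_badShape badShape_six_rect (by norm_num) rankable_rect_four (by norm_num)

theorem gridRank_five_six {n : ℕ} (h : 5 ≤ n) (h' : n ≤ 6) : gridRank 4 n = 8 :=
  gridRank_eq_of_badShape badShape_seven_rect (by omega) (rankable_rects 0).1 (by norm_num; omega)

/-- The least excluded widths 8u-1, 10u-2, 12u-1 and 14u-1 of `lowerBlock j` exceed the widths of
`rankable_rects` by exactly one, so the four intervals fill a block without gaps. -/
theorem gridRank_values {u j n : ℕ} (hu : u = 2 ^ j) :
    (8 * u ≤ n + 1 → n + 3 ≤ 10 * u → gridRank 4 n = 9 + 4 * j) ∧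
    (10 * u ≤ n + 2 → n + 2 ≤ 12 * u → gridRank 4 n = 10 + 4 * j) ∧
    (12 * u ≤ n + 1 → n + 2 ≤ 14 * u → gridRank 4 n = 11 + 4 * j) ∧
    (14 * u ≤ n + 1 → n + 2 ≤ 16 * u → gridRank 4 n = 12 + 4 * j) := by
  have hB := lowerBlock j
  obtain ⟨-, h1, h2, h3⟩ := rankable_rects j
  obtain ⟨h4, -⟩ := rankable_rects (j + 1)
  have hu' : (2 : ℤ) ^ j = u := by rw [hu]; push_cast; rfl
  rw [pow_succ] at h4
  rw [hu'] at hB h1 h2 h3 h4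
  have e : ∀ i, 6 + 4 * j + i + 1 = 6 + i + 1 + 4 * j := fun i => by ring
  refine ⟨fun h h' => ?_, fun h h' => ?_, fun h h' => ?_, fun h h' => ?_⟩
  · have := gridRank_eq_of_badShape (n := n) hB.rect₂ (by omega)
      (by rw [e]; exact h1) (by omega)
    rw [this]
    ring
  · have := gridRank_eq_of_badShape (n := n) hB.rect₃ (by omega)
      (by rw [e]; exact h2) (by omega)
    rw [this]
    ring
  · have := gridRank_eq_of_badShape (n := n) hB.rect₄ (by omega)
      (by rw [e]; exact h3) (by omega)
    rw [this]
    ring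
  · have := gridRank_eq_of_badShape (n := n) hB.rect₅ (by omega)
      (by rw [e, show 6 + 5 + 1 + 4 * j = 8 + 4 * (j + 1) by ring]; exact h4) (by omega)
    rw [this]
    ring

theorem gridRank_pred {u j n : ℕ} (hu : u = 2 ^ j) (h : n + 2 = 8 * u) :
    gridRank 4 n = 8 + 4 * j := by
  cases j with
  | zero => exact gridRank_five_six (by omega) (by omega)
  | succ j =>
    rw [pow_succ] at hu
    rw [(gridRank_values (u := 2 ^ j) rfl).2.2.2 (by omega) (by omega)]
    ring

/-- `d` is the number formed by the three leading binary digits of `N`, so `d - 4` is the value of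
the last two of them. -/
theorem bitTerm_eq {u j N d : ℕ} (hu : u = 2 ^ j) (hd : 4 ≤ d) (hd' : d ≤ 7) (h : 2 * u * d ≤ N)
    (h' : N < 2 * u * (d + 1)) : bitTerm N = d - 4 := by
  have hu0 : 0 < u := hu ▸ Nat.two_pow_pos j
  have h2 : 2 ^ (j + 1) = 2 * u := by rw [hu, pow_succ, mul_comm]
  have hdiv : N / 2 ^ (j + 1) = d := by
    rw [h2]
    exact Nat.div_eq_of_lt_le (by rwa [mul_comm]) (by rwa [mul_comm])
  have hdiv' : N / 2 ^ (j + 2) = d / 2 := by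
    rw [show j + 2 = j + 1 + 1 by ring, pow_succ, ← Nat.div_div_eq_div_mul, hdiv]
  have hsize : Nat.size N = j + 4 := by
    apply le_antisymm
    · rw [Nat.size_le, show j + 4 = j + 1 + 3 by ring, pow_add, h2]
      nlinarith
    · rw [Nat.succ_le_iff, Nat.lt_size, show j + 3 = j + 1 + 2 by ring, pow_add, h2]
      nlinarith
  simp only [bitTerm, msBit, hsize, Nat.testBit_eq_decide_div_mod_eq, decide_eq_true_eq,
    show j + 4 - 2 = j + 2 by omega, show j + 4 - 3 = j + 1 by omega, hdiv, hdiv']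
  interval_cases d <;> simp

theorem ceil_half_sub {n : ℕ} (hn : 4 ≤ n) : ⌈((n : ℚ) - 4) / 2⌉₊ = (n - 3) / 2 := by
  rcases Nat.even_or_odd' (n - 4) with ⟨c, hc | hc⟩
  · obtain rfl : n = 2 * c + 4 := by omega
    rw [show (((2 * c + 4 : ℕ) : ℚ) - 4) / 2 = (c : ℕ) by push_cast; ring, Nat.ceil_natCast]
    omega
  · obtain rfl : n = 2 * c + 5 := by omega
    rw [show (2 * c + 5 - 3) / 2 = c + 1 by omega, Nat.ceil_eq_iff (by omega)]
    push_cast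
    constructor <;> linarith

theorem exists_pow_block {n : ℕ} (hn : 8 < n) : ∃ j u, u = 2 ^ j ∧ 8 * u ≤ n + 1 ∧ n + 1 < 16 * u ∧
    Nat.log 2 (n + 1) = j + 3 := by
  have h3 : 3 ≤ Nat.log 2 (n + 1) := Nat.le_log_of_pow_le (by norm_num) (by omega)
  obtain ⟨j, hj⟩ := Nat.exists_eq_add_of_le' h3
  have h1 := Nat.pow_log_le_self 2 (x := n + 1) (by omega)
  have h2 := Nat.lt_pow_succ_log_self (b := 2) (by norm_num) (n + 1)
  rw [hj] at h1 h2
  rw [pow_add] at h1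
  rw [show (j + 3).succ = j + 4 by rfl, pow_add] at h2
  exact ⟨j, 2 ^ j, rfl, by omega, by omega, hj⟩

theorem eq_of_pow_block {i j N : ℕ} (h1 : 8 * 2 ^ i ≤ N) (h2 : N < 16 * 2 ^ i)
    (h3 : 8 * 2 ^ j ≤ N) (h4 : N < 16 * 2 ^ j) : i = j := by
  by_contra hne
  rcases lt_or_gt_of_ne hne with h | h
  · have := Nat.pow_le_pow_right (n := 2) (by norm_num) (Nat.succ_le_of_lt h)
    rw [Nat.succ_eq_add_one, pow_succ] at this
    omega
  · have := Nat.pow_le_pow_right (n := 2) (by norm_num) (Nat.succ_le_of_lt h)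
    rw [Nat.succ_eq_add_one, pow_succ] at this
    omega

/-- In the block of `u = 2 ^ j` only `k = j + 3` can occur, and `4 ≤ k` becomes `1 ≤ j`. -/
theorem mem_exceptionalSet_iff {n j u : ℕ} (hu : u = 2 ^ j) (h1 : 8 * u ≤ n + 1)
    (h2 : n + 1 < 16 * u) : n ∈ exceptionalSet ↔ 1 ≤ j ∧
      (n + 1 = 8 * u ∨ n = 8 * u ∨ n + 2 = 10 * u ∨ n + 1 = 12 * u ∨ n = 12 * u ∨ n + 1 = 14 * u ∨
        n = 14 * u) := by
  have key : ∀ i, 2 ^ (i + 3) = 8 * 2 ^ i ∧ 2 ^ (i + 3 - 2) = 2 * 2 ^ i ∧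
      2 ^ (i + 3 - 1) = 4 * 2 ^ i := fun i => by
    refine ⟨by rw [pow_add]; ring, ?_, ?_⟩
    · rw [show i + 3 - 2 = i + 1 by omega, pow_succ, mul_comm]
    · rw [show i + 3 - 1 = i + 2 by omega, pow_add, mul_comm]; rfl
  simp only [exceptionalSet, Set.mem_ofPred_eq, Set.mem_Icc]
  constructor
  · rintro ⟨k, hk, h⟩
    obtain ⟨i, rfl⟩ := Nat.exists_eq_add_of_le' (show 3 ≤ k by omega)
    obtain ⟨e1, e2, e3⟩ := key i
    rw [e1, e2, e3] at h
    have hi : 2 ≤ 2 ^ i := by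
      have := Nat.pow_le_pow_right (n := 2) (by norm_num) (show 1 ≤ i by omega)
      simpa using this
    obtain rfl : i = j := by
      refine eq_of_pow_block (N := n + 1) ?_ ?_ (hu ▸ h1) (hu ▸ h2) <;> omega
    rw [← hu] at h hi
    exact ⟨by omega, by omega⟩
  · rintro ⟨hj, h⟩
    obtain ⟨e1, e2, e3⟩ := key j
    refine ⟨j + 3, by omega, ?_⟩
    rw [e1, e2, e3, ← hu]
    omega

end GridRank

theorem theorem1 (n : ℕ) (hn : 8 < n) :
    ((∀ k : ℕ, 2 ≤ k → (n = 2 ^ k + 2 ^ (k - 2) - 2 ∨ n = 2 ^ k + 2 ^ (k - 2) - 1) →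
        (gridRank 4 n : ℤ) = 4 * (k : ℤ) - 2) ∧
      ((∀ k : ℕ, 2 ≤ k → n ≠ 2 ^ k + 2 ^ (k - 2) - 2 ∧ n ≠ 2 ^ k + 2 ^ (k - 2) - 1) →
        (gridRank 4 n : ℤ) = 4 * (Nat.log 2 (n + 1) : ℤ) - 3 + (bitTerm (n + 1) : ℤ))) ∧
    ((n ∈ exceptionalSet → gridRank 4 n = 5 + gridRank 4 ⌈((n : ℚ) - 4) / 2⌉₊) ∧
      (n ∉ exceptionalSet → gridRank 4 n = 4 + gridRank 4 ⌈((n : ℚ) - 4) / 2⌉₊)) := by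
  obtain ⟨j, u, hu, h1, h2, hlog⟩ := exists_pow_block hn
  have hu0 : 0 < u := hu ▸ Nat.two_pow_pos j
  refine ⟨⟨?_, ?_⟩, ?_⟩
  · intro k hk h
    have e : 2 ^ k = 4 * 2 ^ (k - 2) := by
      rw [← Nat.sub_add_cancel hk, pow_add, Nat.add_sub_cancel, mul_comm]; rfl
    -- `k = 2` would give `n = 3` or `n = 4`.
    obtain ⟨i, hi⟩ : ∃ i, k = i + 3 := by
      refine ⟨k - 3, ?_⟩
      by_contra hne
      obtain rfl : k = 2 := by omega
      norm_num at h
      omega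
    subst hi
    rw [show i + 3 - 2 = i + 1 by omega, pow_succ] at e h
    have hi0 := Nat.two_pow_pos i
    rw [(gridRank_values (u := 2 ^ i) (j := i) rfl).2.1 (by omega) (by omega)]
    push_cast
    ring
  · intro h
    have hne := h (j + 3) (by omega)
    rw [show j + 3 - 2 = j + 1 by omega, pow_add, pow_succ, ← hu] at hne
    rw [hlog]
    have hv := gridRank_values (n := n) hu
    -- The excluded value `n = 10u - 2` is the only one whose rank is not given by the leading
    -- digits; at `n = 10u - 1` both formulas agree.
    have hcase : n + 3 ≤ 10 * u ∨ (10 * u ≤ n + 1 ∧ n + 2 ≤ 12 * u) ∨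
        (12 * u ≤ n + 1 ∧ n + 2 ≤ 14 * u) ∨ 14 * u ≤ n + 1 := by omega
    rcases hcase with h3 | h3 | h3 | h3
    · rw [hv.1 h1 h3, bitTerm_eq (d := 4) hu (by omega) (by omega) (by omega) (by omega)]
      push_cast
      ring
    · rw [hv.2.1 (by omega) h3.2, bitTerm_eq (d := 5) hu (by omega) (by omega) (by omega) (by omega)]
      push_cast
      ring
    · rw [hv.2.2.1 h3.1 h3.2, bitTerm_eq (d := 6) hu (by omega) (by omega) (by omega) (by omega)]
      push_cast
      ring
    · rw [hv.2.2.2 h3 (by omega), bitTerm_eq (d := 7) hu (by omega) (by omega) (by omega) (by omega)]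
      push_cast
      ring
  rw [ceil_half_sub (by omega), mem_exceptionalSet_iff hu h1 h2]
  cases j with
  | zero =>
    rw [pow_zero] at hu
    subst hu
    have hv := gridRank_values (n := n) (u := 1) (j := 0) rfl
    refine ⟨fun h => absurd h.1 (by omega), fun _ => ?_⟩
    have hcase : n ≤ 10 ∨ (11 ≤ n ∧ n ≤ 12) ∨ 13 ≤ n := by omega
    rcases hcase with h3 | h3 | h3
    · rw [hv.2.1 (by omega) (by omega), show (n - 3) / 2 = 3 by omega, gridRank_three]
    · rw [hv.2.2.1 (by omega) (by omega), show (n - 3) / 2 = 4 by omega, gridRank_four]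
    · rw [hv.2.2.2 (by omega) (by omega), show (n - 3) / 2 = 5 by omega,
        gridRank_five_six (by omega) (by omega)]
  | succ i =>
    have hv := gridRank_values (n := n) hu
    rw [pow_succ] at hu
    have hw := gridRank_values (n := (n - 3) / 2) (u := 2 ^ i) (j := i) rfl
    -- For `n = 8u - 1` and `n = 8u` the halved width is the last one of the preceding block.
    have hp := gridRank_pred (n := (n - 3) / 2) (u := 2 ^ i) (j := i) rfl
    have hw0 := Nat.two_pow_pos i
    generalize 2 ^ i = w at *
    generalize hg : gridRank 4 n = g at *
    generalize hg' : gridRank 4 ((n - 3) / 2) = g' at *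
    obtain ⟨v1, v2, v3, v4⟩ := hv
    obtain ⟨w1, w2, w3, w4⟩ := hw
    omega
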